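/- **Theorem (The Skeletal MAD is bi-linear).** There are a single program $P$ for random access machines and a constant $c$ such that, for every closed $\lambda$-term $t$ and every run $r : Q_0 \leadsto Q_1 \leadsto \dots \leadsto Q_n$ of the Skeletal MAD from an initial state $Q_0$ of $t$, the program $P$ on input $t$ implements $r$ in time at most $c\cdot |t|\cdot(|r|_\beta+1)$, where $|r|_\beta$ is the number of $\beta$-transitions of $r$ and $|t|$ is the number of constructs of $t$. In short: every Skeletal MAD run $r$ from an initial state of $t$ can be implemented on random access machines in time $O(|t|\cdot(|r|_\beta+1))$. *Skeletal decomposition.* For a term $t$ and a set $\theta$ of variables, $\langle t\rangle_\theta$ is a pair of a term (skeleton) and a list of explicit substitutions (flesh). If $t$ is not a variable and $\mathrm{fv}(t)\cap\theta=\emptyset$, then $\langle t\rangle_\theta:=(z,[z{\leftarrow}t])$ with $z$ fresh. Otherwise $\langle x\rangle_\theta:=(x,\epsilon)$; $\langle\lambda x.u\rangle_\theta:=(\lambda x.s,F)$ where $\langle u\rangle_{\theta\cup\{x\}}=(s,F)$; and $\langle u\,s\rangle_\theta:=(r\,p,\,F::G)$ where $\langle u\rangle_\theta=(r,F)$ and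 $\langle s\rangle_\theta=(p,G)$. A value is an abstraction; the value $\lambda x.t$ has skeleton $\lambda x.u$ and flesh $F$, where $\langle t\rangle_{\{x\}}=(u,F)$. *The machine.* Terms in states are pre-terms (not identified up to $\alpha$). A state $(C\mid t\mid S\mid E)$ consists of a chain $C$ (a list of items $(x,S,E[x{\leftarrow}\cdot])$), a code $t$, a stack $S$ (a list of terms) and an environment $E$ (a list of entries, either explicit substitutions $[x{\leftarrow}t]$ or skeletal substitutions $[\![x{\leftarrow}v]\!]$ with $v$ a value). The initial states of a closed term $t$ are $(\epsilon\mid t'\mid\epsilon\mid\epsilon)$ with $t'$ $\alpha$-equivalent to $t$ and well-bound, i.e. with pairwise distinct bound names. The transitions are, for $v$ a value: - $\mathsf{sea}_1$: $(C\mid tu\mid S\mid E)\leadsto(C\mid t\mid u::S\mid E)$; - $\beta$: $(C\mid\lambda x.t\mid u::S\mid E)\leadsto(C\mid t\mid S\mid[x{\leftarrow}u]::E)$; - $\mathsf{sea}_2$: $(C\mid x\mid S\mid E::[x{\leftarrow}t]::E')\leadsto(C::(x,S,E[x{\leftarrow}\cdot])\mid t\mid\epsilon\mid E')$ if $t$ is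 not a value; - $\mathsf{sea}_3$: $(C::(x,S,E[x{\leftarrow}\cdot])\mid v\mid\epsilon\mid E')\leadsto(C\mid x\mid S\mid E::[x{\leftarrow}v]::E')$; - $\mathsf{sk}$: $(C\mid x\mid S\mid E::[x{\leftarrow}v]::E')\leadsto(C\mid x\mid S\mid E::[\![x{\leftarrow}w]\!]::F::E')$, where $w$ and $F$ are the skeleton and the flesh of $v$, and the variables introduced by the flesh are pairwise distinct and do not occur in the source state; - $\mathsf{ss}$: $(C\mid x\mid S\mid E::[\![x{\leftarrow}v]\!]::E')\leadsto(C\mid w\mid S\mid E::[\![x{\leftarrow}v]\!]::E')$, where $w$ is $\alpha$-equivalent to $v$, well-bound, and its bound names do not occur in the source state. A run is a possibly empty finite sequence of transitions; a state is final if no transition applies. *Random access machines.* A program is a finite list of instructions acting on registers and on a memory, both indexed by $\mathbb N$ and holding natural numbers: load a constant, copy a register, add, subtract (truncated at $0$), load from and store to the memory address held in a register, jump, and jump if a register is $0$. Each executed instruction costs one unit of time; the machine halts when the program counter leaves the program. The input $t$ is given in memory as its prefix serialization with de Bruijn indices (one number per construct), its length is given in register $0$, and everything else is initially $0$. *Implementation.*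 A configuration represents a state $Q$ if, for some assignment of memory locations to names that is injective on the names of $Q$, registers $0$ to $3$ point to the chain, code, stack and environment of $Q$, stored as linked data structures: terms as syntax trees whose variable occurrences are pointers to the location of the variable, stacks as linked lists of pointers to terms, environments as linked lists in which the entry of $x$ is stored at the location of $x$, and chains as linked lists of items. The program $P$ on input $t$ implements $r$ in time $T$ if there are times $\tau_0<\tau_1<\dots<\tau_n\le T$ such that, for every $i$, the configuration of $P$ at time $\tau_i$ represents $Q_i$, and such that, if $Q_n$ is final, $P$ has halted at time $\tau_n$. -/

import Mathlib

/-! ## Pre-terms of the lambda-calculus (terms not identified up to renaming) -/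

/-- Pre-terms of the lambda-calculus, with natural numbers as variable names. -/
inductive PTerm : Type
  | var (x : ℕ) : PTerm
  | lam (x : ℕ) (t : PTerm) : PTerm
  | app (t u : PTerm) : PTerm

namespace PTerm

/-- The size of a pre-term: its number of constructs. -/
def size : PTerm → ℕ
  | var _ => 1
  | lam _ t => size t + 1
  | app t u => size t + size u + 1

/-- Free variables. -/
def fv : PTerm → Finset ℕ
  | var x => {x}
  | lam x t => (fv t).erase x
  | app t u => fv t ∪ fv u

/-- The list of the names of all binders, one per abstraction. -/
def binders : PTerm → List ℕ
  | var _ => []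
  | lam x t => x :: binders t
  | app t u => binders t ++ binders u

/-- All names that occur in a pre-term, in any form. -/
def names : PTerm → List ℕ
  | var x => [x]
  | lam x t => x :: names t
  | app t u => names t ++ names u

/-- Values are the abstractions. -/
def IsValue : PTerm → Prop
  | lam _ _ => True
  | _ => False

def IsVar : PTerm → Prop
  | var _ => True
  | _ => False

/-- A pre-term is well-bound when its bound names are pairwise distinct. -/
def WellBound (t : PTerm) : Prop := t.binders.Nodup

/-- `x` and `y` denote the same variable under the list `l` of paired binders (innermost first). -/
def AlphaVar : List (ℕ × ℕ) → ℕ → ℕ → Prop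
  | [], x, y => x = y
  | (a, b) :: l, x, y => (x = a ∧ y = b) ∨ (x ≠ a ∧ y ≠ b ∧ AlphaVar l x y)

/-- Alpha-equivalence under a list of paired binders. -/
def AlphaIn : List (ℕ × ℕ) → PTerm → PTerm → Prop
  | l, var x, var y => AlphaVar l x y
  | l, lam x t, lam y u => AlphaIn ((x, y) :: l) t u
  | l, app t u, app t' u' => AlphaIn l t t' ∧ AlphaIn l u u'
  | _, _, _ => False

/-- Alpha-equivalence of pre-terms. -/
def Alpha (t u : PTerm) : Prop := AlphaIn [] t u

/-- Serialization, in prefix notation, of a pre-term under a list of binders (innermost first):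
`0` is an abstraction, `1` an application, and `k + 2` an occurrence of the variable bound by the
`k`-th enclosing binder (de Bruijn index `k`). -/
def encodeIn : List ℕ → PTerm → List ℕ
  | l, var x => [l.idxOf x + 2]
  | l, lam x t => 0 :: encodeIn (x :: l) t
  | l, app t u => 1 :: (encodeIn l t ++ encodeIn l u)

/-- Serialization of a closed pre-term; it depends only on its alpha-equivalence class and has
one number per construct. -/
def encode (t : PTerm) : List ℕ := encodeIn [] t

/-- `SkelDec θ t u F`: the pair `(u, F)` is a skeletal decomposition of `t` relative to the set of
variables `θ`, with skeleton `u` and flesh `F = [(x₁, t₁), …, (xₖ, tₖ)]`, which stands for the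
substitution context `⟨·⟩[x₁ ← t₁]…[xₖ ← tₖ]`. The freshness of `x₁, …, xₖ` is required where
the decomposition is used. -/
inductive SkelDec : Finset ℕ → PTerm → PTerm → List (ℕ × PTerm) → Prop
  | extract (θ : Finset ℕ) (t : PTerm) (z : ℕ) (hfree : Disjoint t.fv θ) (hvar : ¬ t.IsVar) :
      SkelDec θ t (var z) [(z, t)]
  | var (θ : Finset ℕ) (x : ℕ) : SkelDec θ (var x) (var x) []
  | lam (θ : Finset ℕ) (x : ℕ) (u s : PTerm) (F : List (ℕ × PTerm))
      (hdep : ¬ Disjoint (PTerm.lam x u).fv θ) (h : SkelDec (insert x θ) u s F) :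
      SkelDec θ (lam x u) (lam x s) F
  | app (θ : Finset ℕ) (u s r p : PTerm) (F G : List (ℕ × PTerm))
      (hdep : ¬ Disjoint (PTerm.app u s).fv θ) (hu : SkelDec θ u r F) (hs : SkelDec θ s p G) :
      SkelDec θ (app u s) (app r p) (F ++ G)

/-- `SkelDecValue v w F`: the value `v` has skeleton `w` and flesh `F`. -/
inductive SkelDecValue : PTerm → PTerm → List (ℕ × PTerm) → Prop
  | mk (x : ℕ) (t u : PTerm) (F : List (ℕ × PTerm)) (h : SkelDec {x} t u F) :
      SkelDecValue (lam x t) (lam x u) F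

end PTerm

/-! ## The Skeletal MAD -/

namespace SMAD

/-- Environment entries: explicit substitutions `[x ← t]` and skeletal substitutions `⟦x ← v⟧`. -/
inductive Entry : Type
  | es (x : ℕ) (t : PTerm) : Entry
  | skel (x : ℕ) (v : PTerm) : Entry

def Entry.names : Entry → List ℕ
  | .es x t => x :: t.names
  | .skel x v => x :: v.names

/-- A chain item `(x, S, E[x ← ·])`. -/
structure ChainItem : Type where
  name : ℕ
  stack : List PTerm
  env : List Entry

def ChainItem.names (i : ChainItem) : List ℕ :=
  i.name :: (i.stack.flatMap PTerm.names ++ i.env.flatMap Entry.names)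

/-- States. The head of the list `chain` is the item that was added last (the rightmost one in
the notation `C :: (x, S, E[x ← ·])`). -/
structure State : Type where
  chain : List ChainItem
  code : PTerm
  stack : List PTerm
  env : List Entry

/-- All names that occur in a state, in any form. -/
def State.names (Q : State) : List ℕ :=
  Q.chain.flatMap ChainItem.names ++ Q.code.names ++ Q.stack.flatMap PTerm.names ++
    Q.env.flatMap Entry.names

/-- Transition labels. -/
inductive Label : Type
  | sea1 | beta | sea2 | sea3 | sk | ss
  deriving DecidableEq

/-- The flesh seen as an environment. -/
def fleshEnv (F : List (ℕ × PTerm)) : List Entry := F.map fun p => Entry.es p.1 p.2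

/-- The labelled transitions of the Skeletal MAD. -/
inductive Step : Label → State → State → Prop
  | sea1 (C : List ChainItem) (t u : PTerm) (S : List PTerm) (E : List Entry) :
      Step .sea1 ⟨C, .app t u, S, E⟩ ⟨C, t, u :: S, E⟩
  | beta (C : List ChainItem) (x : ℕ) (t u : PTerm) (S : List PTerm) (E : List Entry) :
      Step .beta ⟨C, .lam x t, u :: S, E⟩ ⟨C, t, S, .es x u :: E⟩
  | sea2 (C : List ChainItem) (x : ℕ) (t : PTerm) (S : List PTerm) (E E' : List Entry)
      (ht : ¬ t.IsValue) :
      Step .sea2 ⟨C, .var x, S, E ++ .es x t :: E'⟩ ⟨⟨x, S, E⟩ :: C, t, [], E'⟩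
  | sea3 (C : List ChainItem) (x : ℕ) (v : PTerm) (S : List PTerm) (E E' : List Entry)
      (hv : v.IsValue) :
      Step .sea3 ⟨⟨x, S, E⟩ :: C, v, [], E'⟩ ⟨C, .var x, S, E ++ .es x v :: E'⟩
  | sk (C : List ChainItem) (x : ℕ) (v w : PTerm) (F : List (ℕ × PTerm)) (S : List PTerm)
      (E E' : List Entry) (hdec : PTerm.SkelDecValue v w F)
      (hnodup : (F.map Prod.fst).Nodup)
      (hfresh : ∀ z ∈ F.map Prod.fst, z ∉ State.names ⟨C, .var x, S, E ++ .es x v :: E'⟩) :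
      Step .sk ⟨C, .var x, S, E ++ .es x v :: E'⟩
        ⟨C, .var x, S, E ++ .skel x w :: (fleshEnv F ++ E')⟩
  | ss (C : List ChainItem) (x : ℕ) (v w : PTerm) (S : List PTerm) (E E' : List Entry)
      (hv : v.IsValue) (halpha : PTerm.Alpha w v) (hwb : w.WellBound)
      (hfresh : ∀ z ∈ w.binders, z ∉ State.names ⟨C, .var x, S, E ++ .skel x v :: E'⟩) :
      Step .ss ⟨C, .var x, S, E ++ .skel x v :: E'⟩ ⟨C, w, S, E ++ .skel x v :: E'⟩

/-- `Q` is an initial state of `t`: its code is a well-bound renaming of `t`, and the other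
components are empty. -/
def Initial (t : PTerm) (Q : State) : Prop :=
  ∃ u : PTerm, PTerm.Alpha u t ∧ u.WellBound ∧ Q = ⟨[], u, [], []⟩

/-- A state is final if no transition applies. -/
def Final (Q : State) : Prop := ∀ (a : Label) (Q' : State), ¬ Step a Q Q'

/-- A run: a possibly empty finite sequence of transitions. -/
structure Run : Type where
  length : ℕ
  state : Fin (length + 1) → State
  label : Fin length → Label
  step : ∀ i : Fin length, Step (label i) (state i.castSucc) (state i.succ)

namespace Run

def first (r : Run) : State := r.state 0

def last (r : Run) : State := r.state (Fin.last r.length)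

/-- The number of transitions of label `a` in the run `r`. -/
def count (r : Run) (a : Label) : ℕ := (Finset.univ.filter fun i => r.label i = a).card

end Run

end SMAD

/-! ## Random access machines, with uniform cost -/

namespace RAM

/-- Instructions. `R[i]` is the `i`-th register and `M[a]` the memory cell of address `a`. -/
inductive Instr : Type
  /-- `R[i] := k` -/
  | const (i k : ℕ) : Instr
  /-- `R[i] := R[j]` -/
  | move (i j : ℕ) : Instr
  /-- `R[i] := R[j] + R[k]` -/
  | add (i j k : ℕ) : Instr
  /-- `R[i] := max (R[j] - R[k]) 0` -/
  | sub (i j k : ℕ) : Instr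
  /-- `R[i] := M[R[j]]` -/
  | load (i j : ℕ) : Instr
  /-- `M[R[i]] := R[j]` -/
  | store (i j : ℕ) : Instr
  /-- jump to instruction `l` -/
  | jmp (l : ℕ) : Instr
  /-- jump to instruction `l` if `R[i] = 0` -/
  | jz (i l : ℕ) : Instr

/-- Programs are finite lists of instructions, numbered from `0`. -/
abbrev Program : Type := List Instr

structure Config : Type where
  pc : ℕ
  reg : ℕ → ℕ
  mem : ℕ → ℕ

def Instr.exec : Instr → Config → Config
  | const i k, c => ⟨c.pc + 1, Function.update c.reg i k, c.mem⟩
  | move i j, c => ⟨c.pc + 1, Function.update c.reg i (c.reg j), c.mem⟩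
  | add i j k, c => ⟨c.pc + 1, Function.update c.reg i (c.reg j + c.reg k), c.mem⟩
  | sub i j k, c => ⟨c.pc + 1, Function.update c.reg i (c.reg j - c.reg k), c.mem⟩
  | load i j, c => ⟨c.pc + 1, Function.update c.reg i (c.mem (c.reg j)), c.mem⟩
  | store i j, c => ⟨c.pc + 1, c.reg, Function.update c.mem (c.reg i) (c.reg j)⟩
  | jmp l, c => ⟨l, c.reg, c.mem⟩
  | jz i l, c => ⟨if c.reg i = 0 then l else c.pc + 1, c.reg, c.mem⟩

/-- The machine has halted when the program counter has left the program. -/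
def Halted (P : Program) (c : Config) : Prop := P.length ≤ c.pc

/-- One computation step executes one instruction and costs one unit of time. -/
def step (P : Program) (c : Config) : Config :=
  match P[c.pc]? with
  | some ins => ins.exec c
  | none => c

/-- The configuration after `n` units of time. -/
def run (P : Program) (c : Config) (n : ℕ) : Config := (step P)^[n] c

/-- The initial configuration on a given input: register `0` holds the length of the input, the
input is stored from address `0` on, and everything else is `0`. -/
def start (input : List ℕ) : Config where
  pc := 0
  reg := fun i => if i = 0 then input.length else 0
  mem := fun a => input.getD a 0

end RAM

/-! ## Memory representation of the states of the Skeletal MAD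

States are represented by linked data structures. A variable is a memory location, given by a map
`addr` from names to addresses, and its occurrences are pointers to that location. Only the fields
that are mentioned are constrained: records may have additional fields. The null pointer is `0`. -/

namespace SMAD

/-- The pointer `p` represents a term: `0, x` for a variable, `1, x, t` for an abstraction, and
`2, t, u` for an application. -/
def RepTerm (mem addr : ℕ → ℕ) : ℕ → PTerm → Prop
  | p, .var x => mem p = 0 ∧ mem (p + 1) = addr x
  | p, .lam x t => mem p = 1 ∧ mem (p + 1) = addr x ∧ RepTerm mem addr (mem (p + 2)) t
  | p, .app t u =>
      mem p = 2 ∧ RepTerm mem addr (mem (p + 1)) t ∧ RepTerm mem addr (mem (p + 2)) u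

/-- The pointer `p` represents a stack: a linked list of pointers to terms. -/
def RepStack (mem addr : ℕ → ℕ) : ℕ → List PTerm → Prop
  | p, [] => p = 0
  | p, t :: S => p ≠ 0 ∧ RepTerm mem addr (mem p) t ∧ RepStack mem addr (mem (p + 1)) S

/-- The pointer `p` starts a linked list of environment entries that ends at the pointer `q`. The
entry of the variable `x` is stored at the location of `x` and consists of a tag (`1` for an
explicit, `2` for a skeletal substitution), a pointer to a term, and a pointer to the next
entry. -/
def RepEnv (mem addr : ℕ → ℕ) : ℕ → List Entry → ℕ → Prop
  | p, [], q => p = q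
  | p, .es x t :: E, q =>
      p ≠ 0 ∧ p = addr x ∧ mem p = 1 ∧ RepTerm mem addr (mem (p + 1)) t ∧
        RepEnv mem addr (mem (p + 2)) E q
  | p, .skel x v :: E, q =>
      p ≠ 0 ∧ p = addr x ∧ mem p = 2 ∧ RepTerm mem addr (mem (p + 1)) v ∧
        RepEnv mem addr (mem (p + 2)) E q

/-- The pointer `p` represents a chain: a linked list of records made of a variable `x`, a stack,
and an environment, which ends at the location of `x`. -/
def RepChain (mem addr : ℕ → ℕ) : ℕ → List ChainItem → Prop
  | p, [] => p = 0
  | p, i :: C =>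
      p ≠ 0 ∧ mem p = addr i.name ∧ RepStack mem addr (mem (p + 1)) i.stack ∧
        RepEnv mem addr (mem (p + 2)) i.env (addr i.name) ∧ RepChain mem addr (mem (p + 3)) C

/-- The configuration `c` represents the state `Q`: distinct names of `Q` have distinct locations,
and the registers `0`, `1`, `2`, `3` point to the chain, the code, the stack and the environment
of `Q`. -/
def Represents (c : RAM.Config) (Q : State) : Prop :=
  ∃ addr : ℕ → ℕ, Set.InjOn addr {x | x ∈ Q.names} ∧
    RepChain c.mem addr (c.reg 0) Q.chain ∧
    RepTerm c.mem addr (c.reg 1) Q.code ∧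
    RepStack c.mem addr (c.reg 2) Q.stack ∧
    RepEnv c.mem addr (c.reg 3) Q.env 0

/-- The program `P`, started on the input `t`, implements the run `r` in time `T`: within time `T`
it goes, in order, through configurations that represent the successive states of `r`, and it has
halted in the last one if the last state of `r` is final. -/
def Implements (P : RAM.Program) (t : PTerm) (r : Run) (T : ℕ) : Prop :=
  ∃ τ : Fin (r.length + 1) → ℕ, StrictMono τ ∧
    (∀ i, Represents (RAM.run P (RAM.start t.encode) (τ i)) (r.state i)) ∧
    τ (Fin.last r.length) ≤ T ∧
    (Final r.last → RAM.Halted P (RAM.run P (RAM.start t.encode) (τ (Fin.last r.length))))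

end SMAD

/-! The program keeps every state as a shared linked structure. Terms are immutable and are passed
around by pointers, so $\mathsf{sea}_1$, $\beta$, $\mathsf{sea}_2$ and $\mathsf{sea}_3$ take a
constant number of instructions: a variable occurrence points to the record of its variable, and
that record is also the place of its environment entry, so no search is needed. Only $\mathsf{sk}$
and $\mathsf{ss}$ traverse a term. All terms of a reachable state have size at most $n=|t|$
(`WF.step`), so these two cost $O(n)$ once renaming and decomposition are shown to be linear.

Both linear algorithms use the fourth word of a variable record, its mark. For renaming (`copy_run`)
the mark of a binder holds the address of its new variable, and $0$ means that the variable is not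
renamed. For decomposition (`dec_run`) binders receive decreasing positive marks from the outside
in, variables not in $\theta$ have mark $0$, and each subterm returns the largest mark of its free
variables. That number decides whether the subterm meets $\theta$: for an application it must be
$0$; for an abstraction it must not exceed the mark of its own binder, because every enclosing
binder has a larger one. No set of free variables is ever computed. Marks of binders may be left
dirty, but marks of variables bound by the environment or the chain are $0$; this is part of the
simulation relation `Sim`.

The memory is handled as in separation logic. A partial map `G` fixes the words that will not change
again (terms, stacks, chain items, frames); variable records stay outside `G`. Records are aligned
at multiples of four, so different records are disjoint. A run chooses fresh names arbitrarily while
the program allocates addresses; `Fresh` extends the assignment of addresses to whatever names the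
run has chosen, so one deterministic program follows all runs.

The global bound is amortized (`potential_step`). The load, i.e. the total size of the terms that
are not skeletal entries, pays one construct for each constant-time transition, and each
$\mathsf{ss}$ puts back at most $n$. The weight bounds the number of $\mathsf{sk}$, $\mathsf{ss}$
and $\mathsf{sea}_3$ until the next $\beta$: evaluating a lookup ends in an abstraction, which meets
an argument (and $\beta$ fires) or returns to the chain. Sequences of entries binding variables to
variables are the only danger; such entries are created by $\beta$ alone, since flesh never consists
of variables, and each is replaced by a value once evaluated. So a $\beta$ raises the weight by a
constant, and the total time is $O(n\cdot(|r|_\beta+1))$. -/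

open Function
-- The program and its symbolic execution
namespace RAM

/-- An implementation of the Skeletal MAD. Registers `0` to `3` hold the components of the state,
`4` the heap pointer, `5` the size of the input, `10` the top of a linked stack of frames, `11` the
argument and `12` the result of the recursive routines, `20` tells whether terms are read from the
input (`0`) or copied (`1`), and `6`, `7`, `8`, `9`, `21` hold the constants `1`, `2`, `3`, `4`,
`0`. All heap records have four words. -/
def prog : Program := [
  -- 0: initialization
  .move 5 0, .const 0 0, .const 6 1, .const 7 2, .const 8 3, .const 9 4, .add 4 5 5, .add 4 4 4,
  -- 8: build the term that register `11` points to, or the next term of the input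
  .jz 20 29, .load 16 11, .add 17 11 6, .load 17 17, .jz 16 20, .add 18 11 7, .load 11 18,
  .sub 16 16 6, .jz 16 26, .move 18 11, .move 11 17, .jmp 84,
  -- 20: copy a variable
  .move 16 17, .add 17 17 8, .load 17 17, .jz 17 36, .move 16 17, .jmp 36,
  -- 26: copy an abstraction
  .add 17 17 8, .store 17 4, .jmp 73,
  -- 29: read a term from the input
  .load 16 14, .add 14 14 6, .jz 16 72, .sub 16 16 6, .jz 16 84, .sub 16 15 16, .load 16 16,
  -- 36: make a variable
  .store 4 21, .add 17 4 6, .store 17 16, .move 12 4, .add 4 4 9,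
  -- 41: a term has been built: pop a frame
  .jz 10 92, .load 16 10, .add 17 10 6, .load 17 17, .add 18 10 7, .load 18 18, .jz 16 53,
  .sub 16 16 6, .jz 16 63, .move 10 18, .store 4 7, .jmp 56,
  -- 53: its parent is an abstraction
  .move 10 18, .sub 15 15 6, .store 4 6,
  -- 56: make an abstraction or an application
  .add 18 4 6, .store 18 17, .add 18 4 7, .store 18 12, .move 12 4, .add 4 4 9, .jmp 41,
  -- 63: it is the left child of an application
  .move 11 17, .store 4 7, .add 17 4 6, .store 17 12, .add 17 4 7, .store 17 18, .move 10 4,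
  .add 4 4 9, .jmp 8,
  -- 72: read an abstraction
  .store 15 4,
  -- 73: make a new variable and push a frame
  .move 16 4, .add 4 4 9, .store 4 21, .add 17 4 6, .store 17 16, .add 17 4 7, .store 17 10,
  .move 10 4, .add 4 4 9, .add 15 15 6, .jmp 8,
  -- 84: push the frame of an application
  .store 4 6, .add 17 4 6, .store 17 18, .add 17 4 7, .store 17 10, .move 10 4, .add 4 4 9,
  .jmp 8,
  -- 92: the whole term has been built
  .move 1 12,
  -- 93: main loop
  .load 16 1, .add 17 1 6, .load 17 17, .jz 16 142, .add 18 1 7, .load 18 18, .sub 16 16 6,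
  .jz 16 108, .move 1 17, .store 4 18, .add 17 4 6, .store 17 2, .move 2 4, .add 4 4 9, .jmp 93,
  -- 108: the code is an abstraction
  .jz 2 122, .move 1 18, .load 16 2, .add 18 2 6, .load 2 18, .store 17 6, .add 18 17 6,
  .store 18 16, .add 18 17 7, .store 18 3, .add 18 17 8, .store 18 21, .move 3 17, .jmp 93,
  -- 122: and the stack is empty
  .jz 0 294, .load 19 0, .add 16 0 6, .load 2 16, .add 16 0 7, .load 16 16, .add 17 0 8,
  .load 0 17, .store 19 6, .add 17 19 6, .store 17 1, .add 17 19 7, .store 17 3, .move 3 16,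
  .store 4 21, .add 17 4 6, .store 17 19, .move 1 4, .add 4 4 9, .jmp 93,
  -- 142: the code is a variable
  .move 19 17, .load 16 17, .add 17 17 6, .load 22 17, .sub 16 16 6, .jz 16 152, .const 20 1,
  .move 11 22, .const 10 0, .jmp 8,
  -- 152: with an explicit substitution
  .load 16 22, .jz 16 156, .sub 16 16 6, .jz 16 171,
  -- 156: of a term that is not a value
  .add 17 19 7, .load 17 17, .store 4 19, .add 16 4 6, .store 16 2, .add 16 4 7, .store 16 3,
  .add 16 4 8, .store 16 0, .move 0 4, .add 4 4 9, .const 2 0, .move 3 17, .move 1 22, .jmp 93,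
  -- 171: of a value
  .add 17 19 7, .load 15 17, .add 17 22 7, .load 11 17, .add 17 22 6, .load 17 17, .add 17 17 8,
  .store 17 5, .sub 14 5 6, .const 10 0,
  -- 181: decompose the term that register `11` points to
  .load 16 11, .add 17 11 6, .load 17 17, .jz 16 208, .add 18 11 7, .load 18 18, .sub 16 16 6,
  .jz 16 194, .store 4 21, .add 17 4 6, .store 17 11, .move 11 18, .jmp 201,
  -- 194: decompose an abstraction
  .add 17 17 8, .store 17 14, .store 4 6, .add 17 4 6, .store 17 11, .move 11 18, .sub 14 14 6,
  -- 201: push a frame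
  .add 17 4 7, .store 17 15, .add 17 4 8, .store 17 10, .move 10 4, .add 4 4 9, .jmp 181,
  -- 208: decompose a variable
  .move 12 11, .add 17 17 8, .load 13 17,
  -- 211: a term has been decomposed: pop a frame
  .jz 10 280, .load 16 10, .add 17 10 6, .load 17 17, .add 18 10 7, .load 18 18, .add 23 10 8,
  .load 23 23, .jz 16 268, .sub 16 16 6, .jz 16 238, .sub 18 18 13, .add 13 13 18, .move 24 17,
  .add 17 23 6, .load 17 17, .add 18 23 7, .load 18 18, .add 23 23 8, .load 10 23, .jz 13 252,
  .store 4 7, .add 17 4 6, .store 17 12, .add 17 4 7, .store 17 24, .jmp 249,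
  -- 238: its parent is an abstraction
  .move 10 23, .add 14 14 6, .sub 16 13 14, .jz 16 252, .add 17 17 6, .load 17 17, .store 4 6,
  .add 18 4 6, .store 18 17, .add 18 4 7, .store 18 12,
  -- 249: return the skeleton
  .move 12 4, .add 4 4 9, .jmp 211,
  -- 252: extract the parent
  .store 4 6, .add 16 4 6, .store 16 17, .add 16 4 7, .store 16 18, .add 16 4 8, .store 16 21,
  .move 15 4, .add 4 4 9, .store 4 21, .add 16 4 6, .store 16 15, .move 12 4, .add 4 4 9,
  .const 13 0, .jmp 211,
  -- 268: it is the right child of an application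
  .add 17 17 6, .load 11 17, .store 4 7, .add 17 4 6, .store 17 12, .add 17 4 7, .store 17 13,
  .add 17 4 8, .store 17 10, .move 10 4, .add 4 4 9, .jmp 181,
  -- 280: the whole value has been decomposed
  .add 17 22 6, .load 17 17, .store 4 6, .add 18 4 6, .store 18 17, .add 18 4 7, .store 18 12,
  .store 19 7, .add 18 19 6, .store 18 4, .add 18 19 7, .store 18 15, .add 4 4 9, .jmp 93]

theorem run_succ (P : Program) (c : Config) (k : ℕ) : run P c (k + 1) = run P (step P c) k := rfl

theorem run_zero (P : Program) (c : Config) : run P c 0 = c := rfl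

theorem run_add (P : Program) (c : Config) (j k : ℕ) : run P c (j + k) = run P (run P c j) k := by
  simp only [run, Nat.add_comm j k, Function.iterate_add_apply]

theorem run_trans {P : Program} {c c' c'' : Config} {j k : ℕ} (h : run P c j = c')
    (h' : run P c' k = c'') : run P c (j + k) = c'' := by
  rw [run_add, h, h']

-- One rewriting rule per instruction lets `simp` run straight-line code symbolically. Once these
-- rules are available, `prog` is made irreducible so that its list is not unfolded again.
@[simp] theorem step0 (r m : ℕ → ℕ) : step prog ⟨0, r, m⟩ = ⟨1, update r 5 (r 0), m⟩ := rfl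
@[simp] theorem step1 (r m : ℕ → ℕ) : step prog ⟨1, r, m⟩ = ⟨2, update r 0 0, m⟩ := rfl
@[simp] theorem step2 (r m : ℕ → ℕ) : step prog ⟨2, r, m⟩ = ⟨3, update r 6 1, m⟩ := rfl
@[simp] theorem step3 (r m : ℕ → ℕ) : step prog ⟨3, r, m⟩ = ⟨4, update r 7 2, m⟩ := rfl
@[simp] theorem step4 (r m : ℕ → ℕ) : step prog ⟨4, r, m⟩ = ⟨5, update r 8 3, m⟩ := rfl
@[simp] theorem step5 (r m : ℕ → ℕ) : step prog ⟨5, r, m⟩ = ⟨6, update r 9 4, m⟩ := rfl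
@[simp] theorem step6 (r m : ℕ → ℕ) : step prog ⟨6, r, m⟩ = ⟨7, update r 4 (r 5 + r 5), m⟩ := rfl
@[simp] theorem step7 (r m : ℕ → ℕ) : step prog ⟨7, r, m⟩ = ⟨8, update r 4 (r 4 + r 4), m⟩ := rfl
@[simp] theorem step8 (r m : ℕ → ℕ) : step prog ⟨8, r, m⟩ = ⟨if r 20 = 0 then 29 else 9, r, m⟩ := rfl
@[simp] theorem step9 (r m : ℕ → ℕ) : step prog ⟨9, r, m⟩ = ⟨10, update r 16 (m (r 11)), m⟩ := rfl
@[simp] theorem step10 (r m : ℕ → ℕ) : step prog ⟨10, r, m⟩ = ⟨11, update r 17 (r 11 + r 6), m⟩ := rfl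
@[simp] theorem step11 (r m : ℕ → ℕ) : step prog ⟨11, r, m⟩ = ⟨12, update r 17 (m (r 17)), m⟩ := rfl
@[simp] theorem step12 (r m : ℕ → ℕ) : step prog ⟨12, r, m⟩ = ⟨if r 16 = 0 then 20 else 13, r, m⟩ := rfl
@[simp] theorem step13 (r m : ℕ → ℕ) : step prog ⟨13, r, m⟩ = ⟨14, update r 18 (r 11 + r 7), m⟩ := rfl
@[simp] theorem step14 (r m : ℕ → ℕ) : step prog ⟨14, r, m⟩ = ⟨15, update r 11 (m (r 18)), m⟩ := rfl
@[simp] theorem step15 (r m : ℕ → ℕ) : step prog ⟨15, r, m⟩ = ⟨16, update r 16 (r 16 - r 6), m⟩ := rfl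
@[simp] theorem step16 (r m : ℕ → ℕ) : step prog ⟨16, r, m⟩ = ⟨if r 16 = 0 then 26 else 17, r, m⟩ := rfl
@[simp] theorem step17 (r m : ℕ → ℕ) : step prog ⟨17, r, m⟩ = ⟨18, update r 18 (r 11), m⟩ := rfl
@[simp] theorem step18 (r m : ℕ → ℕ) : step prog ⟨18, r, m⟩ = ⟨19, update r 11 (r 17), m⟩ := rfl
@[simp] theorem step19 (r m : ℕ → ℕ) : step prog ⟨19, r, m⟩ = ⟨84, r, m⟩ := rfl
@[simp] theorem step20 (r m : ℕ → ℕ) : step prog ⟨20, r, m⟩ = ⟨21, update r 16 (r 17), m⟩ := rfl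
@[simp] theorem step21 (r m : ℕ → ℕ) : step prog ⟨21, r, m⟩ = ⟨22, update r 17 (r 17 + r 8), m⟩ := rfl
@[simp] theorem step22 (r m : ℕ → ℕ) : step prog ⟨22, r, m⟩ = ⟨23, update r 17 (m (r 17)), m⟩ := rfl
@[simp] theorem step23 (r m : ℕ → ℕ) : step prog ⟨23, r, m⟩ = ⟨if r 17 = 0 then 36 else 24, r, m⟩ := rfl
@[simp] theorem step24 (r m : ℕ → ℕ) : step prog ⟨24, r, m⟩ = ⟨25, update r 16 (r 17), m⟩ := rfl
@[simp] theorem step25 (r m : ℕ → ℕ) : step prog ⟨25, r, m⟩ = ⟨36, r, m⟩ := rfl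
@[simp] theorem step26 (r m : ℕ → ℕ) : step prog ⟨26, r, m⟩ = ⟨27, update r 17 (r 17 + r 8), m⟩ := rfl
@[simp] theorem step27 (r m : ℕ → ℕ) : step prog ⟨27, r, m⟩ = ⟨28, r, update m (r 17) (r 4)⟩ := rfl
@[simp] theorem step28 (r m : ℕ → ℕ) : step prog ⟨28, r, m⟩ = ⟨73, r, m⟩ := rfl
@[simp] theorem step29 (r m : ℕ → ℕ) : step prog ⟨29, r, m⟩ = ⟨30, update r 16 (m (r 14)), m⟩ := rfl
@[simp] theorem step30 (r m : ℕ → ℕ) : step prog ⟨30, r, m⟩ = ⟨31, update r 14 (r 14 + r 6), m⟩ := rfl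
@[simp] theorem step31 (r m : ℕ → ℕ) : step prog ⟨31, r, m⟩ = ⟨if r 16 = 0 then 72 else 32, r, m⟩ := rfl
@[simp] theorem step32 (r m : ℕ → ℕ) : step prog ⟨32, r, m⟩ = ⟨33, update r 16 (r 16 - r 6), m⟩ := rfl
@[simp] theorem step33 (r m : ℕ → ℕ) : step prog ⟨33, r, m⟩ = ⟨if r 16 = 0 then 84 else 34, r, m⟩ := rfl
@[simp] theorem step34 (r m : ℕ → ℕ) : step prog ⟨34, r, m⟩ = ⟨35, update r 16 (r 15 - r 16), m⟩ := rfl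
@[simp] theorem step35 (r m : ℕ → ℕ) : step prog ⟨35, r, m⟩ = ⟨36, update r 16 (m (r 16)), m⟩ := rfl
@[simp] theorem step36 (r m : ℕ → ℕ) : step prog ⟨36, r, m⟩ = ⟨37, r, update m (r 4) (r 21)⟩ := rfl
@[simp] theorem step37 (r m : ℕ → ℕ) : step prog ⟨37, r, m⟩ = ⟨38, update r 17 (r 4 + r 6), m⟩ := rfl
@[simp] theorem step38 (r m : ℕ → ℕ) : step prog ⟨38, r, m⟩ = ⟨39, r, update m (r 17) (r 16)⟩ := rfl
@[simp] theorem step39 (r m : ℕ → ℕ) : step prog ⟨39, r, m⟩ = ⟨40, update r 12 (r 4), m⟩ := rfl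
@[simp] theorem step40 (r m : ℕ → ℕ) : step prog ⟨40, r, m⟩ = ⟨41, update r 4 (r 4 + r 9), m⟩ := rfl
@[simp] theorem step41 (r m : ℕ → ℕ) : step prog ⟨41, r, m⟩ = ⟨if r 10 = 0 then 92 else 42, r, m⟩ := rfl
@[simp] theorem step42 (r m : ℕ → ℕ) : step prog ⟨42, r, m⟩ = ⟨43, update r 16 (m (r 10)), m⟩ := rfl
@[simp] theorem step43 (r m : ℕ → ℕ) : step prog ⟨43, r, m⟩ = ⟨44, update r 17 (r 10 + r 6), m⟩ := rfl
@[simp] theorem step44 (r m : ℕ → ℕ) : step prog ⟨44, r, m⟩ = ⟨45, update r 17 (m (r 17)), m⟩ := rfl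
@[simp] theorem step45 (r m : ℕ → ℕ) : step prog ⟨45, r, m⟩ = ⟨46, update r 18 (r 10 + r 7), m⟩ := rfl
@[simp] theorem step46 (r m : ℕ → ℕ) : step prog ⟨46, r, m⟩ = ⟨47, update r 18 (m (r 18)), m⟩ := rfl
@[simp] theorem step47 (r m : ℕ → ℕ) : step prog ⟨47, r, m⟩ = ⟨if r 16 = 0 then 53 else 48, r, m⟩ := rfl
@[simp] theorem step48 (r m : ℕ → ℕ) : step prog ⟨48, r, m⟩ = ⟨49, update r 16 (r 16 - r 6), m⟩ := rfl
@[simp] theorem step49 (r m : ℕ → ℕ) : step prog ⟨49, r, m⟩ = ⟨if r 16 = 0 then 63 else 50, r, m⟩ := rfl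
@[simp] theorem step50 (r m : ℕ → ℕ) : step prog ⟨50, r, m⟩ = ⟨51, update r 10 (r 18), m⟩ := rfl
@[simp] theorem step51 (r m : ℕ → ℕ) : step prog ⟨51, r, m⟩ = ⟨52, r, update m (r 4) (r 7)⟩ := rfl
@[simp] theorem step52 (r m : ℕ → ℕ) : step prog ⟨52, r, m⟩ = ⟨56, r, m⟩ := rfl
@[simp] theorem step53 (r m : ℕ → ℕ) : step prog ⟨53, r, m⟩ = ⟨54, update r 10 (r 18), m⟩ := rfl
@[simp] theorem step54 (r m : ℕ → ℕ) : step prog ⟨54, r, m⟩ = ⟨55, update r 15 (r 15 - r 6), m⟩ := rfl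
@[simp] theorem step55 (r m : ℕ → ℕ) : step prog ⟨55, r, m⟩ = ⟨56, r, update m (r 4) (r 6)⟩ := rfl
@[simp] theorem step56 (r m : ℕ → ℕ) : step prog ⟨56, r, m⟩ = ⟨57, update r 18 (r 4 + r 6), m⟩ := rfl
@[simp] theorem step57 (r m : ℕ → ℕ) : step prog ⟨57, r, m⟩ = ⟨58, r, update m (r 18) (r 17)⟩ := rfl
@[simp] theorem step58 (r m : ℕ → ℕ) : step prog ⟨58, r, m⟩ = ⟨59, update r 18 (r 4 + r 7), m⟩ := rfl
@[simp] theorem step59 (r m : ℕ → ℕ) : step prog ⟨59, r, m⟩ = ⟨60, r, update m (r 18) (r 12)⟩ := rfl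
@[simp] theorem step60 (r m : ℕ → ℕ) : step prog ⟨60, r, m⟩ = ⟨61, update r 12 (r 4), m⟩ := rfl
@[simp] theorem step61 (r m : ℕ → ℕ) : step prog ⟨61, r, m⟩ = ⟨62, update r 4 (r 4 + r 9), m⟩ := rfl
@[simp] theorem step62 (r m : ℕ → ℕ) : step prog ⟨62, r, m⟩ = ⟨41, r, m⟩ := rfl
@[simp] theorem step63 (r m : ℕ → ℕ) : step prog ⟨63, r, m⟩ = ⟨64, update r 11 (r 17), m⟩ := rfl
@[simp] theorem step64 (r m : ℕ → ℕ) : step prog ⟨64, r, m⟩ = ⟨65, r, update m (r 4) (r 7)⟩ := rfl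
@[simp] theorem step65 (r m : ℕ → ℕ) : step prog ⟨65, r, m⟩ = ⟨66, update r 17 (r 4 + r 6), m⟩ := rfl
@[simp] theorem step66 (r m : ℕ → ℕ) : step prog ⟨66, r, m⟩ = ⟨67, r, update m (r 17) (r 12)⟩ := rfl
@[simp] theorem step67 (r m : ℕ → ℕ) : step prog ⟨67, r, m⟩ = ⟨68, update r 17 (r 4 + r 7), m⟩ := rfl
@[simp] theorem step68 (r m : ℕ → ℕ) : step prog ⟨68, r, m⟩ = ⟨69, r, update m (r 17) (r 18)⟩ := rfl
@[simp] theorem step69 (r m : ℕ → ℕ) : step prog ⟨69, r, m⟩ = ⟨70, update r 10 (r 4), m⟩ := rfl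
@[simp] theorem step70 (r m : ℕ → ℕ) : step prog ⟨70, r, m⟩ = ⟨71, update r 4 (r 4 + r 9), m⟩ := rfl
@[simp] theorem step71 (r m : ℕ → ℕ) : step prog ⟨71, r, m⟩ = ⟨8, r, m⟩ := rfl
@[simp] theorem step72 (r m : ℕ → ℕ) : step prog ⟨72, r, m⟩ = ⟨73, r, update m (r 15) (r 4)⟩ := rfl
@[simp] theorem step73 (r m : ℕ → ℕ) : step prog ⟨73, r, m⟩ = ⟨74, update r 16 (r 4), m⟩ := rfl
@[simp] theorem step74 (r m : ℕ → ℕ) : step prog ⟨74, r, m⟩ = ⟨75, update r 4 (r 4 + r 9), m⟩ := rfl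
@[simp] theorem step75 (r m : ℕ → ℕ) : step prog ⟨75, r, m⟩ = ⟨76, r, update m (r 4) (r 21)⟩ := rfl
@[simp] theorem step76 (r m : ℕ → ℕ) : step prog ⟨76, r, m⟩ = ⟨77, update r 17 (r 4 + r 6), m⟩ := rfl
@[simp] theorem step77 (r m : ℕ → ℕ) : step prog ⟨77, r, m⟩ = ⟨78, r, update m (r 17) (r 16)⟩ := rfl
@[simp] theorem step78 (r m : ℕ → ℕ) : step prog ⟨78, r, m⟩ = ⟨79, update r 17 (r 4 + r 7), m⟩ := rfl
@[simp] theorem step79 (r m : ℕ → ℕ) : step prog ⟨79, r, m⟩ = ⟨80, r, update m (r 17) (r 10)⟩ := rfl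
@[simp] theorem step80 (r m : ℕ → ℕ) : step prog ⟨80, r, m⟩ = ⟨81, update r 10 (r 4), m⟩ := rfl
@[simp] theorem step81 (r m : ℕ → ℕ) : step prog ⟨81, r, m⟩ = ⟨82, update r 4 (r 4 + r 9), m⟩ := rfl
@[simp] theorem step82 (r m : ℕ → ℕ) : step prog ⟨82, r, m⟩ = ⟨83, update r 15 (r 15 + r 6), m⟩ := rfl
@[simp] theorem step83 (r m : ℕ → ℕ) : step prog ⟨83, r, m⟩ = ⟨8, r, m⟩ := rfl
@[simp] theorem step84 (r m : ℕ → ℕ) : step prog ⟨84, r, m⟩ = ⟨85, r, update m (r 4) (r 6)⟩ := rfl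
@[simp] theorem step85 (r m : ℕ → ℕ) : step prog ⟨85, r, m⟩ = ⟨86, update r 17 (r 4 + r 6), m⟩ := rfl
@[simp] theorem step86 (r m : ℕ → ℕ) : step prog ⟨86, r, m⟩ = ⟨87, r, update m (r 17) (r 18)⟩ := rfl
@[simp] theorem step87 (r m : ℕ → ℕ) : step prog ⟨87, r, m⟩ = ⟨88, update r 17 (r 4 + r 7), m⟩ := rfl
@[simp] theorem step88 (r m : ℕ → ℕ) : step prog ⟨88, r, m⟩ = ⟨89, r, update m (r 17) (r 10)⟩ := rfl
@[simp] theorem step89 (r m : ℕ → ℕ) : step prog ⟨89, r, m⟩ = ⟨90, update r 10 (r 4), m⟩ := rfl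
@[simp] theorem step90 (r m : ℕ → ℕ) : step prog ⟨90, r, m⟩ = ⟨91, update r 4 (r 4 + r 9), m⟩ := rfl
@[simp] theorem step91 (r m : ℕ → ℕ) : step prog ⟨91, r, m⟩ = ⟨8, r, m⟩ := rfl
@[simp] theorem step92 (r m : ℕ → ℕ) : step prog ⟨92, r, m⟩ = ⟨93, update r 1 (r 12), m⟩ := rfl
@[simp] theorem step93 (r m : ℕ → ℕ) : step prog ⟨93, r, m⟩ = ⟨94, update r 16 (m (r 1)), m⟩ := rfl
@[simp] theorem step94 (r m : ℕ → ℕ) : step prog ⟨94, r, m⟩ = ⟨95, update r 17 (r 1 + r 6), m⟩ := rfl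
@[simp] theorem step95 (r m : ℕ → ℕ) : step prog ⟨95, r, m⟩ = ⟨96, update r 17 (m (r 17)), m⟩ := rfl
@[simp] theorem step96 (r m : ℕ → ℕ) : step prog ⟨96, r, m⟩ = ⟨if r 16 = 0 then 142 else 97, r, m⟩ := rfl
@[simp] theorem step97 (r m : ℕ → ℕ) : step prog ⟨97, r, m⟩ = ⟨98, update r 18 (r 1 + r 7), m⟩ := rfl
@[simp] theorem step98 (r m : ℕ → ℕ) : step prog ⟨98, r, m⟩ = ⟨99, update r 18 (m (r 18)), m⟩ := rfl
@[simp] theorem step99 (r m : ℕ → ℕ) : step prog ⟨99, r, m⟩ = ⟨100, update r 16 (r 16 - r 6), m⟩ := rfl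
@[simp] theorem step100 (r m : ℕ → ℕ) : step prog ⟨100, r, m⟩ = ⟨if r 16 = 0 then 108 else 101, r, m⟩ := rfl
@[simp] theorem step101 (r m : ℕ → ℕ) : step prog ⟨101, r, m⟩ = ⟨102, update r 1 (r 17), m⟩ := rfl
@[simp] theorem step102 (r m : ℕ → ℕ) : step prog ⟨102, r, m⟩ = ⟨103, r, update m (r 4) (r 18)⟩ := rfl
@[simp] theorem step103 (r m : ℕ → ℕ) : step prog ⟨103, r, m⟩ = ⟨104, update r 17 (r 4 + r 6), m⟩ := rfl
@[simp] theorem step104 (r m : ℕ → ℕ) : step prog ⟨104, r, m⟩ = ⟨105, r, update m (r 17) (r 2)⟩ := rfl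
@[simp] theorem step105 (r m : ℕ → ℕ) : step prog ⟨105, r, m⟩ = ⟨106, update r 2 (r 4), m⟩ := rfl
@[simp] theorem step106 (r m : ℕ → ℕ) : step prog ⟨106, r, m⟩ = ⟨107, update r 4 (r 4 + r 9), m⟩ := rfl
@[simp] theorem step107 (r m : ℕ → ℕ) : step prog ⟨107, r, m⟩ = ⟨93, r, m⟩ := rfl
@[simp] theorem step108 (r m : ℕ → ℕ) : step prog ⟨108, r, m⟩ = ⟨if r 2 = 0 then 122 else 109, r, m⟩ := rfl
@[simp] theorem step109 (r m : ℕ → ℕ) : step prog ⟨109, r, m⟩ = ⟨110, update r 1 (r 18), m⟩ := rfl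
@[simp] theorem step110 (r m : ℕ → ℕ) : step prog ⟨110, r, m⟩ = ⟨111, update r 16 (m (r 2)), m⟩ := rfl
@[simp] theorem step111 (r m : ℕ → ℕ) : step prog ⟨111, r, m⟩ = ⟨112, update r 18 (r 2 + r 6), m⟩ := rfl
@[simp] theorem step112 (r m : ℕ → ℕ) : step prog ⟨112, r, m⟩ = ⟨113, update r 2 (m (r 18)), m⟩ := rfl
@[simp] theorem step113 (r m : ℕ → ℕ) : step prog ⟨113, r, m⟩ = ⟨114, r, update m (r 17) (r 6)⟩ := rfl
@[simp] theorem step114 (r m : ℕ → ℕ) : step prog ⟨114, r, m⟩ = ⟨115, update r 18 (r 17 + r 6), m⟩ := rfl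
@[simp] theorem step115 (r m : ℕ → ℕ) : step prog ⟨115, r, m⟩ = ⟨116, r, update m (r 18) (r 16)⟩ := rfl
@[simp] theorem step116 (r m : ℕ → ℕ) : step prog ⟨116, r, m⟩ = ⟨117, update r 18 (r 17 + r 7), m⟩ := rfl
@[simp] theorem step117 (r m : ℕ → ℕ) : step prog ⟨117, r, m⟩ = ⟨118, r, update m (r 18) (r 3)⟩ := rfl
@[simp] theorem step118 (r m : ℕ → ℕ) : step prog ⟨118, r, m⟩ = ⟨119, update r 18 (r 17 + r 8), m⟩ := rfl
@[simp] theorem step119 (r m : ℕ → ℕ) : step prog ⟨119, r, m⟩ = ⟨120, r, update m (r 18) (r 21)⟩ := rfl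
@[simp] theorem step120 (r m : ℕ → ℕ) : step prog ⟨120, r, m⟩ = ⟨121, update r 3 (r 17), m⟩ := rfl
@[simp] theorem step121 (r m : ℕ → ℕ) : step prog ⟨121, r, m⟩ = ⟨93, r, m⟩ := rfl
@[simp] theorem step122 (r m : ℕ → ℕ) : step prog ⟨122, r, m⟩ = ⟨if r 0 = 0 then 294 else 123, r, m⟩ := rfl
@[simp] theorem step123 (r m : ℕ → ℕ) : step prog ⟨123, r, m⟩ = ⟨124, update r 19 (m (r 0)), m⟩ := rfl
@[simp] theorem step124 (r m : ℕ → ℕ) : step prog ⟨124, r, m⟩ = ⟨125, update r 16 (r 0 + r 6), m⟩ := rfl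
@[simp] theorem step125 (r m : ℕ → ℕ) : step prog ⟨125, r, m⟩ = ⟨126, update r 2 (m (r 16)), m⟩ := rfl
@[simp] theorem step126 (r m : ℕ → ℕ) : step prog ⟨126, r, m⟩ = ⟨127, update r 16 (r 0 + r 7), m⟩ := rfl
@[simp] theorem step127 (r m : ℕ → ℕ) : step prog ⟨127, r, m⟩ = ⟨128, update r 16 (m (r 16)), m⟩ := rfl
@[simp] theorem step128 (r m : ℕ → ℕ) : step prog ⟨128, r, m⟩ = ⟨129, update r 17 (r 0 + r 8), m⟩ := rfl
@[simp] theorem step129 (r m : ℕ → ℕ) : step prog ⟨129, r, m⟩ = ⟨130, update r 0 (m (r 17)), m⟩ := rfl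
@[simp] theorem step130 (r m : ℕ → ℕ) : step prog ⟨130, r, m⟩ = ⟨131, r, update m (r 19) (r 6)⟩ := rfl
@[simp] theorem step131 (r m : ℕ → ℕ) : step prog ⟨131, r, m⟩ = ⟨132, update r 17 (r 19 + r 6), m⟩ := rfl
@[simp] theorem step132 (r m : ℕ → ℕ) : step prog ⟨132, r, m⟩ = ⟨133, r, update m (r 17) (r 1)⟩ := rfl
@[simp] theorem step133 (r m : ℕ → ℕ) : step prog ⟨133, r, m⟩ = ⟨134, update r 17 (r 19 + r 7), m⟩ := rfl
@[simp] theorem step134 (r m : ℕ → ℕ) : step prog ⟨134, r, m⟩ = ⟨135, r, update m (r 17) (r 3)⟩ := rfl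
@[simp] theorem step135 (r m : ℕ → ℕ) : step prog ⟨135, r, m⟩ = ⟨136, update r 3 (r 16), m⟩ := rfl
@[simp] theorem step136 (r m : ℕ → ℕ) : step prog ⟨136, r, m⟩ = ⟨137, r, update m (r 4) (r 21)⟩ := rfl
@[simp] theorem step137 (r m : ℕ → ℕ) : step prog ⟨137, r, m⟩ = ⟨138, update r 17 (r 4 + r 6), m⟩ := rfl
@[simp] theorem step138 (r m : ℕ → ℕ) : step prog ⟨138, r, m⟩ = ⟨139, r, update m (r 17) (r 19)⟩ := rfl
@[simp] theorem step139 (r m : ℕ → ℕ) : step prog ⟨139, r, m⟩ = ⟨140, update r 1 (r 4), m⟩ := rfl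
@[simp] theorem step140 (r m : ℕ → ℕ) : step prog ⟨140, r, m⟩ = ⟨141, update r 4 (r 4 + r 9), m⟩ := rfl
@[simp] theorem step141 (r m : ℕ → ℕ) : step prog ⟨141, r, m⟩ = ⟨93, r, m⟩ := rfl
@[simp] theorem step142 (r m : ℕ → ℕ) : step prog ⟨142, r, m⟩ = ⟨143, update r 19 (r 17), m⟩ := rfl
@[simp] theorem step143 (r m : ℕ → ℕ) : step prog ⟨143, r, m⟩ = ⟨144, update r 16 (m (r 17)), m⟩ := rfl
@[simp] theorem step144 (r m : ℕ → ℕ) : step prog ⟨144, r, m⟩ = ⟨145, update r 17 (r 17 + r 6), m⟩ := rfl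
@[simp] theorem step145 (r m : ℕ → ℕ) : step prog ⟨145, r, m⟩ = ⟨146, update r 22 (m (r 17)), m⟩ := rfl
@[simp] theorem step146 (r m : ℕ → ℕ) : step prog ⟨146, r, m⟩ = ⟨147, update r 16 (r 16 - r 6), m⟩ := rfl
@[simp] theorem step147 (r m : ℕ → ℕ) : step prog ⟨147, r, m⟩ = ⟨if r 16 = 0 then 152 else 148, r, m⟩ := rfl
@[simp] theorem step148 (r m : ℕ → ℕ) : step prog ⟨148, r, m⟩ = ⟨149, update r 20 1, m⟩ := rfl
@[simp] theorem step149 (r m : ℕ → ℕ) : step prog ⟨149, r, m⟩ = ⟨150, update r 11 (r 22), m⟩ := rfl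
@[simp] theorem step150 (r m : ℕ → ℕ) : step prog ⟨150, r, m⟩ = ⟨151, update r 10 0, m⟩ := rfl
@[simp] theorem step151 (r m : ℕ → ℕ) : step prog ⟨151, r, m⟩ = ⟨8, r, m⟩ := rfl
@[simp] theorem step152 (r m : ℕ → ℕ) : step prog ⟨152, r, m⟩ = ⟨153, update r 16 (m (r 22)), m⟩ := rfl
@[simp] theorem step153 (r m : ℕ → ℕ) : step prog ⟨153, r, m⟩ = ⟨if r 16 = 0 then 156 else 154, r, m⟩ := rfl
@[simp] theorem step154 (r m : ℕ → ℕ) : step prog ⟨154, r, m⟩ = ⟨155, update r 16 (r 16 - r 6), m⟩ := rfl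
@[simp] theorem step155 (r m : ℕ → ℕ) : step prog ⟨155, r, m⟩ = ⟨if r 16 = 0 then 171 else 156, r, m⟩ := rfl
@[simp] theorem step156 (r m : ℕ → ℕ) : step prog ⟨156, r, m⟩ = ⟨157, update r 17 (r 19 + r 7), m⟩ := rfl
@[simp] theorem step157 (r m : ℕ → ℕ) : step prog ⟨157, r, m⟩ = ⟨158, update r 17 (m (r 17)), m⟩ := rfl
@[simp] theorem step158 (r m : ℕ → ℕ) : step prog ⟨158, r, m⟩ = ⟨159, r, update m (r 4) (r 19)⟩ := rfl
@[simp] theorem step159 (r m : ℕ → ℕ) : step prog ⟨159, r, m⟩ = ⟨160, update r 16 (r 4 + r 6), m⟩ := rfl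
@[simp] theorem step160 (r m : ℕ → ℕ) : step prog ⟨160, r, m⟩ = ⟨161, r, update m (r 16) (r 2)⟩ := rfl
@[simp] theorem step161 (r m : ℕ → ℕ) : step prog ⟨161, r, m⟩ = ⟨162, update r 16 (r 4 + r 7), m⟩ := rfl
@[simp] theorem step162 (r m : ℕ → ℕ) : step prog ⟨162, r, m⟩ = ⟨163, r, update m (r 16) (r 3)⟩ := rfl
@[simp] theorem step163 (r m : ℕ → ℕ) : step prog ⟨163, r, m⟩ = ⟨164, update r 16 (r 4 + r 8), m⟩ := rfl
@[simp] theorem step164 (r m : ℕ → ℕ) : step prog ⟨164, r, m⟩ = ⟨165, r, update m (r 16) (r 0)⟩ := rfl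
@[simp] theorem step165 (r m : ℕ → ℕ) : step prog ⟨165, r, m⟩ = ⟨166, update r 0 (r 4), m⟩ := rfl
@[simp] theorem step166 (r m : ℕ → ℕ) : step prog ⟨166, r, m⟩ = ⟨167, update r 4 (r 4 + r 9), m⟩ := rfl
@[simp] theorem step167 (r m : ℕ → ℕ) : step prog ⟨167, r, m⟩ = ⟨168, update r 2 0, m⟩ := rfl
@[simp] theorem step168 (r m : ℕ → ℕ) : step prog ⟨168, r, m⟩ = ⟨169, update r 3 (r 17), m⟩ := rfl
@[simp] theorem step169 (r m : ℕ → ℕ) : step prog ⟨169, r, m⟩ = ⟨170, update r 1 (r 22), m⟩ := rfl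
@[simp] theorem step170 (r m : ℕ → ℕ) : step prog ⟨170, r, m⟩ = ⟨93, r, m⟩ := rfl
@[simp] theorem step171 (r m : ℕ → ℕ) : step prog ⟨171, r, m⟩ = ⟨172, update r 17 (r 19 + r 7), m⟩ := rfl
@[simp] theorem step172 (r m : ℕ → ℕ) : step prog ⟨172, r, m⟩ = ⟨173, update r 15 (m (r 17)), m⟩ := rfl
@[simp] theorem step173 (r m : ℕ → ℕ) : step prog ⟨173, r, m⟩ = ⟨174, update r 17 (r 22 + r 7), m⟩ := rfl
@[simp] theorem step174 (r m : ℕ → ℕ) : step prog ⟨174, r, m⟩ = ⟨175, update r 11 (m (r 17)), m⟩ := rfl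
@[simp] theorem step175 (r m : ℕ → ℕ) : step prog ⟨175, r, m⟩ = ⟨176, update r 17 (r 22 + r 6), m⟩ := rfl
@[simp] theorem step176 (r m : ℕ → ℕ) : step prog ⟨176, r, m⟩ = ⟨177, update r 17 (m (r 17)), m⟩ := rfl
@[simp] theorem step177 (r m : ℕ → ℕ) : step prog ⟨177, r, m⟩ = ⟨178, update r 17 (r 17 + r 8), m⟩ := rfl
@[simp] theorem step178 (r m : ℕ → ℕ) : step prog ⟨178, r, m⟩ = ⟨179, r, update m (r 17) (r 5)⟩ := rfl
@[simp] theorem step179 (r m : ℕ → ℕ) : step prog ⟨179, r, m⟩ = ⟨180, update r 14 (r 5 - r 6), m⟩ := rfl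
@[simp] theorem step180 (r m : ℕ → ℕ) : step prog ⟨180, r, m⟩ = ⟨181, update r 10 0, m⟩ := rfl
@[simp] theorem step181 (r m : ℕ → ℕ) : step prog ⟨181, r, m⟩ = ⟨182, update r 16 (m (r 11)), m⟩ := rfl
@[simp] theorem step182 (r m : ℕ → ℕ) : step prog ⟨182, r, m⟩ = ⟨183, update r 17 (r 11 + r 6), m⟩ := rfl
@[simp] theorem step183 (r m : ℕ → ℕ) : step prog ⟨183, r, m⟩ = ⟨184, update r 17 (m (r 17)), m⟩ := rfl
@[simp] theorem step184 (r m : ℕ → ℕ) : step prog ⟨184, r, m⟩ = ⟨if r 16 = 0 then 208 else 185, r, m⟩ := rfl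
@[simp] theorem step185 (r m : ℕ → ℕ) : step prog ⟨185, r, m⟩ = ⟨186, update r 18 (r 11 + r 7), m⟩ := rfl
@[simp] theorem step186 (r m : ℕ → ℕ) : step prog ⟨186, r, m⟩ = ⟨187, update r 18 (m (r 18)), m⟩ := rfl
@[simp] theorem step187 (r m : ℕ → ℕ) : step prog ⟨187, r, m⟩ = ⟨188, update r 16 (r 16 - r 6), m⟩ := rfl
@[simp] theorem step188 (r m : ℕ → ℕ) : step prog ⟨188, r, m⟩ = ⟨if r 16 = 0 then 194 else 189, r, m⟩ := rfl
@[simp] theorem step189 (r m : ℕ → ℕ) : step prog ⟨189, r, m⟩ = ⟨190, r, update m (r 4) (r 21)⟩ := rfl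
@[simp] theorem step190 (r m : ℕ → ℕ) : step prog ⟨190, r, m⟩ = ⟨191, update r 17 (r 4 + r 6), m⟩ := rfl
@[simp] theorem step191 (r m : ℕ → ℕ) : step prog ⟨191, r, m⟩ = ⟨192, r, update m (r 17) (r 11)⟩ := rfl
@[simp] theorem step192 (r m : ℕ → ℕ) : step prog ⟨192, r, m⟩ = ⟨193, update r 11 (r 18), m⟩ := rfl
@[simp] theorem step193 (r m : ℕ → ℕ) : step prog ⟨193, r, m⟩ = ⟨201, r, m⟩ := rfl
@[simp] theorem step194 (r m : ℕ → ℕ) : step prog ⟨194, r, m⟩ = ⟨195, update r 17 (r 17 + r 8), m⟩ := rfl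
@[simp] theorem step195 (r m : ℕ → ℕ) : step prog ⟨195, r, m⟩ = ⟨196, r, update m (r 17) (r 14)⟩ := rfl
@[simp] theorem step196 (r m : ℕ → ℕ) : step prog ⟨196, r, m⟩ = ⟨197, r, update m (r 4) (r 6)⟩ := rfl
@[simp] theorem step197 (r m : ℕ → ℕ) : step prog ⟨197, r, m⟩ = ⟨198, update r 17 (r 4 + r 6), m⟩ := rfl
@[simp] theorem step198 (r m : ℕ → ℕ) : step prog ⟨198, r, m⟩ = ⟨199, r, update m (r 17) (r 11)⟩ := rfl
@[simp] theorem step199 (r m : ℕ → ℕ) : step prog ⟨199, r, m⟩ = ⟨200, update r 11 (r 18), m⟩ := rfl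
@[simp] theorem step200 (r m : ℕ → ℕ) : step prog ⟨200, r, m⟩ = ⟨201, update r 14 (r 14 - r 6), m⟩ := rfl
@[simp] theorem step201 (r m : ℕ → ℕ) : step prog ⟨201, r, m⟩ = ⟨202, update r 17 (r 4 + r 7), m⟩ := rfl
@[simp] theorem step202 (r m : ℕ → ℕ) : step prog ⟨202, r, m⟩ = ⟨203, r, update m (r 17) (r 15)⟩ := rfl
@[simp] theorem step203 (r m : ℕ → ℕ) : step prog ⟨203, r, m⟩ = ⟨204, update r 17 (r 4 + r 8), m⟩ := rfl
@[simp] theorem step204 (r m : ℕ → ℕ) : step prog ⟨204, r, m⟩ = ⟨205, r, update m (r 17) (r 10)⟩ := rfl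
@[simp] theorem step205 (r m : ℕ → ℕ) : step prog ⟨205, r, m⟩ = ⟨206, update r 10 (r 4), m⟩ := rfl
@[simp] theorem step206 (r m : ℕ → ℕ) : step prog ⟨206, r, m⟩ = ⟨207, update r 4 (r 4 + r 9), m⟩ := rfl
@[simp] theorem step207 (r m : ℕ → ℕ) : step prog ⟨207, r, m⟩ = ⟨181, r, m⟩ := rfl
@[simp] theorem step208 (r m : ℕ → ℕ) : step prog ⟨208, r, m⟩ = ⟨209, update r 12 (r 11), m⟩ := rfl
@[simp] theorem step209 (r m : ℕ → ℕ) : step prog ⟨209, r, m⟩ = ⟨210, update r 17 (r 17 + r 8), m⟩ := rfl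
@[simp] theorem step210 (r m : ℕ → ℕ) : step prog ⟨210, r, m⟩ = ⟨211, update r 13 (m (r 17)), m⟩ := rfl
@[simp] theorem step211 (r m : ℕ → ℕ) : step prog ⟨211, r, m⟩ = ⟨if r 10 = 0 then 280 else 212, r, m⟩ := rfl
@[simp] theorem step212 (r m : ℕ → ℕ) : step prog ⟨212, r, m⟩ = ⟨213, update r 16 (m (r 10)), m⟩ := rfl
@[simp] theorem step213 (r m : ℕ → ℕ) : step prog ⟨213, r, m⟩ = ⟨214, update r 17 (r 10 + r 6), m⟩ := rfl
@[simp] theorem step214 (r m : ℕ → ℕ) : step prog ⟨214, r, m⟩ = ⟨215, update r 17 (m (r 17)), m⟩ := rfl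
@[simp] theorem step215 (r m : ℕ → ℕ) : step prog ⟨215, r, m⟩ = ⟨216, update r 18 (r 10 + r 7), m⟩ := rfl
@[simp] theorem step216 (r m : ℕ → ℕ) : step prog ⟨216, r, m⟩ = ⟨217, update r 18 (m (r 18)), m⟩ := rfl
@[simp] theorem step217 (r m : ℕ → ℕ) : step prog ⟨217, r, m⟩ = ⟨218, update r 23 (r 10 + r 8), m⟩ := rfl
@[simp] theorem step218 (r m : ℕ → ℕ) : step prog ⟨218, r, m⟩ = ⟨219, update r 23 (m (r 23)), m⟩ := rfl
@[simp] theorem step219 (r m : ℕ → ℕ) : step prog ⟨219, r, m⟩ = ⟨if r 16 = 0 then 268 else 220, r, m⟩ := rfl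
@[simp] theorem step220 (r m : ℕ → ℕ) : step prog ⟨220, r, m⟩ = ⟨221, update r 16 (r 16 - r 6), m⟩ := rfl
@[simp] theorem step221 (r m : ℕ → ℕ) : step prog ⟨221, r, m⟩ = ⟨if r 16 = 0 then 238 else 222, r, m⟩ := rfl
@[simp] theorem step222 (r m : ℕ → ℕ) : step prog ⟨222, r, m⟩ = ⟨223, update r 18 (r 18 - r 13), m⟩ := rfl
@[simp] theorem step223 (r m : ℕ → ℕ) : step prog ⟨223, r, m⟩ = ⟨224, update r 13 (r 13 + r 18), m⟩ := rfl
@[simp] theorem step224 (r m : ℕ → ℕ) : step prog ⟨224, r, m⟩ = ⟨225, update r 24 (r 17), m⟩ := rfl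
@[simp] theorem step225 (r m : ℕ → ℕ) : step prog ⟨225, r, m⟩ = ⟨226, update r 17 (r 23 + r 6), m⟩ := rfl
@[simp] theorem step226 (r m : ℕ → ℕ) : step prog ⟨226, r, m⟩ = ⟨227, update r 17 (m (r 17)), m⟩ := rfl
@[simp] theorem step227 (r m : ℕ → ℕ) : step prog ⟨227, r, m⟩ = ⟨228, update r 18 (r 23 + r 7), m⟩ := rfl
@[simp] theorem step228 (r m : ℕ → ℕ) : step prog ⟨228, r, m⟩ = ⟨229, update r 18 (m (r 18)), m⟩ := rfl
@[simp] theorem step229 (r m : ℕ → ℕ) : step prog ⟨229, r, m⟩ = ⟨230, update r 23 (r 23 + r 8), m⟩ := rfl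
@[simp] theorem step230 (r m : ℕ → ℕ) : step prog ⟨230, r, m⟩ = ⟨231, update r 10 (m (r 23)), m⟩ := rfl
@[simp] theorem step231 (r m : ℕ → ℕ) : step prog ⟨231, r, m⟩ = ⟨if r 13 = 0 then 252 else 232, r, m⟩ := rfl
@[simp] theorem step232 (r m : ℕ → ℕ) : step prog ⟨232, r, m⟩ = ⟨233, r, update m (r 4) (r 7)⟩ := rfl
@[simp] theorem step233 (r m : ℕ → ℕ) : step prog ⟨233, r, m⟩ = ⟨234, update r 17 (r 4 + r 6), m⟩ := rfl
@[simp] theorem step234 (r m : ℕ → ℕ) : step prog ⟨234, r, m⟩ = ⟨235, r, update m (r 17) (r 12)⟩ := rfl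
@[simp] theorem step235 (r m : ℕ → ℕ) : step prog ⟨235, r, m⟩ = ⟨236, update r 17 (r 4 + r 7), m⟩ := rfl
@[simp] theorem step236 (r m : ℕ → ℕ) : step prog ⟨236, r, m⟩ = ⟨237, r, update m (r 17) (r 24)⟩ := rfl
@[simp] theorem step237 (r m : ℕ → ℕ) : step prog ⟨237, r, m⟩ = ⟨249, r, m⟩ := rfl
@[simp] theorem step238 (r m : ℕ → ℕ) : step prog ⟨238, r, m⟩ = ⟨239, update r 10 (r 23), m⟩ := rfl
@[simp] theorem step239 (r m : ℕ → ℕ) : step prog ⟨239, r, m⟩ = ⟨240, update r 14 (r 14 + r 6), m⟩ := rfl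
@[simp] theorem step240 (r m : ℕ → ℕ) : step prog ⟨240, r, m⟩ = ⟨241, update r 16 (r 13 - r 14), m⟩ := rfl
@[simp] theorem step241 (r m : ℕ → ℕ) : step prog ⟨241, r, m⟩ = ⟨if r 16 = 0 then 252 else 242, r, m⟩ := rfl
@[simp] theorem step242 (r m : ℕ → ℕ) : step prog ⟨242, r, m⟩ = ⟨243, update r 17 (r 17 + r 6), m⟩ := rfl
@[simp] theorem step243 (r m : ℕ → ℕ) : step prog ⟨243, r, m⟩ = ⟨244, update r 17 (m (r 17)), m⟩ := rfl
@[simp] theorem step244 (r m : ℕ → ℕ) : step prog ⟨244, r, m⟩ = ⟨245, r, update m (r 4) (r 6)⟩ := rfl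
@[simp] theorem step245 (r m : ℕ → ℕ) : step prog ⟨245, r, m⟩ = ⟨246, update r 18 (r 4 + r 6), m⟩ := rfl
@[simp] theorem step246 (r m : ℕ → ℕ) : step prog ⟨246, r, m⟩ = ⟨247, r, update m (r 18) (r 17)⟩ := rfl
@[simp] theorem step247 (r m : ℕ → ℕ) : step prog ⟨247, r, m⟩ = ⟨248, update r 18 (r 4 + r 7), m⟩ := rfl
@[simp] theorem step248 (r m : ℕ → ℕ) : step prog ⟨248, r, m⟩ = ⟨249, r, update m (r 18) (r 12)⟩ := rfl
@[simp] theorem step249 (r m : ℕ → ℕ) : step prog ⟨249, r, m⟩ = ⟨250, update r 12 (r 4), m⟩ := rfl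
@[simp] theorem step250 (r m : ℕ → ℕ) : step prog ⟨250, r, m⟩ = ⟨251, update r 4 (r 4 + r 9), m⟩ := rfl
@[simp] theorem step251 (r m : ℕ → ℕ) : step prog ⟨251, r, m⟩ = ⟨211, r, m⟩ := rfl
@[simp] theorem step252 (r m : ℕ → ℕ) : step prog ⟨252, r, m⟩ = ⟨253, r, update m (r 4) (r 6)⟩ := rfl
@[simp] theorem step253 (r m : ℕ → ℕ) : step prog ⟨253, r, m⟩ = ⟨254, update r 16 (r 4 + r 6), m⟩ := rfl
@[simp] theorem step254 (r m : ℕ → ℕ) : step prog ⟨254, r, m⟩ = ⟨255, r, update m (r 16) (r 17)⟩ := rfl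
@[simp] theorem step255 (r m : ℕ → ℕ) : step prog ⟨255, r, m⟩ = ⟨256, update r 16 (r 4 + r 7), m⟩ := rfl
@[simp] theorem step256 (r m : ℕ → ℕ) : step prog ⟨256, r, m⟩ = ⟨257, r, update m (r 16) (r 18)⟩ := rfl
@[simp] theorem step257 (r m : ℕ → ℕ) : step prog ⟨257, r, m⟩ = ⟨258, update r 16 (r 4 + r 8), m⟩ := rfl
@[simp] theorem step258 (r m : ℕ → ℕ) : step prog ⟨258, r, m⟩ = ⟨259, r, update m (r 16) (r 21)⟩ := rfl
@[simp] theorem step259 (r m : ℕ → ℕ) : step prog ⟨259, r, m⟩ = ⟨260, update r 15 (r 4), m⟩ := rfl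
@[simp] theorem step260 (r m : ℕ → ℕ) : step prog ⟨260, r, m⟩ = ⟨261, update r 4 (r 4 + r 9), m⟩ := rfl
@[simp] theorem step261 (r m : ℕ → ℕ) : step prog ⟨261, r, m⟩ = ⟨262, r, update m (r 4) (r 21)⟩ := rfl
@[simp] theorem step262 (r m : ℕ → ℕ) : step prog ⟨262, r, m⟩ = ⟨263, update r 16 (r 4 + r 6), m⟩ := rfl
@[simp] theorem step263 (r m : ℕ → ℕ) : step prog ⟨263, r, m⟩ = ⟨264, r, update m (r 16) (r 15)⟩ := rfl
@[simp] theorem step264 (r m : ℕ → ℕ) : step prog ⟨264, r, m⟩ = ⟨265, update r 12 (r 4), m⟩ := rfl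
@[simp] theorem step265 (r m : ℕ → ℕ) : step prog ⟨265, r, m⟩ = ⟨266, update r 4 (r 4 + r 9), m⟩ := rfl
@[simp] theorem step266 (r m : ℕ → ℕ) : step prog ⟨266, r, m⟩ = ⟨267, update r 13 0, m⟩ := rfl
@[simp] theorem step267 (r m : ℕ → ℕ) : step prog ⟨267, r, m⟩ = ⟨211, r, m⟩ := rfl
@[simp] theorem step268 (r m : ℕ → ℕ) : step prog ⟨268, r, m⟩ = ⟨269, update r 17 (r 17 + r 6), m⟩ := rfl
@[simp] theorem step269 (r m : ℕ → ℕ) : step prog ⟨269, r, m⟩ = ⟨270, update r 11 (m (r 17)), m⟩ := rfl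
@[simp] theorem step270 (r m : ℕ → ℕ) : step prog ⟨270, r, m⟩ = ⟨271, r, update m (r 4) (r 7)⟩ := rfl
@[simp] theorem step271 (r m : ℕ → ℕ) : step prog ⟨271, r, m⟩ = ⟨272, update r 17 (r 4 + r 6), m⟩ := rfl
@[simp] theorem step272 (r m : ℕ → ℕ) : step prog ⟨272, r, m⟩ = ⟨273, r, update m (r 17) (r 12)⟩ := rfl
@[simp] theorem step273 (r m : ℕ → ℕ) : step prog ⟨273, r, m⟩ = ⟨274, update r 17 (r 4 + r 7), m⟩ := rfl
@[simp] theorem step274 (r m : ℕ → ℕ) : step prog ⟨274, r, m⟩ = ⟨275, r, update m (r 17) (r 13)⟩ := rfl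
@[simp] theorem step275 (r m : ℕ → ℕ) : step prog ⟨275, r, m⟩ = ⟨276, update r 17 (r 4 + r 8), m⟩ := rfl
@[simp] theorem step276 (r m : ℕ → ℕ) : step prog ⟨276, r, m⟩ = ⟨277, r, update m (r 17) (r 10)⟩ := rfl
@[simp] theorem step277 (r m : ℕ → ℕ) : step prog ⟨277, r, m⟩ = ⟨278, update r 10 (r 4), m⟩ := rfl
@[simp] theorem step278 (r m : ℕ → ℕ) : step prog ⟨278, r, m⟩ = ⟨279, update r 4 (r 4 + r 9), m⟩ := rfl
@[simp] theorem step279 (r m : ℕ → ℕ) : step prog ⟨279, r, m⟩ = ⟨181, r, m⟩ := rfl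
@[simp] theorem step280 (r m : ℕ → ℕ) : step prog ⟨280, r, m⟩ = ⟨281, update r 17 (r 22 + r 6), m⟩ := rfl
@[simp] theorem step281 (r m : ℕ → ℕ) : step prog ⟨281, r, m⟩ = ⟨282, update r 17 (m (r 17)), m⟩ := rfl
@[simp] theorem step282 (r m : ℕ → ℕ) : step prog ⟨282, r, m⟩ = ⟨283, r, update m (r 4) (r 6)⟩ := rfl
@[simp] theorem step283 (r m : ℕ → ℕ) : step prog ⟨283, r, m⟩ = ⟨284, update r 18 (r 4 + r 6), m⟩ := rfl
@[simp] theorem step284 (r m : ℕ → ℕ) : step prog ⟨284, r, m⟩ = ⟨285, r, update m (r 18) (r 17)⟩ := rfl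
@[simp] theorem step285 (r m : ℕ → ℕ) : step prog ⟨285, r, m⟩ = ⟨286, update r 18 (r 4 + r 7), m⟩ := rfl
@[simp] theorem step286 (r m : ℕ → ℕ) : step prog ⟨286, r, m⟩ = ⟨287, r, update m (r 18) (r 12)⟩ := rfl
@[simp] theorem step287 (r m : ℕ → ℕ) : step prog ⟨287, r, m⟩ = ⟨288, r, update m (r 19) (r 7)⟩ := rfl
@[simp] theorem step288 (r m : ℕ → ℕ) : step prog ⟨288, r, m⟩ = ⟨289, update r 18 (r 19 + r 6), m⟩ := rfl
@[simp] theorem step289 (r m : ℕ → ℕ) : step prog ⟨289, r, m⟩ = ⟨290, r, update m (r 18) (r 4)⟩ := rfl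
@[simp] theorem step290 (r m : ℕ → ℕ) : step prog ⟨290, r, m⟩ = ⟨291, update r 18 (r 19 + r 7), m⟩ := rfl
@[simp] theorem step291 (r m : ℕ → ℕ) : step prog ⟨291, r, m⟩ = ⟨292, r, update m (r 18) (r 15)⟩ := rfl
@[simp] theorem step292 (r m : ℕ → ℕ) : step prog ⟨292, r, m⟩ = ⟨293, update r 4 (r 4 + r 9), m⟩ := rfl
@[simp] theorem step293 (r m : ℕ → ℕ) : step prog ⟨293, r, m⟩ = ⟨93, r, m⟩ := rfl

set_option maxRecDepth 4000 in
theorem length_prog : prog.length = 294 := rfl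

attribute [irreducible] prog

end RAM

/-! ### Names of pre-terms and terms without name clashes -/

namespace PTerm

theorem mem_names_iff {x : ℕ} {t : PTerm} : x ∈ t.names ↔ x ∈ t.fv ∨ x ∈ t.binders := by
  induction t with
  | var y => simp [names, fv, binders]
  | lam y t ih => simp only [names, fv, binders, List.mem_cons, Finset.mem_erase, ih]; tauto
  | app t u iht ihu => simp only [names, fv, binders, List.mem_append, Finset.mem_union, iht, ihu]; tauto

theorem size_pos (t : PTerm) : 0 < t.size := by cases t <;> simp [size]

/-- The bound names are pairwise distinct and distinct from the free names. -/
def Clean (t : PTerm) : Prop := t.binders.Nodup ∧ ∀ x ∈ t.binders, x ∉ t.fv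

theorem Clean.lam {x : ℕ} {t : PTerm} (h : (lam x t).Clean) : t.Clean ∧ x ∉ t.binders := by
  obtain ⟨h1, h2⟩ := h
  simp only [binders, List.nodup_cons, List.mem_cons, fv, Finset.mem_erase] at h1 h2
  refine ⟨⟨h1.2, fun y hy hy' => h2 y (.inr hy) ⟨?_, hy'⟩⟩, h1.1⟩
  rintro rfl
  exact h1.1 hy

theorem Clean.app {t u : PTerm} (h : (app t u).Clean) : t.Clean ∧ u.Clean ∧
    (∀ x ∈ t.binders, x ∉ u.names) ∧ ∀ x ∈ u.binders, x ∉ t.names := by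
  obtain ⟨h1, h2⟩ := h
  simp only [binders, List.nodup_append, List.mem_append, fv, Finset.mem_union, not_or] at h1 h2
  obtain ⟨h3, h4, h5⟩ := h1
  refine ⟨⟨h3, fun x hx => (h2 x (.inl hx)).1⟩, ⟨h4, fun x hx => (h2 x (.inr hx)).2⟩, ?_, ?_⟩
  · intro x hx hx'
    rcases mem_names_iff.1 hx' with h | h
    · exact (h2 x (.inl hx)).2 h
    · exact h5 x hx x h rfl
  · intro x hx hx'
    rcases mem_names_iff.1 hx' with h | h
    · exact (h2 x (.inr hx)).1 h
    · exact h5 x h x hx rfl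

end PTerm

namespace SMAD
open RAM

/-! ### Frozen memory words

`G : ℕ → Option ℕ` records the words of the memory that are never written again. -/

/-- Terms are read from the frozen words only, so no later write can damage them. -/
def TermAt (G : ℕ → Option ℕ) (addr : ℕ → ℕ) : ℕ → PTerm → Prop
  | p, .var x => G p = some 0 ∧ G (p + 1) = some (addr x)
  | p, .lam x t => G p = some 1 ∧ G (p + 1) = some (addr x) ∧
      ∃ q, G (p + 2) = some q ∧ TermAt G addr q t
  | p, .app t u => G p = some 2 ∧ ∃ q q', G (p + 1) = some q ∧ G (p + 2) = some q' ∧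
      TermAt G addr q t ∧ TermAt G addr q' u

def StackAt (G : ℕ → Option ℕ) (addr : ℕ → ℕ) : ℕ → List PTerm → Prop
  | p, [] => p = 0
  | p, t :: S => p ≠ 0 ∧ ∃ q q', G p = some q ∧ G (p + 1) = some q' ∧
      TermAt G addr q t ∧ StackAt G addr q' S

def Entry.name : Entry → ℕ
  | .es x _ => x
  | .skel x _ => x

def Entry.term : Entry → PTerm
  | .es _ t => t
  | .skel _ t => t

def Entry.tag : Entry → ℕ
  | .es _ _ => 1
  | .skel _ _ => 2

theorem Entry.names_eq (e : Entry) : e.names = e.name :: e.term.names := by cases e <;> rfl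

/-- Tags and pointers are read from the live memory `m`, because entries are rewritten in place by
$\mathsf{sk}$ and $\mathsf{sea}_3$; only the terms they point to are frozen. -/
def EnvAt (G : ℕ → Option ℕ) (m addr : ℕ → ℕ) : ℕ → List Entry → ℕ → Prop
  | p, [], q => p = q
  | p, e :: E, q => p ≠ 0 ∧ p = addr e.name ∧ m p = e.tag ∧ TermAt G addr (m (p + 1)) e.term ∧
      EnvAt G m addr (m (p + 2)) E q

def ChainAt (G : ℕ → Option ℕ) (m addr : ℕ → ℕ) : ℕ → List ChainItem → Prop
  | p, [] => p = 0
  | p, i :: C => p ≠ 0 ∧ ∃ s e c, G p = some (addr i.name) ∧ G (p + 1) = some s ∧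
      G (p + 2) = some e ∧ G (p + 3) = some c ∧ StackAt G addr s i.stack ∧
      EnvAt G m addr e i.env (addr i.name) ∧ ChainAt G m addr c C

/-- `G` is below `G'`. -/
def GLe (G G' : ℕ → Option ℕ) : Prop := ∀ a v, G a = some v → G' a = some v

theorem GLe.refl (G : ℕ → Option ℕ) : GLe G G := fun _ _ h => h

theorem TermAt.mono {G G' : ℕ → Option ℕ} {addr addr' : ℕ → ℕ} (hG : GLe G G') {t : PTerm} :
    ∀ {p : ℕ}, (∀ x ∈ t.names, addr' x = addr x) → TermAt G addr p t → TermAt G' addr' p t := by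
  induction t with
  | var x =>
    intro p ha h
    exact ⟨hG _ _ h.1, by rw [ha x (by simp [PTerm.names])]; exact hG _ _ h.2⟩
  | lam x t ih =>
    intro p ha h
    obtain ⟨h1, h2, q, h3, h4⟩ := h
    exact ⟨hG _ _ h1, by rw [ha x (by simp [PTerm.names])]; exact hG _ _ h2, q, hG _ _ h3,
      ih (fun y hy => ha y (by simp [PTerm.names, hy])) h4⟩
  | app t u iht ihu =>
    intro p ha h
    obtain ⟨h1, q, q', h2, h3, h4, h5⟩ := h
    exact ⟨hG _ _ h1, q, q', hG _ _ h2, hG _ _ h3,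
      iht (fun y hy => ha y (by simp [PTerm.names, hy])) h4,
      ihu (fun y hy => ha y (by simp [PTerm.names, hy])) h5⟩

theorem StackAt.mono {G G' : ℕ → Option ℕ} {addr addr' : ℕ → ℕ} (hG : GLe G G')
    {S : List PTerm} : ∀ {p : ℕ}, (∀ x ∈ S.flatMap PTerm.names, addr' x = addr x) →
      StackAt G addr p S → StackAt G' addr' p S := by
  induction S with
  | nil => intro p _ h; exact h
  | cons t S ih =>
    intro p ha h
    obtain ⟨h0, q, q', h2, h3, h4, h5⟩ := h
    simp only [List.flatMap_cons, List.mem_append] at ha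
    exact ⟨h0, q, q', hG _ _ h2, hG _ _ h3, h4.mono hG fun x hx => ha x (.inl hx),
      ih (fun x hx => ha x (.inr hx)) h5⟩

/-- Only the first three words of an entry have to be preserved: the fourth one is the mark, which
does not belong to the representation. -/
theorem EnvAt.mono {G G' : ℕ → Option ℕ} {m m' addr addr' : ℕ → ℕ} (hG : GLe G G')
    {E : List Entry} : ∀ {p q : ℕ}, (∀ x ∈ E.flatMap Entry.names, addr' x = addr x) →
      (∀ e ∈ E, ∀ i < 3, m' (addr e.name + i) = m (addr e.name + i)) →
      EnvAt G m addr p E q → EnvAt G' m' addr' p E q := by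
  induction E with
  | nil => intro p q _ _ h; exact h
  | cons e E ih =>
    intro p q ha hm h
    obtain ⟨h0, h1, h2, h3, h4⟩ := h
    simp only [List.flatMap_cons, List.mem_append, Entry.names_eq, List.mem_cons] at ha
    have hm0 := hm e (by simp)
    rw [← h1] at hm0
    have e0 := hm0 0 (by simp)
    have e1 := hm0 1 (by simp)
    have e2 := hm0 2 (by simp)
    refine ⟨h0, by rw [h1, ha _ (.inl (.inl rfl))], by rw [← h2]; exact e0, ?_, ?_⟩
    · rw [e1]; exact h3.mono hG fun x hx => ha x (.inl (.inr hx))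
    · rw [e2]
      exact ih (fun x hx => ha x (.inr (by simpa [Entry.names_eq] using hx)))
        (fun e' he' => hm e' (by simp [he'])) h4

theorem ChainAt.mono {G G' : ℕ → Option ℕ} {m m' addr addr' : ℕ → ℕ} (hG : GLe G G')
    {C : List ChainItem} : ∀ {p : ℕ}, (∀ x ∈ C.flatMap ChainItem.names, addr' x = addr x) →
      (∀ c ∈ C, ∀ e ∈ c.env, ∀ i < 3, m' (addr e.name + i) = m (addr e.name + i)) →
      ChainAt G m addr p C → ChainAt G' m' addr' p C := by
  induction C with
  | nil => intro p _ _ h; exact h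
  | cons c C ih =>
    intro p ha hm h
    obtain ⟨h0, s, e, k, h1, h2, h3, h4, h5, h6, h7⟩ := h
    simp only [List.flatMap_cons, List.mem_append, ChainItem.names, List.mem_cons] at ha
    have hn := ha _ (.inl (.inl rfl))
    refine ⟨h0, s, e, k, by rw [hn]; exact hG _ _ h1, hG _ _ h2, hG _ _ h3, hG _ _ h4,
      h5.mono hG fun x hx => ha x (.inl (.inr (.inl hx))), ?_, ?_⟩
    · rw [hn]
      exact h6.mono hG (fun x hx => ha x (.inl (.inr (.inr hx)))) (hm c (by simp))
    · exact ih (fun x hx => ha x (.inr (by simpa [ChainItem.names] using hx)))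
        (fun c' hc' => hm c' (by simp [hc'])) h7

theorem EnvAt.append {G : ℕ → Option ℕ} {m addr : ℕ → ℕ} {E E' : List Entry} :
    ∀ {p q : ℕ}, EnvAt G m addr p (E ++ E') q ↔
      ∃ k, EnvAt G m addr p E k ∧ EnvAt G m addr k E' q := by
  induction E with
  | nil => intro p q; simp [EnvAt]
  | cons e E ih =>
    intro p q
    simp only [List.cons_append, EnvAt, ih]
    constructor
    · rintro ⟨h1, h2, h3, h4, k, h5, h6⟩; exact ⟨k, ⟨h1, h2, h3, h4, h5⟩, h6⟩
    · rintro ⟨k, ⟨h1, h2, h3, h4, h5⟩, h6⟩; exact ⟨h1, h2, h3, h4, k, h5, h6⟩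

/-- The frozen words are up to date and lie below the heap pointer. -/
structure HeapInv (G : ℕ → Option ℕ) (hp : ℕ) (m : ℕ → ℕ) : Prop where
  sub : ∀ a v, G a = some v → m a = v
  bound : ∀ a, hp ≤ a → G a = none
  dvd : 4 ∣ hp
  pos : 0 < hp

theorem HeapInv.lt {G : ℕ → Option ℕ} {hp : ℕ} {m : ℕ → ℕ} (h : HeapInv G hp m) {a v : ℕ}
    (ha : G a = some v) : a < hp := by
  by_contra hc
  rw [h.bound a (not_lt.1 hc)] at ha
  cases ha

theorem TermAt.rep {G : ℕ → Option ℕ} {addr m : ℕ → ℕ} (hG : ∀ a v, G a = some v → m a = v)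
    {t : PTerm} : ∀ {p : ℕ}, TermAt G addr p t → RepTerm m addr p t := by
  induction t with
  | var x => intro p h; exact ⟨hG _ _ h.1, hG _ _ h.2⟩
  | lam x t ih =>
    rintro p ⟨h1, h2, q, h3, h4⟩
    exact ⟨hG _ _ h1, hG _ _ h2, by rw [hG _ _ h3]; exact ih h4⟩
  | app t u iht ihu =>
    rintro p ⟨h1, q, q', h2, h3, h4, h5⟩
    exact ⟨hG _ _ h1, by rw [hG _ _ h2]; exact iht h4, by rw [hG _ _ h3]; exact ihu h5⟩

theorem StackAt.rep {G : ℕ → Option ℕ} {addr m : ℕ → ℕ} (hG : ∀ a v, G a = some v → m a = v)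
    {S : List PTerm} : ∀ {p : ℕ}, StackAt G addr p S → RepStack m addr p S := by
  induction S with
  | nil => intro p h; exact h
  | cons t S ih =>
    rintro p ⟨h0, q, q', h2, h3, h4, h5⟩
    exact ⟨h0, by rw [hG _ _ h2]; exact h4.rep hG, by rw [hG _ _ h3]; exact ih h5⟩

theorem EnvAt.rep {G : ℕ → Option ℕ} {addr m : ℕ → ℕ} (hG : ∀ a v, G a = some v → m a = v)
    {E : List Entry} : ∀ {p q : ℕ}, EnvAt G m addr p E q → RepEnv m addr p E q := by
  induction E with
  | nil => intro p q h; exact h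
  | cons e E ih =>
    rintro p q ⟨h0, h1, h2, h3, h4⟩
    cases e <;> exact ⟨h0, h1, h2, h3.rep hG, ih h4⟩

theorem ChainAt.rep {G : ℕ → Option ℕ} {addr m : ℕ → ℕ} (hG : ∀ a v, G a = some v → m a = v)
    {C : List ChainItem} : ∀ {p : ℕ}, ChainAt G m addr p C → RepChain m addr p C := by
  induction C with
  | nil => intro p h; exact h
  | cons c C ih =>
    rintro p ⟨h0, s, e, k, h1, h2, h3, h4, h5, h6, h7⟩
    exact ⟨h0, hG _ _ h1, by rw [hG _ _ h2]; exact h5.rep hG,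
      by rw [hG _ _ h3]; exact h6.rep hG, by rw [hG _ _ h4]; exact ih h7⟩

/-- A record at `a` that may be written. -/
structure Cell (G : ℕ → Option ℕ) (hp a : ℕ) : Prop where
  dvd : 4 ∣ a
  pos : 0 < a
  le : a + 4 ≤ hp
  free : ∀ i < 4, G (a + i) = none

/-- Freezing the record at `k`. -/
def freeze (G : ℕ → Option ℕ) (m : ℕ → ℕ) (k : ℕ) : ℕ → Option ℕ :=
  fun a => if k ≤ a ∧ a < k + 4 then some (m a) else G a

/-- New words are frozen only above the heap pointer. -/
def Grow (G : ℕ → Option ℕ) (hp : ℕ) (G' : ℕ → Option ℕ) (hp' : ℕ) : Prop :=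
  hp ≤ hp' ∧ ∀ a < hp, G' a = G a

theorem Grow.trans {G G' G'' : ℕ → Option ℕ} {hp hp' hp'' : ℕ} (h : Grow G hp G' hp')
    (h' : Grow G' hp' G'' hp'') : Grow G hp G'' hp'' :=
  ⟨h.1.trans h'.1, fun a ha => (h'.2 a (ha.trans_le h.1)).trans (h.2 a ha)⟩

theorem Cell.grow {G G' : ℕ → Option ℕ} {hp hp' a : ℕ} (h : Cell G hp a)
    (hg : Grow G hp G' hp') : Cell G' hp' a := by
  have := h.le
  refine ⟨h.dvd, h.pos, h.le.trans hg.1, fun i hi => ?_⟩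
  rw [hg.2 _ (by omega)]; exact h.free i hi

theorem HeapInv.freeze {G : ℕ → Option ℕ} {hp hp' k : ℕ} {m m' : ℕ → ℕ} (hi : HeapInv G hp m)
    (h1 : hp ≤ k) (h2 : k + 4 ≤ hp') (h4 : 4 ∣ hp') (hm : ∀ a v, G a = some v → m' a = m a) :
    HeapInv (SMAD.freeze G m' k) hp' m' ∧ Grow G hp (SMAD.freeze G m' k) hp' := by
  refine ⟨⟨?_, ?_, h4, by have := hi.pos; omega⟩, ⟨by omega, ?_⟩⟩
  · intro a v ha
    simp only [SMAD.freeze] at ha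
    split_ifs at ha with h
    · simpa using ha
    · rw [hm a v ha]
      exact hi.sub a v ha
  · intro a ha
    simp only [SMAD.freeze]
    rw [if_neg (by omega), hi.bound a (by omega)]
  · intro a ha
    simp only [SMAD.freeze]
    rw [if_neg (by omega)]

theorem HeapInv.write {G : ℕ → Option ℕ} {hp hp' : ℕ} {m m' : ℕ → ℕ} (hi : HeapInv G hp m)
    (h2 : hp ≤ hp') (h4 : 4 ∣ hp') (hm : ∀ a v, G a = some v → m' a = m a) : HeapInv G hp' m' :=
  ⟨fun a v ha => by rw [hm a v ha]; exact hi.sub a v ha, fun a ha => hi.bound a (h2.trans ha), h4,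
    hi.pos.trans_le h2⟩

theorem Grow.gle {G G' : ℕ → Option ℕ} {hp hp' : ℕ} {m : ℕ → ℕ} (h : Grow G hp G' hp')
    (hi : HeapInv G hp m) : GLe G G' :=
  fun a v ha => by rw [h.2 a (hi.lt ha)]; exact ha

/-- The registers that the recursive routines do not change. -/
def kept : List ℕ := [0, 1, 2, 3, 5, 6, 7, 8, 9, 19, 20, 21, 22]

def Keep (r r' : ℕ → ℕ) : Prop := ∀ i ∈ kept, r' i = r i

theorem Keep.trans {r r' r'' : ℕ → ℕ} (h : Keep r r') (h' : Keep r' r'') : Keep r r'' :=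
  fun i hi => (h' i hi).trans (h i hi)

structure Consts (r : ℕ → ℕ) : Prop where
  h6 : r 6 = 1
  h7 : r 7 = 2
  h8 : r 8 = 3
  h9 : r 9 = 4
  h21 : r 21 = 0

theorem Consts.keep {r r' : ℕ → ℕ} (h : Consts r) (hk : Keep r r') : Consts r' :=
  ⟨(hk 6 (by simp [kept])).trans h.h6, (hk 7 (by simp [kept])).trans h.h7,
    (hk 8 (by simp [kept])).trans h.h8, (hk 9 (by simp [kept])).trans h.h9,
    (hk 21 (by simp [kept])).trans h.h21⟩

/-- Part of a computation that allocates records, and below the heap pointer only writes words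
that satisfy `W`. -/
structure HeapStep (W : ℕ → Prop) (r m : ℕ → ℕ) (G : ℕ → Option ℕ) (r' m' : ℕ → ℕ)
    (G' : ℕ → Option ℕ) : Prop where
  keep : Keep r r'
  inv : HeapInv G' (r' 4) m'
  grow : Grow G (r 4) G' (r' 4)
  mem : ∀ a < r 4, ¬ W a → m' a = m a

theorem HeapStep.trans {W W' : ℕ → Prop} {r m r' m' r'' m'' : ℕ → ℕ} {G G' G'' : ℕ → Option ℕ}
    (h : HeapStep W r m G r' m' G') (h' : HeapStep W' r' m' G' r'' m'' G'') :
    HeapStep (fun a => W a ∨ W' a) r m G r'' m'' G'' :=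
  ⟨h.keep.trans h'.keep, h'.inv, h.grow.trans h'.grow, fun a ha hw => by
    rw [not_or] at hw
    rw [h'.mem a (ha.trans_le h.grow.1) hw.2, h.mem a ha hw.1]⟩

theorem HeapStep.weaken {W W' : ℕ → Prop} {r m r' m' : ℕ → ℕ} {G G' : ℕ → Option ℕ}
    (h : HeapStep W r m G r' m' G') (hW : ∀ a < r 4, W a → W' a) :
    HeapStep W' r m G r' m' G' :=
  ⟨h.keep, h.inv, h.grow, fun a ha hw => h.mem a ha fun h => hw (hW a ha h)⟩

theorem HeapStep.gle {W : ℕ → Prop} {r m r' m' : ℕ → ℕ} {G G' : ℕ → Option ℕ}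
    (h : HeapStep W r m G r' m' G') (hi : HeapInv G (r 4) m) : GLe G G' :=
  h.grow.gle hi

/-- Writes below the heap pointer are harmless because the writable words `W` are not frozen; the
new record lies above the heap pointer, where nothing is frozen yet. -/
theorem HeapStep.freeze {W : ℕ → Prop} {r m r' m' : ℕ → ℕ} {G : ℕ → Option ℕ} {k : ℕ}
    (hi : HeapInv G (r 4) m) (hk : Keep r r') (h1 : r 4 ≤ k) (h2 : k + 4 ≤ r' 4)
    (h4 : 4 ∣ r' 4) (hm : ∀ a < r 4, ¬ W a → m' a = m a) (hW : ∀ a, W a → G a = none) :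
    HeapStep W r m G r' m' (freeze G m' k) := by
  obtain ⟨h, h'⟩ := hi.freeze h1 h2 h4 fun a v ha =>
    hm a (hi.lt ha) fun hw => by rw [hW a hw] at ha; cases ha
  exact ⟨hk, h, h', hm⟩

theorem HeapStep.write {W : ℕ → Prop} {r m r' m' : ℕ → ℕ} {G : ℕ → Option ℕ}
    (hi : HeapInv G (r 4) m) (hk : Keep r r') (h2 : r 4 ≤ r' 4)
    (h4 : 4 ∣ r' 4) (hm : ∀ a < r 4, ¬ W a → m' a = m a) (hW : ∀ a, W a → G a = none) :
    HeapStep W r m G r' m' G :=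
  ⟨hk, hi.write h2 h4 fun a v ha => hm a (hi.lt ha) fun hw => by simp [hW a hw] at ha,
    ⟨h2, fun _ _ => rfl⟩, hm⟩

/-- `addr'` extends `addr` with new records for the names in `B`. -/
structure Fresh (B : List ℕ) (hp : ℕ) (addr : ℕ → ℕ) (G' : ℕ → Option ℕ) (hp' : ℕ)
    (addr' : ℕ → ℕ) : Prop where
  eq : ∀ x ∉ B, addr' x = addr x
  cell : ∀ x ∈ B, Cell G' hp' (addr' x) ∧ hp ≤ addr' x
  inj : ∀ x ∈ B, ∀ y ∈ B, addr' x = addr' y → x = y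

theorem Fresh.nil (hp : ℕ) (addr : ℕ → ℕ) (G' : ℕ → Option ℕ) (hp' : ℕ) :
    Fresh [] hp addr G' hp' addr :=
  ⟨fun _ _ => rfl, by simp, by simp⟩

/-- The records for `B` end at or before `hp'` and those for `B'` start at or after it, so the two
families of addresses cannot collide. -/
theorem Fresh.append {B B' : List ℕ} {hp hp' hp'' : ℕ} {addr addr' addr'' : ℕ → ℕ}
    {G' G'' : ℕ → Option ℕ} (h : Fresh B hp addr G' hp' addr')
    (h' : Fresh B' hp' addr' G'' hp'' addr'') (hg : Grow G' hp' G'' hp'') (hle : hp ≤ hp')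
    (hd : ∀ x ∈ B, x ∉ B') : Fresh (B ++ B') hp addr G'' hp'' addr'' := by
  refine ⟨?_, ?_, ?_⟩
  · intro x hx
    simp only [List.mem_append, not_or] at hx
    rw [h'.eq x hx.2, h.eq x hx.1]
  · intro x hx
    rcases List.mem_append.1 hx with hx | hx
    · rw [h'.eq x (hd x hx)]
      exact ⟨(h.cell x hx).1.grow hg, (h.cell x hx).2⟩
    · exact ⟨(h'.cell x hx).1, hle.trans (h'.cell x hx).2⟩
  · intro x hx y hy hxy
    rcases List.mem_append.1 hx with hx | hx <;> rcases List.mem_append.1 hy with hy | hy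
    · rw [h'.eq x (hd x hx), h'.eq y (hd y hy)] at hxy
      exact h.inj x hx y hy hxy
    · rw [h'.eq x (hd x hx)] at hxy
      have := (h.cell x hx).1.le
      have := (h'.cell y hy).2
      omega
    · rw [h'.eq y (hd y hy)] at hxy
      have := (h.cell y hy).1.le
      have := (h'.cell x hx).2
      omega
    · exact h'.inj x hx y hy hxy

theorem Fresh.grow {B : List ℕ} {hp hp' hp'' : ℕ} {addr addr' : ℕ → ℕ}
    {G' G'' : ℕ → Option ℕ} (h : Fresh B hp addr G' hp' addr') (hg : Grow G' hp' G'' hp'') :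
    Fresh B hp addr G'' hp'' addr' :=
  ⟨h.eq, fun x hx => ⟨(h.cell x hx).1.grow hg, (h.cell x hx).2⟩, h.inj⟩

theorem Fresh.single {x hp a hp' : ℕ} {addr : ℕ → ℕ} {G' : ℕ → Option ℕ} (hc : Cell G' hp' a)
    (ha : hp ≤ a) : Fresh [x] hp addr G' hp' (update addr x a) := by
  refine ⟨fun y hy => ?_, ?_, by simp⟩
  · rw [update_of_ne (by simpa using hy)]
  · simpa using ⟨hc, ha⟩

theorem Fresh.base {B : List ℕ} {hp₀ hp hp' : ℕ} {addr addr' : ℕ → ℕ} {G' : ℕ → Option ℕ}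
    (h : Fresh B hp addr G' hp' addr') (hle : hp₀ ≤ hp) : Fresh B hp₀ addr G' hp' addr' :=
  ⟨h.eq, fun x hx => ⟨(h.cell x hx).1, hle.trans (h.cell x hx).2⟩, h.inj⟩

end SMAD

/-! ### Basic blocks shared by reading and copying terms -/

namespace SMAD
open RAM

section segments
variable {r m : ℕ → ℕ} {G : ℕ → Option ℕ}

/-- All the block lemmas follow this pattern: `simp` executes the block, leaving a nest of updates
at the heap pointer, and the new record is then frozen with its present contents. The choice `G'` is
the map with that record added. -/
theorem leaf_run (hi : HeapInv G (r 4) m) (hc : Consts r) :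
    ∃ r' m' G', run prog ⟨36, r, m⟩ 5 = ⟨41, r', m'⟩ ∧
      HeapStep (fun _ => False) r m G r' m' G' ∧ r' 10 = r 10 ∧ r' 14 = r 14 ∧ r' 15 = r 15 ∧
      G' (r' 12) = some 0 ∧ G' (r' 12 + 1) = some (r 16) := by
  obtain ⟨r', hr, h4, h10, h14, h15, h12, hk⟩ : ∃ r', run prog ⟨36, r, m⟩ 5 =
      ⟨41, r', update (update m (r 4) 0) (r 4 + 1) (r 16)⟩ ∧ r' 4 = r 4 + 4 ∧ r' 10 = r 10 ∧
      r' 14 = r 14 ∧ r' 15 = r 15 ∧ r' 12 = r 4 ∧ Keep r r' := by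
    simp [run_succ, run_zero, Keep, kept, hc.h6, hc.h9, hc.h21]
  have hd := hi.dvd
  refine ⟨r', _, _, hr, .freeze hi hk le_rfl h4.ge (by omega) ?_ (by simp), h10, h14, h15, ?_, ?_⟩
  · intro a ha _
    rw [update_of_ne (by omega), update_of_ne (by omega)]
  · simp [freeze, h12]
  · simp [freeze, h12]

/-- Two records are allocated. The one at `r 4` belongs to the new variable and stays writable,
since it will carry a mark and later an environment entry; only the frame at `r 4 + 4` is frozen.
Frame tags of the builder are `0` for the body of an abstraction, `1` for the left child of an
application and `2` for its right child. -/
theorem lamFrame_run (hi : HeapInv G (r 4) m) (hc : Consts r) :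
    ∃ r' m' G', run prog ⟨73, r, m⟩ 11 = ⟨8, r', m'⟩ ∧
      HeapStep (fun _ => False) r m G r' m' G' ∧ r' 10 ≠ 0 ∧ r' 11 = r 11 ∧ r' 14 = r 14 ∧
      r' 15 = r 15 + 1 ∧ G' (r' 10) = some 0 ∧ G' (r' 10 + 1) = some (r 4) ∧
      G' (r' 10 + 2) = some (r 10) ∧ Cell G' (r' 4) (r 4) := by
  obtain ⟨r', hr, h4, h10, h11, h14, h15, hk⟩ : ∃ r', run prog ⟨73, r, m⟩ 11 =
      ⟨8, r', update (update (update m (r 4 + 4) 0) (r 4 + 4 + 1) (r 4)) (r 4 + 4 + 2) (r 10)⟩ ∧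
      r' 4 = r 4 + 4 + 4 ∧ r' 10 = r 4 + 4 ∧ r' 11 = r 11 ∧ r' 14 = r 14 ∧ r' 15 = r 15 + 1 ∧
      Keep r r' := by
    simp [run_succ, run_zero, Keep, kept, hc.h6, hc.h7, hc.h9, hc.h21]
  have hd := hi.dvd
  have hp := hi.pos
  refine ⟨r', _, _, hr, .freeze hi hk (k := r 4 + 4) (by omega) (by omega) (by omega) ?_ (by simp),
    by omega, h11, h14, h15, ?_, ?_, ?_, ⟨hd, hp, by omega, ?_⟩⟩
  · intro a ha _
    rw [update_of_ne (by omega), update_of_ne (by omega), update_of_ne (by omega)]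
  · simp [freeze, h10]
  · simp [freeze, h10]
  · simp [freeze, h10]
  · intro i h
    simp only [freeze]
    rw [if_neg (by omega), hi.bound _ (by omega)]

theorem appFrame_run (hi : HeapInv G (r 4) m) (hc : Consts r) :
    ∃ r' m' G', run prog ⟨84, r, m⟩ 8 = ⟨8, r', m'⟩ ∧
      HeapStep (fun _ => False) r m G r' m' G' ∧ r' 10 ≠ 0 ∧ r' 11 = r 11 ∧ r' 14 = r 14 ∧
      r' 15 = r 15 ∧ G' (r' 10) = some 1 ∧ G' (r' 10 + 1) = some (r 18) ∧
      G' (r' 10 + 2) = some (r 10) := by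
  obtain ⟨r', hr, h4, h10, h11, h14, h15, hk⟩ : ∃ r', run prog ⟨84, r, m⟩ 8 =
      ⟨8, r', update (update (update m (r 4) 1) (r 4 + 1) (r 18)) (r 4 + 2) (r 10)⟩ ∧
      r' 4 = r 4 + 4 ∧ r' 10 = r 4 ∧ r' 11 = r 11 ∧ r' 14 = r 14 ∧ r' 15 = r 15 ∧
      Keep r r' := by
    simp [run_succ, run_zero, Keep, kept, hc.h6, hc.h7, hc.h9]
  have hd := hi.dvd
  have hp := hi.pos
  refine ⟨r', _, _, hr, .freeze hi hk le_rfl h4.ge (by omega) ?_ (by simp),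
    by omega, h11, h14, h15, ?_, ?_, ?_⟩
  · intro a ha _
    rw [update_of_ne (by omega), update_of_ne (by omega), update_of_ne (by omega)]
  · simp [freeze, h10]
  · simp [freeze, h10]
  · simp [freeze, h10]

theorem retLam_run {x k : ℕ} (hi : HeapInv G (r 4) m) (hc : Consts r) (hK : r 10 ≠ 0)
    (h0 : G (r 10) = some 0) (h1 : G (r 10 + 1) = some x) (h2 : G (r 10 + 2) = some k) :
    ∃ r' m' G', run prog ⟨41, r, m⟩ 17 = ⟨41, r', m'⟩ ∧
      HeapStep (fun _ => False) r m G r' m' G' ∧ r' 10 = k ∧ r' 14 = r 14 ∧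
      r' 15 = r 15 - 1 ∧ G' (r' 12) = some 1 ∧ G' (r' 12 + 1) = some x ∧
      G' (r' 12 + 2) = some (r 12) := by
  obtain ⟨r', hr, h4, h10, h12, h14, h15, hk⟩ : ∃ r', run prog ⟨41, r, m⟩ 17 =
      ⟨41, r', update (update (update m (r 4) 1) (r 4 + 1) x) (r 4 + 2) (r 12)⟩ ∧
      r' 4 = r 4 + 4 ∧ r' 10 = k ∧ r' 12 = r 4 ∧ r' 14 = r 14 ∧ r' 15 = r 15 - 1 ∧
      Keep r r' := by
    simp [run_succ, run_zero, Keep, kept, hc.h6, hc.h7, hc.h9, hK, hi.sub _ _ h0, hi.sub _ _ h1,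
      hi.sub _ _ h2]
  have hd := hi.dvd
  have hp := hi.pos
  refine ⟨r', _, _, hr, .freeze hi hk le_rfl h4.ge (by omega) ?_ (by simp),
    h10, h14, h15, ?_, ?_, ?_⟩
  · intro a ha _
    rw [update_of_ne (by omega), update_of_ne (by omega), update_of_ne (by omega)]
  · simp [freeze, h12]
  · simp [freeze, h12]
  · simp [freeze, h12]

/-- When the left child is done, its frame gives the pending right child and a new frame of tag `2`
remembers the result. Frames are never overwritten, which is why they can be frozen too. -/
theorem retFun_run {p k : ℕ} (hi : HeapInv G (r 4) m) (hc : Consts r) (hK : r 10 ≠ 0)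
    (h0 : G (r 10) = some 1) (h1 : G (r 10 + 1) = some p) (h2 : G (r 10 + 2) = some k) :
    ∃ r' m' G', run prog ⟨41, r, m⟩ 18 = ⟨8, r', m'⟩ ∧
      HeapStep (fun _ => False) r m G r' m' G' ∧ r' 10 ≠ 0 ∧ r' 11 = p ∧ r' 14 = r 14 ∧
      r' 15 = r 15 ∧ G' (r' 10) = some 2 ∧ G' (r' 10 + 1) = some (r 12) ∧
      G' (r' 10 + 2) = some k := by
  obtain ⟨r', hr, h4, h10, h12, h14, h15, hk⟩ : ∃ r', run prog ⟨41, r, m⟩ 18 =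
      ⟨8, r', update (update (update m (r 4) 2) (r 4 + 1) (r 12)) (r 4 + 2) k⟩ ∧
      r' 4 = r 4 + 4 ∧ r' 10 = r 4 ∧ r' 11 = p ∧ r' 14 = r 14 ∧ r' 15 = r 15 ∧
      Keep r r' := by
    simp [run_succ, run_zero, Keep, kept, hc.h6, hc.h7, hc.h9, hK, hi.sub _ _ h0, hi.sub _ _ h1,
      hi.sub _ _ h2]
  have hd := hi.dvd
  have hp := hi.pos
  refine ⟨r', _, _, hr, .freeze hi hk le_rfl h4.ge (by omega) ?_ (by simp),
    by omega, h12, h14, h15, ?_, ?_, ?_⟩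
  · intro a ha _
    rw [update_of_ne (by omega), update_of_ne (by omega), update_of_ne (by omega)]
  · simp [freeze, h10]
  · simp [freeze, h10]
  · simp [freeze, h10]

theorem retArg_run {p k : ℕ} (hi : HeapInv G (r 4) m) (hc : Consts r) (hK : r 10 ≠ 0)
    (h0 : G (r 10) = some 2) (h1 : G (r 10 + 1) = some p) (h2 : G (r 10 + 2) = some k) :
    ∃ r' m' G', run prog ⟨41, r, m⟩ 19 = ⟨41, r', m'⟩ ∧
      HeapStep (fun _ => False) r m G r' m' G' ∧ r' 10 = k ∧ r' 14 = r 14 ∧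
      r' 15 = r 15 ∧ G' (r' 12) = some 2 ∧ G' (r' 12 + 1) = some p ∧
      G' (r' 12 + 2) = some (r 12) := by
  obtain ⟨r', hr, h4, h10, h12, h14, h15, hk⟩ : ∃ r', run prog ⟨41, r, m⟩ 19 =
      ⟨41, r', update (update (update m (r 4) 2) (r 4 + 1) p) (r 4 + 2) (r 12)⟩ ∧
      r' 4 = r 4 + 4 ∧ r' 10 = k ∧ r' 12 = r 4 ∧ r' 14 = r 14 ∧ r' 15 = r 15 ∧
      Keep r r' := by
    simp [run_succ, run_zero, Keep, kept, hc.h6, hc.h7, hc.h9, hK, hi.sub _ _ h0, hi.sub _ _ h1,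
      hi.sub _ _ h2]
  have hd := hi.dvd
  have hp := hi.pos
  refine ⟨r', _, _, hr, .freeze hi hk le_rfl h4.ge (by omega) ?_ (by simp),
    h10, h14, h15, ?_, ?_, ?_⟩
  · intro a ha _
    rw [update_of_ne (by omega), update_of_ne (by omega), update_of_ne (by omega)]
  · simp [freeze, h12]
  · simp [freeze, h12]
  · simp [freeze, h12]

end segments
end SMAD

/-! ### Copying a term with renaming -/

namespace SMAD
open RAM

/-- The variable that replaces the one at `a`. -/
def resolve (m : ℕ → ℕ) (a : ℕ) : ℕ := if m (a + 3) = 0 then a else m (a + 3)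

section copy
variable {r m : ℕ → ℕ} {G : ℕ → Option ℕ}

theorem copyVar_run {a : ℕ} (hi : HeapInv G (r 4) m) (hc : Consts r) (h20 : r 20 ≠ 0)
    (h0 : G (r 11) = some 0) (h1 : G (r 11 + 1) = some a) :
    ∃ T r' m' G', run prog ⟨8, r, m⟩ T = ⟨41, r', m'⟩ ∧ T ≤ 16 ∧
      HeapStep (fun _ => False) r m G r' m' G' ∧ r' 10 = r 10 ∧
      G' (r' 12) = some 0 ∧ G' (r' 12 + 1) = some (resolve m a) := by
  obtain ⟨T, r1, hT, hr, h4, h10, h16, hk⟩ : ∃ T r', T ≤ 11 ∧ run prog ⟨8, r, m⟩ T = ⟨36, r', m⟩ ∧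
      r' 4 = r 4 ∧ r' 10 = r 10 ∧ r' 16 = resolve m a ∧ Keep r r' := by
    by_cases ha : m (a + 3) = 0
    · refine ⟨9, ?_⟩
      simp [run_succ, run_zero, Keep, kept, hc.h6, hc.h8, h20, hi.sub _ _ h0, hi.sub _ _ h1, ha,
        resolve]
    · refine ⟨11, ?_⟩
      simp [run_succ, run_zero, Keep, kept, hc.h6, hc.h8, h20, hi.sub _ _ h0, hi.sub _ _ h1, ha,
        resolve]
  obtain ⟨r2, m2, G2, hr2, hs2, h10', -, -, h3, h5⟩ := leaf_run (h4.symm ▸ hi) (hc.keep hk)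
  refine ⟨_, r2, m2, G2, run_trans hr hr2, by omega, ?_, by omega, h3, by rw [h5, h16]⟩
  have hs1 : HeapStep (fun _ => False) r m G r1 m G :=
    .write hi hk h4.ge (h4 ▸ hi.dvd) (fun _ _ _ => rfl) (by simp)
  exact (hs1.trans hs2).weaken (by simp)

theorem copyLam_run {a p : ℕ} (hi : HeapInv G (r 4) m) (hc : Consts r) (h20 : r 20 ≠ 0)
    (h0 : G (r 11) = some 1) (h1 : G (r 11 + 1) = some a) (h2 : G (r 11 + 2) = some p)
    (ha : Cell G (r 4) a) :
    ∃ r' m' G', run prog ⟨8, r, m⟩ (12 + 11) = ⟨8, r', m'⟩ ∧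
      HeapStep (fun b => b = a + 3) r m G r' m' G' ∧ r' 10 ≠ 0 ∧ r' 11 = p ∧
      G' (r' 10) = some 0 ∧ G' (r' 10 + 1) = some (r 4) ∧ G' (r' 10 + 2) = some (r 10) ∧
      Cell G' (r' 4) (r 4) ∧ m' (a + 3) = r 4 := by
  obtain ⟨r1, hr, h4, h10, h11, hk⟩ : ∃ r', run prog ⟨8, r, m⟩ 12 =
      ⟨73, r', update m (a + 3) (r 4)⟩ ∧ r' 4 = r 4 ∧ r' 10 = r 10 ∧ r' 11 = p ∧ Keep r r' := by
    simp [run_succ, run_zero, Keep, kept, hc.h6, hc.h7, hc.h8, h20, hi.sub _ _ h0, hi.sub _ _ h1,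
      hi.sub _ _ h2]
  have hs1 : HeapStep (fun b => b = a + 3) r m G r1 (update m (a + 3) (r 4)) G :=
    .write hi hk h4.ge (h4 ▸ hi.dvd) (fun b _ hb => update_of_ne hb _ _)
      (fun b hb => hb ▸ ha.free 3 (by simp))
  obtain ⟨r2, m2, G2, hr2, hs2, h10', h11', -, -, g0, g1, g2, g3⟩ :=
    lamFrame_run hs1.inv (hc.keep hk)
  have := ha.le
  refine ⟨r2, m2, G2, run_trans hr hr2, (hs1.trans hs2).weaken (by simp), h10', by omega, g0,
    by rw [g1, h4], by rw [g2, h10], h4 ▸ g3, ?_⟩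
  rw [hs2.mem _ (by omega) (by simp)]; simp

theorem copyApp_run {p q : ℕ} (hi : HeapInv G (r 4) m) (hc : Consts r) (h20 : r 20 ≠ 0)
    (h0 : G (r 11) = some 2) (h1 : G (r 11 + 1) = some p) (h2 : G (r 11 + 2) = some q) :
    ∃ r' m' G', run prog ⟨8, r, m⟩ (12 + 8) = ⟨8, r', m'⟩ ∧
      HeapStep (fun _ => False) r m G r' m' G' ∧ r' 10 ≠ 0 ∧ r' 11 = p ∧
      G' (r' 10) = some 1 ∧ G' (r' 10 + 1) = some q ∧ G' (r' 10 + 2) = some (r 10) := by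
  obtain ⟨r1, hr, h4, h10, h11, h18, hk⟩ : ∃ r', run prog ⟨8, r, m⟩ 12 =
      ⟨84, r', m⟩ ∧ r' 4 = r 4 ∧ r' 10 = r 10 ∧ r' 11 = p ∧ r' 18 = q ∧ Keep r r' := by
    simp [run_succ, run_zero, Keep, kept, hc.h6, hc.h7, h20, hi.sub _ _ h0, hi.sub _ _ h1,
      hi.sub _ _ h2]
  have hs1 : HeapStep (fun _ => False) r m G r1 m G :=
    .write hi hk h4.ge (h4 ▸ hi.dvd) (fun _ _ _ => rfl) (by simp)
  obtain ⟨r2, m2, G2, hr2, hs2, h10', h11', -, -, g0, g1, g2⟩ :=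
    appFrame_run hs1.inv (hc.keep hk)
  exact ⟨r2, m2, G2, run_trans hr hr2, (hs1.trans hs2).weaken (by simp), h10', by omega, g0,
    by rw [g1, h18], by rw [g2, h10]⟩

/-- The target `w` is given in advance, as the run chooses it; the algorithm does not see its names,
and the addresses of the variables it allocates are attributed to the binders of `w`. The invariant
is the last hypothesis: following the mark of a variable of `s` leads to the address of the variable
that corresponds to it in `w`. Marks need not be cleaned, since a binder is always marked before its
occurrences are read, and by cleanness of `s` these marks do not concern any name outside its scope.
Each construct costs at most 57 instructions (the case of an application), hence the factor 64. -/
theorem copy_run (s : PTerm) : ∀ (w : PTerm) (l : List (ℕ × ℕ)) (r m : ℕ → ℕ)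
    (G : ℕ → Option ℕ) (addr : ℕ → ℕ), HeapInv G (r 4) m → Consts r → r 20 ≠ 0 →
    TermAt G addr (r 11) s → (∀ y ∈ s.names, Cell G (r 4) (addr y)) →
    (∀ x ∈ s.names, ∀ y ∈ s.names, addr x = addr y → x = y) → s.Clean → w.Clean →
    (∀ x ∈ w.binders, x ∉ s.names) → PTerm.AlphaIn l w s →
    (∀ x ∈ w.fv, ∀ y ∈ s.fv, PTerm.AlphaVar l x y → resolve m (addr y) = addr x) →
    ∃ T r' m' G' addr', run prog ⟨8, r, m⟩ T = ⟨41, r', m'⟩ ∧ T ≤ 64 * s.size ∧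
      HeapStep (fun a => ∃ y ∈ s.binders, a = addr y + 3) r m G r' m' G' ∧ r' 10 = r 10 ∧
      Fresh w.binders (r 4) addr G' (r' 4) addr' ∧ TermAt G' addr' (r' 12) w := by
  induction s with
  | var y =>
    intro w l r m G addr hi hc h20 ht hcell hinj hs hw hws hα hres
    cases w with
    | lam _ _ | app _ _ => simp [PTerm.AlphaIn] at hα
    | var x =>
    obtain ⟨T, r', m', G', hr, hT, hst, h10, g0, g1⟩ := copyVar_run hi hc h20 ht.1 ht.2
    refine ⟨T, r', m', G', addr, hr, by simp [PTerm.size]; omega,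
      hst.weaken (by simp), h10, .nil _ _ _ _, g0, ?_⟩
    rw [g1, hres x (by simp [PTerm.fv]) y (by simp [PTerm.fv]) hα]
  | lam y s ih =>
    intro w l r m G addr hi hc h20 ht hcell hinj hs hw hws hα hres
    cases w with
    | var _ | app _ _ => simp [PTerm.AlphaIn] at hα
    | lam x w =>
    obtain ⟨t0, t1, p, t2, t3⟩ := ht
    simp only [PTerm.names, List.mem_cons, PTerm.binders, forall_eq_or_imp, not_or] at hcell hinj hws
    obtain ⟨hcy, hcell⟩ := hcell
    obtain ⟨⟨hxy, hxs⟩, hws⟩ := hws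
    obtain ⟨hs1, hys⟩ := hs.lam
    obtain ⟨hw1, hxw⟩ := hw.lam
    obtain ⟨r1, m1, G1, hr1, hst1, k10, h11, g0, g1, g2, gc, hm1⟩ :=
      copyLam_run hi hc h20 t0 t1 t2 hcy
    have ha1 : ∀ z ∈ s.names, update addr x (r 4) z = addr z := fun z hz =>
      update_of_ne (by rintro rfl; exact hxs hz) _ _
    have hc1 := hc.keep hst1.keep
    obtain ⟨T2, r2, m2, G2, addr2, hr2, hT2, hst2, k10', hf2, ht2⟩ := ih w ((x, y) :: l) r1 m1 G1
      (update addr x (r 4)) hst1.inv hc1 (by rwa [hst1.keep 20 (by simp [kept])])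
      (h11 ▸ t3.mono (hst1.gle hi) ha1)
      (fun z hz => ha1 z hz ▸ (hcell z hz).grow hst1.grow)
      (fun u hu v hv huv => hinj.2 u hu |>.2 v hv (by rwa [ha1 u hu, ha1 v hv] at huv))
      hs1 hw1 (fun z hz => (hws z hz).2) hα (by
        intro x' hx' y' hy' hα'
        have hy'n := PTerm.mem_names_iff.2 (.inl hy')
        rw [ha1 y' hy'n]
        rcases hα' with ⟨rfl, rfl⟩ | ⟨hx, hy, hα'⟩
        -- The mark is the old heap pointer, which is positive, so it cannot be confused with the
        -- mark `0` of a variable that is not renamed.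
        · have := hi.pos
          simp only [resolve, hm1]
          rw [if_neg (by omega)]; simp
        · rw [update_of_ne hx, ← hres x' (by simp [PTerm.fv, *]) y' (by simp [PTerm.fv, *]) hα']
          have := (hcell y' hy'n).le
          simp only [resolve]
          rw [hst1.mem _ (by omega)]
          intro h
          exact hy (hinj.1.2 y' hy'n (by omega)).symm)
    have gg := hst2.gle hst1.inv
    obtain ⟨r3, m3, G3, hr3, hst3, k10'', -, -, e0, e1, e2⟩ := retLam_run hst2.inv
      (hc1.keep hst2.keep) (by omega) (k10' ▸ gg _ _ g0) (k10' ▸ gg _ _ g1) (k10' ▸ gg _ _ g2)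
    refine ⟨12 + 11 + T2 + 17, r3, m3, G3, addr2, run_trans (run_trans hr1 hr2) hr3,
      by simp only [PTerm.size]; omega, ((hst1.trans hst2).trans hst3).weaken ?_, k10'', ?_, ?_⟩
    · rintro a - ((rfl | ⟨z, hz, rfl⟩) | h)
      · exact ⟨y, by simp [PTerm.binders], rfl⟩
      · rw [ha1 z (PTerm.mem_names_iff.2 (.inr hz))]
        exact ⟨z, by simp [PTerm.binders, hz], rfl⟩
      · exact h.elim
    · exact ((Fresh.single gc le_rfl).append hf2 hst2.grow hst1.grow.1 (by simpa using hxw)).grow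
        hst3.grow
    · refine ⟨e0, ?_, _, e2, ht2.mono (hst3.gle hst2.inv) fun _ _ => rfl⟩
      rw [e1, hf2.eq x hxw]; simp
  | app s u ihs ihu =>
    intro w l r m G addr hi hc h20 ht hcell hinj hs hw hws hα hres
    cases w with
    | var _ | lam _ _ => simp [PTerm.AlphaIn] at hα
    | app w v =>
    obtain ⟨t0, p, q, t1, t2, t3, t4⟩ := ht
    simp only [PTerm.names, List.mem_append, PTerm.binders, PTerm.fv, Finset.mem_union, not_or]
      at hcell hinj hws hres
    obtain ⟨hs1, hu1, hsu, hus⟩ := hs.app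
    obtain ⟨hw1, hv1, hwv, hvw⟩ := hw.app
    obtain ⟨r1, m1, G1, hr1, hst1, k10, h11, g0, g1, g2⟩ := copyApp_run hi hc h20 t0 t1 t2
    have hc1 := hc.keep hst1.keep
    obtain ⟨T2, r2, m2, G2, addr2, hr2, hT2, hst2, k10', hf2, ht2⟩ := ihs w l r1 m1 G1
      addr hst1.inv hc1 (by rwa [hst1.keep 20 (by simp [kept])])
      (h11 ▸ t3.mono (hst1.gle hi) fun _ _ => rfl)
      (fun z hz => (hcell z (.inl hz)).grow hst1.grow)
      (fun x hx y hy => hinj x (.inl hx) y (.inl hy)) hs1 hw1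
      (fun z hz => (hws z (.inl hz)).1) hα.1 (by
        intro x' hx' y' hy' hα'
        rw [← hres x' (.inl hx') y' (.inl hy') hα']
        have := (hcell y' (.inl (PTerm.mem_names_iff.2 (.inl hy')))).le
        simp only [resolve]
        rw [hst1.mem _ (by omega) (by simp)])
    have gg := hst2.gle hst1.inv
    have hc2 := hc1.keep hst2.keep
    obtain ⟨r3, m3, G3, hr3, hst3, k10'', h11', -, -, e0, e1, e2⟩ := retFun_run hst2.inv
      hc2 (by omega) (k10' ▸ gg _ _ g0) (k10' ▸ gg _ _ g1) (k10' ▸ gg _ _ g2)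
    have hst13 := (hst1.trans hst2).trans hst3
    have hc3 := hc2.keep hst3.keep
    have ha2 : ∀ z ∈ u.names, addr2 z = addr z := fun z hz =>
      hf2.eq z fun h => (hws z (.inl h)).2 hz
    obtain ⟨T4, r4, m4, G4, addr4, hr4, hT4, hst4, k10''', hf4, ht4⟩ := ihu v l r3 m3 G3
      addr2 hst3.inv hc3 (by rwa [hst13.keep 20 (by simp [kept])])
      (h11' ▸ t4.mono (hst13.gle hi) ha2)
      (fun z hz => ha2 z hz ▸ (hcell z (.inr hz)).grow hst13.grow)
      (fun x hx y hy h => hinj x (.inr hx) y (.inr hy) (by rwa [ha2 x hx, ha2 y hy] at h)) hu1 hv1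
      (fun z hz => (hws z (.inr hz)).2) hα.2 (by
        intro x' hx' y' hy' hα'
        have hy'n := PTerm.mem_names_iff.2 (.inl hy')
        rw [ha2 y' hy'n, hf2.eq x' (fun h => hwv _ h (PTerm.mem_names_iff.2 (.inl hx'))),
          ← hres x' (.inr hx') y' (.inr hy') hα']
        have := (hcell y' (.inr hy'n)).le
        simp only [resolve]
        rw [hst13.mem _ (by omega)]
        -- The marks left by the copy of the function belong to its binders, which by cleanness do
        -- not occur in the argument.
        rintro ((h | ⟨z, hz, h⟩) | h)
        · exact h
        · have := hinj y' (.inr hy'n) z (.inl (PTerm.mem_names_iff.2 (.inr hz))) (by omega)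
          subst this
          exact hsu _ hz hy'n
        · exact h)
    have gg' := hst4.gle hst3.inv
    obtain ⟨r5, m5, G5, hr5, hst5, j10, -, -, f0, f1, f2⟩ := retArg_run hst4.inv
      (hc3.keep hst4.keep) (by omega) (k10''' ▸ gg' _ _ e0) (k10''' ▸ gg' _ _ e1)
      (k10''' ▸ gg' _ _ e2)
    refine ⟨12 + 8 + T2 + 18 + T4 + 19, r5, m5, G5, addr4,
      run_trans (run_trans (run_trans (run_trans hr1 hr2) hr3) hr4) hr5,
      by simp only [PTerm.size]; omega, ((hst13.trans hst4).trans hst5).weaken ?_, j10, ?_, ?_⟩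
    · rintro a - ((((h | ⟨z, hz, rfl⟩) | h) | ⟨z, hz, rfl⟩) | h)
      · exact h.elim
      · exact ⟨z, by simp [PTerm.binders, hz], rfl⟩
      · exact h.elim
      · rw [ha2 z (PTerm.mem_names_iff.2 (.inr hz))]
        exact ⟨z, by simp [PTerm.binders, hz], rfl⟩
      · exact h.elim
    · exact ((((hf2.grow hst3.grow).base hst1.grow.1).append hf4 hst4.grow
        (hst1.grow.1.trans (hst2.grow.1.trans hst3.grow.1)) fun x hx hx' =>
          hwv x hx (PTerm.mem_names_iff.2 (.inr hx'))).grow hst5.grow)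
    · refine ⟨f0, _, _, f1, f2, ?_, ht4.mono (hst5.gle hst4.inv) fun _ _ => rfl⟩
      exact ht2.mono ((hst3.trans (hst4.trans hst5)).gle hst2.inv) fun x hx =>
        hf4.eq x fun h => hvw x h hx

end copy
end SMAD

/-! ### Reading the input -/

theorem PTerm.length_encodeIn (t : PTerm) : ∀ l : List ℕ, (PTerm.encodeIn l t).length = t.size := by
  induction t with
  | var x => intro l; rfl
  | lam x t ih => intro l; simp [encodeIn, size, ih]
  | app t u iht ihu => intro l; simp [encodeIn, size, iht, ihu]

namespace SMAD
open RAM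

section parse
variable {r m : ℕ → ℕ} {G : ℕ → Option ℕ}

theorem parseVar_run {k : ℕ} (hi : HeapInv G (r 4) m) (hc : Consts r) (h20 : r 20 = 0)
    (h0 : m (r 14) = k + 2) :
    ∃ r' m' G', run prog ⟨8, r, m⟩ (8 + 5) = ⟨41, r', m'⟩ ∧
      HeapStep (fun _ => False) r m G r' m' G' ∧ r' 10 = r 10 ∧ r' 14 = r 14 + 1 ∧ r' 15 = r 15 ∧
      G' (r' 12) = some 0 ∧ G' (r' 12 + 1) = some (m (r 15 - (k + 1))) := by
  obtain ⟨r1, hr, h4, h10, h14, h15, h16, hk⟩ : ∃ r', run prog ⟨8, r, m⟩ 8 = ⟨36, r', m⟩ ∧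
      r' 4 = r 4 ∧ r' 10 = r 10 ∧ r' 14 = r 14 + 1 ∧ r' 15 = r 15 ∧ r' 16 = m (r 15 - (k + 1)) ∧
      Keep r r' := by
    simp [run_succ, run_zero, Keep, kept, hc.h6, h20, h0]
  obtain ⟨r2, m2, G2, hr2, hs2, h10', h14', h15', h3, h5⟩ := leaf_run (h4.symm ▸ hi) (hc.keep hk)
  refine ⟨r2, m2, G2, run_trans hr hr2, ?_, by omega, by omega, by omega, h3, by rw [h5, h16]⟩
  have hs1 : HeapStep (fun _ => False) r m G r1 m G :=
    .write hi hk h4.ge (h4 ▸ hi.dvd) (fun _ _ _ => rfl) (by simp)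
  exact (hs1.trans hs2).weaken (by simp)

theorem parseLam_run (hi : HeapInv G (r 4) m) (hc : Consts r) (h20 : r 20 = 0)
    (h0 : m (r 14) = 0) (hG : G (r 15) = none) (h15 : r 15 < r 4) :
    ∃ r' m' G', run prog ⟨8, r, m⟩ (5 + 11) = ⟨8, r', m'⟩ ∧
      HeapStep (fun b => b = r 15) r m G r' m' G' ∧ r' 10 ≠ 0 ∧ r' 14 = r 14 + 1 ∧
      r' 15 = r 15 + 1 ∧ G' (r' 10) = some 0 ∧ G' (r' 10 + 1) = some (r 4) ∧
      G' (r' 10 + 2) = some (r 10) ∧ Cell G' (r' 4) (r 4) ∧ m' (r 15) = r 4 := by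
  obtain ⟨r1, hr, h4, h10, h14, h15', hk⟩ : ∃ r', run prog ⟨8, r, m⟩ 5 =
      ⟨73, r', update m (r 15) (r 4)⟩ ∧ r' 4 = r 4 ∧ r' 10 = r 10 ∧ r' 14 = r 14 + 1 ∧
      r' 15 = r 15 ∧ Keep r r' := by
    simp [run_succ, run_zero, Keep, kept, hc.h6, h20, h0]
  have hs1 : HeapStep (fun b => b = r 15) r m G r1 (update m (r 15) (r 4)) G :=
    .write hi hk h4.ge (h4 ▸ hi.dvd) (fun b _ hb => update_of_ne hb _ _) (fun b hb => hb ▸ hG)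
  obtain ⟨r2, m2, G2, hr2, hs2, h10', -, k14, k15, g0, g1, g2, g3⟩ :=
    lamFrame_run hs1.inv (hc.keep hk)
  refine ⟨r2, m2, G2, run_trans hr hr2, (hs1.trans hs2).weaken (by simp), h10', by omega,
    by omega, g0, by rw [g1, h4], by rw [g2, h10], h4 ▸ g3, ?_⟩
  rw [hs2.mem _ (by omega) (by simp)]; simp

/-- In reading mode the field for the pending right child receives whatever register `18` contains,
as the right child will come from the input; hence the unspecified `q`. -/
theorem parseApp_run (hi : HeapInv G (r 4) m) (hc : Consts r) (h20 : r 20 = 0)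
    (h0 : m (r 14) = 1) :
    ∃ r' m' G' q, run prog ⟨8, r, m⟩ (6 + 8) = ⟨8, r', m'⟩ ∧
      HeapStep (fun _ => False) r m G r' m' G' ∧ r' 10 ≠ 0 ∧ r' 14 = r 14 + 1 ∧ r' 15 = r 15 ∧
      G' (r' 10) = some 1 ∧ G' (r' 10 + 1) = some q ∧ G' (r' 10 + 2) = some (r 10) := by
  obtain ⟨r1, hr, h4, h10, h14, h15, hk⟩ : ∃ r', run prog ⟨8, r, m⟩ 6 =
      ⟨84, r', m⟩ ∧ r' 4 = r 4 ∧ r' 10 = r 10 ∧ r' 14 = r 14 + 1 ∧ r' 15 = r 15 ∧ Keep r r' := by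
    simp [run_succ, run_zero, Keep, kept, hc.h6, h20, h0]
  have hs1 : HeapStep (fun _ => False) r m G r1 m G :=
    .write hi hk h4.ge (h4 ▸ hi.dvd) (fun _ _ _ => rfl) (by simp)
  obtain ⟨r2, m2, G2, hr2, hs2, h10', -, k14, k15, g0, g1, g2⟩ :=
    appFrame_run hs1.inv (hc.keep hk)
  exact ⟨r2, m2, G2, _, run_trans hr hr2, (hs1.trans hs2).weaken (by simp), h10', by omega,
    by omega, g0, g1, by rw [g2, h10]⟩

/-- The context of binders is kept in the input area itself: the binder at level `i` (outermost
first) has its address in word `i`. Since the depth `r 15` never exceeds the reading position `r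
14`, this overwrites only words already consumed. A de Bruijn index `k` is therefore resolved by the
word `r 15 - (k + 1)`, in constant time. -/
theorem parse_run (n : ℕ) (w : PTerm) : ∀ (l : List ℕ) (r m : ℕ → ℕ)
    (G : ℕ → Option ℕ) (addr : ℕ → ℕ), HeapInv G (r 4) m → Consts r → r 20 = 0 →
    (∀ a < n, G a = none) → n ≤ r 4 → r 14 + w.size ≤ n → r 15 = l.length → r 15 ≤ r 14 →
    w.Clean → (∀ i v, (PTerm.encodeIn l w)[i]? = some v → m (r 14 + i) = v) →
    (∀ x ∈ w.fv, x ∈ l ∧ m (r 15 - (l.idxOf x + 1)) = addr x) →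
    ∃ T r' m' G' addr', run prog ⟨8, r, m⟩ T = ⟨41, r', m'⟩ ∧ T ≤ 64 * w.size ∧
      HeapStep (fun a => r 15 ≤ a ∧ a < r 14 + w.size) r m G r' m' G' ∧ r' 10 = r 10 ∧
      r' 14 = r 14 + w.size ∧ r' 15 = r 15 ∧
      Fresh w.binders (r 4) addr G' (r' 4) addr' ∧ TermAt G' addr' (r' 12) w := by
  induction w with
  | var x =>
    intro l r m G addr hi hc h20 hG hn hpos hdep hle hw hin hctx
    obtain ⟨-, hx⟩ := hctx x (by simp [PTerm.fv])
    obtain ⟨r', m', G', hr, hst, h10, h14, h15, g0, g1⟩ := parseVar_run (k := l.idxOf x) hi hc h20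
      (hin 0 _ (by simp [PTerm.encodeIn]))
    exact ⟨_, r', m', G', addr, hr, by simp [PTerm.size], hst.weaken (by simp), h10, h14, h15,
      .nil _ _ _ _, g0, by rw [g1, hx]⟩
  | lam x w ih =>
    intro l r m G addr hi hc h20 hG hn hpos hdep hle hw hin hctx
    obtain ⟨hw1, hxw⟩ := hw.lam
    simp only [PTerm.size] at hpos
    have hsz := w.size_pos
    obtain ⟨r1, m1, G1, hr1, hst1, k10, k14, k15, g0, g1, g2, gc, hm1⟩ := parseLam_run hi hc h20
      (hin 0 _ (by simp [PTerm.encodeIn])) (hG _ (by omega)) (by omega)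
    have hc1 := hc.keep hst1.keep
    obtain ⟨T2, r2, m2, G2, addr2, hr2, hT2, hst2, k10', k14', k15', hf2, ht2⟩ := ih (x :: l) r1 m1
      G1 (update addr x (r 4)) hst1.inv hc1 (by rw [hst1.keep 20 (by simp [kept]), h20])
      (fun a ha => by rw [hst1.grow.2 a (by omega)]; exact hG a ha) (hn.trans hst1.grow.1)
      (by omega) (by rw [List.length_cons]; omega) (by omega) hw1 (by
        intro i v h
        have := (List.getElem?_eq_some_iff.1 h).1
        rw [PTerm.length_encodeIn] at this
        rw [k14, hst1.mem _ (by omega) (by omega), Nat.add_assoc, Nat.add_comm 1 i]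
        exact hin (i + 1) v (by rw [PTerm.encodeIn, List.getElem?_cons_succ, h])) (by
        intro y hy
        by_cases hxy : y = x
        · subst hxy
          refine ⟨by simp, ?_⟩
          simp [k15, hm1]
        · obtain ⟨h1, h2⟩ := hctx y (by simp [PTerm.fv, hxy, hy])
          refine ⟨by simp [h1], ?_⟩
          have := List.idxOf_lt_length_of_mem h1
          rw [List.idxOf_cons_ne _ (Ne.symm hxy), update_of_ne hxy, ← h2, k15,
            hst1.mem _ (by omega) (by omega)]
          congr 1
          omega)
    have gg := hst2.gle hst1.inv
    obtain ⟨r3, m3, G3, hr3, hst3, k10'', j14, j15, e0, e1, e2⟩ := retLam_run hst2.inv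
      (hc1.keep hst2.keep) (by omega) (k10' ▸ gg _ _ g0) (k10' ▸ gg _ _ g1) (k10' ▸ gg _ _ g2)
    refine ⟨5 + 11 + T2 + 17, r3, m3, G3, addr2, run_trans (run_trans hr1 hr2) hr3,
      by simp only [PTerm.size]; omega, ((hst1.trans hst2).trans hst3).weaken ?_, k10'',
      by simp only [PTerm.size]; omega, by omega, ?_, ?_⟩
    · simp only [PTerm.size, or_false]
      omega
    · exact ((Fresh.single gc le_rfl).append hf2 hst2.grow hst1.grow.1 (by simpa using hxw)).grow
        hst3.grow
    · refine ⟨e0, ?_, _, e2, ht2.mono (hst3.gle hst2.inv) fun _ _ => rfl⟩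
      rw [e1, hf2.eq x hxw]; simp
  | app w v ihw ihv =>
    intro l r m G addr hi hc h20 hG hn hpos hdep hle hw hin hctx
    obtain ⟨hw1, hv1, hwv, hvw⟩ := hw.app
    simp only [PTerm.size] at hpos
    have hlen := w.length_encodeIn l
    have hlen' := v.length_encodeIn l
    obtain ⟨r1, m1, G1, q, hr1, hst1, k10, k14, k15, g0, g1, g2⟩ := parseApp_run hi hc h20
      (hin 0 _ (by simp [PTerm.encodeIn]))
    have hc1 := hc.keep hst1.keep
    obtain ⟨T2, r2, m2, G2, addr2, hr2, hT2, hst2, k10', k14', k15', hf2, ht2⟩ := ihw l r1 m1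
      G1 addr hst1.inv hc1 (by rwa [hst1.keep 20 (by simp [kept])])
      (fun a ha => by rw [hst1.grow.2 a (by omega)]; exact hG a ha) (hn.trans hst1.grow.1)
      (by omega) (by omega) (by omega) hw1 (by
        intro i v' h
        have := (List.getElem?_eq_some_iff.1 h).1
        rw [k14, hst1.mem _ (by omega) (by simp), Nat.add_assoc, Nat.add_comm 1 i]
        refine hin (i + 1) v' ?_
        simpa [PTerm.encodeIn, List.getElem?_append_left this] using h) (by
        intro y hy
        obtain ⟨h1, h2⟩ := hctx y (by simp [PTerm.fv, hy])
        have := List.idxOf_lt_length_of_mem h1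
        refine ⟨h1, ?_⟩
        rw [k15, hst1.mem _ (by omega) (by simp), h2])
    have gg := hst2.gle hst1.inv
    have hc2 := hc1.keep hst2.keep
    obtain ⟨r3, m3, G3, hr3, hst3, k10'', -, j14, j15, e0, e1, e2⟩ := retFun_run hst2.inv
      hc2 (by omega) (k10' ▸ gg _ _ g0) (k10' ▸ gg _ _ g1) (k10' ▸ gg _ _ g2)
    have hst13 := (hst1.trans hst2).trans hst3
    have hc3 := hc2.keep hst3.keep
    obtain ⟨T4, r4, m4, G4, addr4, hr4, hT4, hst4, k10''', i14, i15, hf4, ht4⟩ := ihv l r3 m3 G3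
      addr2 hst3.inv hc3 (by rwa [hst13.keep 20 (by simp [kept])])
      (fun a ha => by rw [hst13.grow.2 a (by omega)]; exact hG a ha) (hn.trans hst13.grow.1)
      (by omega) (by omega) (by omega) hv1 (by
        intro i v' h
        have := (List.getElem?_eq_some_iff.1 h).1
        have e : r3 14 + i = r 14 + (w.size + i + 1) := by omega
        -- Reading the left child wrote only between the current depth and the end of its own
        -- serialization, so both the part of the input still to be read and the current context
        -- below `r 15` are intact.
        rw [hst13.mem _ (by omega) (by simp only [false_or, or_false]; omega), e]
        refine hin _ v' ?_
        simp only [PTerm.encodeIn, List.getElem?_cons_succ]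
        rw [List.getElem?_append_right (by omega), ← h]
        congr 1
        omega) (by
        intro y hy
        obtain ⟨h1, h2⟩ := hctx y (by simp [PTerm.fv, hy])
        have := List.idxOf_lt_length_of_mem h1
        refine ⟨h1, ?_⟩
        rw [hf2.eq y (fun h => hwv y h (PTerm.mem_names_iff.2 (.inl hy))), ← h2,
          hst13.mem _ (by omega) (by simp only [false_or, or_false]; omega)]
        congr 1
        omega)
    have gg' := hst4.gle hst3.inv
    obtain ⟨r5, m5, G5, hr5, hst5, j10, l14, l15, f0, f1, f2⟩ := retArg_run hst4.inv
      (hc3.keep hst4.keep) (by omega) (k10''' ▸ gg' _ _ e0) (k10''' ▸ gg' _ _ e1)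
      (k10''' ▸ gg' _ _ e2)
    refine ⟨6 + 8 + T2 + 18 + T4 + 19, r5, m5, G5, addr4,
      run_trans (run_trans (run_trans (run_trans hr1 hr2) hr3) hr4) hr5,
      by simp only [PTerm.size]; omega, ((hst13.trans hst4).trans hst5).weaken ?_, j10,
      by simp only [PTerm.size]; omega, by omega, ?_, ?_⟩
    · simp only [PTerm.size, false_or, or_false]
      omega
    · exact ((((hf2.grow hst3.grow).base hst1.grow.1).append hf4 hst4.grow
        (hst1.grow.1.trans (hst2.grow.1.trans hst3.grow.1)) fun x hx hx' =>
          hwv x hx (PTerm.mem_names_iff.2 (.inr hx'))).grow hst5.grow)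
    · refine ⟨f0, _, _, f1, f2, ?_, ht4.mono (hst5.gle hst4.inv) fun _ _ => rfl⟩
      exact ht2.mono ((hst3.trans (hst4.trans hst5)).gle hst2.inv) fun x hx =>
        hf4.eq x fun h => hvw x h hx

end parse
end SMAD

/-! ### Skeletal decomposition in linear time -/

namespace PTerm

theorem SkelDec.names {θ : Finset ℕ} {t w : PTerm} {F : List (ℕ × PTerm)} (h : SkelDec θ t w F) :
    (∀ x ∈ w.names, x ∈ t.names ∨ x ∈ F.map Prod.fst) ∧ ∀ p ∈ F, ∀ x ∈ p.2.names, x ∈ t.names := by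
  induction h with
  | extract θ t z hfree hvar => simp [PTerm.names]
  | var θ x => simp [PTerm.names]
  | lam θ x u s F hdep h ih =>
    refine ⟨fun y hy => ?_, fun p hp y hy => ?_⟩
    · rcases List.mem_cons.1 hy with rfl | hy
      · simp [PTerm.names]
      · rcases ih.1 y hy with h | h <;> simp [PTerm.names, h]
    · simp [PTerm.names, ih.2 p hp y hy]
  | app θ u s r p F G hdep hu hs ihu ihs =>
    refine ⟨fun y hy => ?_, fun q hq y hy => ?_⟩
    · rw [List.map_append, List.mem_append]
      rcases List.mem_append.1 hy with hy | hy
      · rcases ihu.1 y hy with h | h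
        · exact .inl (List.mem_append.2 (.inl h))
        · exact .inr (.inl h)
      · rcases ihs.1 y hy with h | h
        · exact .inl (List.mem_append.2 (.inr h))
        · exact .inr (.inr h)
    · rcases List.mem_append.1 hq with hq | hq
      · exact List.mem_append.2 (.inl (ihu.2 q hq y hy))
      · exact List.mem_append.2 (.inr (ihs.2 q hq y hy))

/-- The side conditions of the other rules exclude them here, so the decomposition is forced up to
the name `z`. -/
theorem SkelDec.of_disjoint {θ : Finset ℕ} {t w : PTerm} {F : List (ℕ × PTerm)}
    (h : SkelDec θ t w F) (hd : Disjoint t.fv θ) (hv : ¬ t.IsVar) :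
    ∃ z, w = PTerm.var z ∧ F = [(z, t)] := by
  cases h with
  | extract θ t z hfree hvar => exact ⟨z, rfl, rfl⟩
  | var θ x => exact absurd trivial hv
  | lam θ x u s F hdep h => exact absurd hd hdep
  | app θ u s r p F G hdep hu hs => exact absurd hd hdep

end PTerm

namespace SMAD
open RAM

theorem fleshEnv_names {F : List (ℕ × PTerm)} {x : ℕ}
    (h : x ∈ (fleshEnv F).flatMap Entry.names) :
    x ∈ F.map Prod.fst ∨ ∃ p ∈ F, x ∈ p.2.names := by
  simp only [fleshEnv, List.mem_flatMap, List.mem_map] at h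
  obtain ⟨_, ⟨p, hp, rfl⟩, hx⟩ := h
  rcases List.mem_cons.1 hx with rfl | hx
  · exact .inl (List.mem_map.2 ⟨p, hp, rfl⟩)
  · exact .inr ⟨p, hp, hx⟩

/-- `M` is the largest mark of a variable in `s`. -/
def MarkMax (s : Finset ℕ) (m addr : ℕ → ℕ) (M : ℕ) : Prop :=
  (∀ y ∈ s, m (addr y + 3) ≤ M) ∧ (M = 0 ∨ ∃ y ∈ s, m (addr y + 3) = M)

section decompose
variable {r m : ℕ → ℕ} {G : ℕ → Option ℕ}

/-- The first new record is both the variable `z` and its entry, and stays writable; the second,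
frozen, is the term `var z`. The next pointer of the entry is `r 18`, the flesh saved when the
traversal entered the extracted term: everything extracted inside that term is thereby discarded.
The returned mark is `0`, because a skeleton that is a new variable comes from a term disjoint from
the enclosing binders. -/
theorem extract_run (hi : HeapInv G (r 4) m) (hc : Consts r) {t : PTerm} {addr : ℕ → ℕ}
    (ht : TermAt G addr (r 17) t) :
    ∃ r' m' G', run prog ⟨252, r, m⟩ 16 = ⟨211, r', m'⟩ ∧
      HeapStep (fun _ => False) r m G r' m' G' ∧ r' 10 = r 10 ∧ r' 14 = r 14 ∧ r' 13 = 0 ∧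
      ∀ z addr₂, (∀ x ∈ t.names, addr₂ x = addr x) → z ∉ t.names →
        ∃ addr', Fresh [z] (r 4) addr₂ G' (r' 4) addr' ∧ m' (addr' z + 3) = 0 ∧
          TermAt G' addr' (r' 12) (.var z) ∧
          EnvAt G' m' addr' (r' 15) (fleshEnv [(z, t)]) (r 18) := by
  obtain ⟨r', hr, h4, h10, h12, h13, h14, h15, hk⟩ : ∃ r', run prog ⟨252, r, m⟩ 16 =
      ⟨211, r', update (update (update (update (update (update m (r 4) 1) (r 4 + 1) (r 17))
        (r 4 + 2) (r 18)) (r 4 + 3) 0) (r 4 + 4) 0) (r 4 + 4 + 1) (r 4)⟩ ∧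
      r' 4 = r 4 + 4 + 4 ∧ r' 10 = r 10 ∧ r' 12 = r 4 + 4 ∧ r' 13 = 0 ∧ r' 14 = r 14 ∧
      r' 15 = r 4 ∧ Keep r r' := by
    simp [run_succ, run_zero, Keep, kept, hc.h6, hc.h7, hc.h8, hc.h9, hc.h21]
  have hd := hi.dvd
  have hp := hi.pos
  have hst := HeapStep.freeze (W := fun _ => False) (r' := r') (m' := update (update (update (update
    (update (update m (r 4) 1) (r 4 + 1) (r 17)) (r 4 + 2) (r 18)) (r 4 + 3) 0) (r 4 + 4) 0)
    (r 4 + 4 + 1) (r 4)) (k := r 4 + 4) hi hk (by omega) (by omega) (by omega) (by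
      intro a ha _
      rw [update_of_ne (by omega), update_of_ne (by omega), update_of_ne (by omega),
        update_of_ne (by omega), update_of_ne (by omega), update_of_ne (by omega)]) (by simp)
  have hgle := hst.gle hi
  refine ⟨r', _, _, hr, hst, h10, h14, h13, fun z addr₂ ha hz => ⟨update addr₂ z (r 4),
    .single ⟨hd, hp, by omega, fun i h => ?_⟩ le_rfl, by simp, ⟨?_, ?_⟩, ?_⟩⟩
  · simp only [freeze]
    rw [if_neg (by omega), hi.bound _ (by omega)]
  · simp [freeze, h12]
  · simp [freeze, h12]
  · refine ⟨by omega, by simp [Entry.name, h15], ?_, ?_, by simp [h15, EnvAt]⟩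
    · rw [h15, update_of_ne (by omega), update_of_ne (by omega), update_of_ne (by omega),
        update_of_ne (by omega), update_of_ne (by omega), update_self]
      rfl
    have e : (update (update (update (update (update (update m (r 4) 1) (r 4 + 1) (r 17))
        (r 4 + 2) (r 18)) (r 4 + 3) 0) (r 4 + 4) 0) (r 4 + 4 + 1) (r 4)) (r' 15 + 1) = r 17 := by
      simp [h15]
    rw [e]
    exact ht.mono hgle fun x hx => by
      rw [update_of_ne (by rintro rfl; exact hz hx), ha x hx]

theorem decVar_run {a : ℕ} (hi : HeapInv G (r 4) m) (hc : Consts r)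
    (h0 : G (r 11) = some 0) (h1 : G (r 11 + 1) = some a) :
    ∃ r', run prog ⟨181, r, m⟩ 7 = ⟨211, r', m⟩ ∧ HeapStep (fun _ => False) r m G r' m G ∧
      r' 10 = r 10 ∧ r' 12 = r 11 ∧ r' 13 = m (a + 3) ∧ r' 14 = r 14 ∧ r' 15 = r 15 := by
  obtain ⟨r', hr, h4, h10, h12, h13, h14, h15, hk⟩ : ∃ r', run prog ⟨181, r, m⟩ 7 = ⟨211, r', m⟩ ∧
      r' 4 = r 4 ∧ r' 10 = r 10 ∧ r' 12 = r 11 ∧ r' 13 = m (a + 3) ∧ r' 14 = r 14 ∧ r' 15 = r 15 ∧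
      Keep r r' := by
    simp [run_succ, run_zero, Keep, kept, hc.h6, hc.h8, hi.sub _ _ h0, hi.sub _ _ h1]
  exact ⟨r', hr, .write hi hk h4.ge (h4 ▸ hi.dvd) (fun _ _ _ => rfl) (by simp), h10, h12, h13, h14,
    h15⟩

theorem decLam_run {a p : ℕ} (hi : HeapInv G (r 4) m) (hc : Consts r)
    (h0 : G (r 11) = some 1) (h1 : G (r 11 + 1) = some a) (h2 : G (r 11 + 2) = some p)
    (ha : Cell G (r 4) a) :
    ∃ r' m' G', run prog ⟨181, r, m⟩ 22 = ⟨181, r', m'⟩ ∧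
      HeapStep (fun b => b = a + 3) r m G r' m' G' ∧ r' 10 ≠ 0 ∧ r' 11 = p ∧ r' 14 = r 14 - 1 ∧
      r' 15 = r 15 ∧ m' (a + 3) = r 14 ∧ G' (r' 10) = some 1 ∧ G' (r' 10 + 1) = some (r 11) ∧
      G' (r' 10 + 2) = some (r 15) ∧ G' (r' 10 + 3) = some (r 10) := by
  obtain ⟨r', hr, h4, h10, h11, h14, h15, hk⟩ : ∃ r', run prog ⟨181, r, m⟩ 22 =
      ⟨181, r', update (update (update (update (update m (a + 3) (r 14)) (r 4) 1) (r 4 + 1) (r 11))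
        (r 4 + 2) (r 15)) (r 4 + 3) (r 10)⟩ ∧
      r' 4 = r 4 + 4 ∧ r' 10 = r 4 ∧ r' 11 = p ∧ r' 14 = r 14 - 1 ∧ r' 15 = r 15 ∧ Keep r r' := by
    simp [run_succ, run_zero, Keep, kept, hc.h6, hc.h7, hc.h8, hc.h9, hi.sub _ _ h0,
      hi.sub _ _ h1, hi.sub _ _ h2]
  have hd := hi.dvd
  have hp := hi.pos
  have hle := ha.le
  refine ⟨r', _, _, hr, .freeze hi hk le_rfl h4.ge (by omega) ?_ ?_,
    by omega, h11, h14, h15, ?_, ?_, ?_, ?_, ?_⟩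
  · intro b hb hne
    rw [update_of_ne (by omega), update_of_ne (by omega), update_of_ne (by omega),
      update_of_ne (by omega), update_of_ne hne]
  · rintro b rfl
    exact ha.free 3 (by simp)
  · rw [update_of_ne (by omega), update_of_ne (by omega), update_of_ne (by omega),
      update_of_ne (by omega), update_self]
  · simp [freeze, h10]
  · simp [freeze, h10]
  · simp [freeze, h10]
  · simp [freeze, h10]

/-- The argument is visited before the function because the flesh is built by adding at the front,
and the flesh of the function must come first. The frame keeps the source term and the current
flesh, in case the whole application is extracted. -/
theorem decApp_run {p : ℕ} (hi : HeapInv G (r 4) m) (hc : Consts r)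
    (h0 : G (r 11) = some 2) (h2 : G (r 11 + 2) = some p) :
    ∃ r' m' G', run prog ⟨181, r, m⟩ 20 = ⟨181, r', m'⟩ ∧
      HeapStep (fun _ => False) r m G r' m' G' ∧ r' 10 ≠ 0 ∧ r' 11 = p ∧ r' 14 = r 14 ∧
      r' 15 = r 15 ∧ G' (r' 10) = some 0 ∧ G' (r' 10 + 1) = some (r 11) ∧
      G' (r' 10 + 2) = some (r 15) ∧ G' (r' 10 + 3) = some (r 10) := by
  obtain ⟨r', hr, h4, h10, h11, h14, h15, hk⟩ : ∃ r', run prog ⟨181, r, m⟩ 20 =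
      ⟨181, r', update (update (update (update m (r 4) 0) (r 4 + 1) (r 11))
        (r 4 + 2) (r 15)) (r 4 + 3) (r 10)⟩ ∧
      r' 4 = r 4 + 4 ∧ r' 10 = r 4 ∧ r' 11 = p ∧ r' 14 = r 14 ∧ r' 15 = r 15 ∧ Keep r r' := by
    simp [run_succ, run_zero, Keep, kept, hc.h6, hc.h7, hc.h8, hc.h9, hc.h21, hi.sub _ _ h0,
      hi.sub _ _ h2]
  have hd := hi.dvd
  have hp := hi.pos
  refine ⟨r', _, _, hr, .freeze hi hk le_rfl h4.ge (by omega) ?_ (by simp),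
    by omega, h11, h14, h15, ?_, ?_, ?_, ?_⟩
  · intro b hb _
    rw [update_of_ne (by omega), update_of_ne (by omega), update_of_ne (by omega),
      update_of_ne (by omega)]
  · simp [freeze, h10]
  · simp [freeze, h10]
  · simp [freeze, h10]
  · simp [freeze, h10]

/-- The frame of tag `0` is not discarded: the new frame of tag `2` points to it, so that the source
term and the saved flesh are still available when the function has been visited. -/
theorem decRetArg_run {s p q k : ℕ} (hi : HeapInv G (r 4) m) (hc : Consts r) (hK : r 10 ≠ 0)
    (h0 : G (r 10) = some 0) (h1 : G (r 10 + 1) = some s) (h2 : G (r 10 + 2) = some q)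
    (h3 : G (r 10 + 3) = some k) (hs : G (s + 1) = some p) :
    ∃ r' m' G', run prog ⟨211, r, m⟩ 21 = ⟨181, r', m'⟩ ∧
      HeapStep (fun _ => False) r m G r' m' G' ∧ r' 10 ≠ 0 ∧ r' 11 = p ∧ r' 14 = r 14 ∧
      r' 15 = r 15 ∧ G' (r' 10) = some 2 ∧ G' (r' 10 + 1) = some (r 12) ∧
      G' (r' 10 + 2) = some (r 13) ∧ G' (r' 10 + 3) = some (r 10) := by
  obtain ⟨r', hr, h4, h10, h11, h14, h15, hk⟩ : ∃ r', run prog ⟨211, r, m⟩ 21 =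
      ⟨181, r', update (update (update (update m (r 4) 2) (r 4 + 1) (r 12))
        (r 4 + 2) (r 13)) (r 4 + 3) (r 10)⟩ ∧
      r' 4 = r 4 + 4 ∧ r' 10 = r 4 ∧ r' 11 = p ∧ r' 14 = r 14 ∧ r' 15 = r 15 ∧ Keep r r' := by
    simp [run_succ, run_zero, Keep, kept, hc.h6, hc.h7, hc.h8, hc.h9, hK, hi.sub _ _ h0,
      hi.sub _ _ h1, hi.sub _ _ h2, hi.sub _ _ h3, hi.sub _ _ hs]
  have hd := hi.dvd
  have hp := hi.pos
  refine ⟨r', _, _, hr, .freeze hi hk le_rfl h4.ge (by omega) ?_ (by simp),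
    by omega, h11, h14, h15, ?_, ?_, ?_, ?_⟩
  · intro b hb _
    rw [update_of_ne (by omega), update_of_ne (by omega), update_of_ne (by omega),
      update_of_ne (by omega)]
  · simp [freeze, h10]
  · simp [freeze, h10]
  · simp [freeze, h10]
  · simp [freeze, h10]

/-- On entering the abstraction the counter was lowered by one, so `r 14 + 1` is the mark of its own
binder. If no free variable of the body has a larger mark, no enclosing binder occurs in the
abstraction. -/
theorem decRetLam_extract {s q k : ℕ} (hi : HeapInv G (r 4) m) (hc : Consts r) (hK : r 10 ≠ 0)
    (h0 : G (r 10) = some 1) (h1 : G (r 10 + 1) = some s) (h2 : G (r 10 + 2) = some q)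
    (h3 : G (r 10 + 3) = some k) (hM : r 13 ≤ r 14 + 1) :
    ∃ r', run prog ⟨211, r, m⟩ 15 = ⟨252, r', m⟩ ∧
      HeapStep (fun _ => False) r m G r' m G ∧ r' 10 = k ∧ r' 14 = r 14 + 1 ∧ r' 17 = s ∧
      r' 18 = q := by
  obtain ⟨r', hr, h4, h10, h14, h17, h18, hk⟩ : ∃ r', run prog ⟨211, r, m⟩ 15 =
      ⟨252, r', m⟩ ∧ r' 4 = r 4 ∧ r' 10 = k ∧ r' 14 = r 14 + 1 ∧ r' 17 = s ∧ r' 18 = q ∧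
      Keep r r' := by
    have := Nat.sub_eq_zero_of_le hM
    simp [run_succ, run_zero, Keep, kept, hc.h6, hc.h7, hc.h8, hK, hi.sub _ _ h0,
      hi.sub _ _ h1, hi.sub _ _ h2, hi.sub _ _ h3, this]
  exact ⟨r', hr, .write hi hk h4.ge (h4 ▸ hi.dvd) (fun _ _ _ => rfl) (by simp), h10, h14, h17, h18⟩

theorem decRetLam_node {s q k y : ℕ} (hi : HeapInv G (r 4) m) (hc : Consts r) (hK : r 10 ≠ 0)
    (h0 : G (r 10) = some 1) (h1 : G (r 10 + 1) = some s) (h2 : G (r 10 + 2) = some q)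
    (h3 : G (r 10 + 3) = some k) (hs : G (s + 1) = some y) (hM : ¬ r 13 ≤ r 14 + 1) :
    ∃ r' m' G', run prog ⟨211, r, m⟩ 25 = ⟨211, r', m'⟩ ∧
      HeapStep (fun _ => False) r m G r' m' G' ∧ r' 10 = k ∧ r' 13 = r 13 ∧ r' 14 = r 14 + 1 ∧
      r' 15 = r 15 ∧ G' (r' 12) = some 1 ∧ G' (r' 12 + 1) = some y ∧
      G' (r' 12 + 2) = some (r 12) := by
  obtain ⟨r', hr, h4, h10, h12, h13, h14, h15, hk⟩ : ∃ r', run prog ⟨211, r, m⟩ 25 =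
      ⟨211, r', update (update (update m (r 4) 1) (r 4 + 1) y) (r 4 + 2) (r 12)⟩ ∧
      r' 4 = r 4 + 4 ∧ r' 10 = k ∧ r' 12 = r 4 ∧ r' 13 = r 13 ∧ r' 14 = r 14 + 1 ∧ r' 15 = r 15 ∧
      Keep r r' := by
    have : r 13 - (r 14 + 1) ≠ 0 := by omega
    simp [run_succ, run_zero, Keep, kept, hc.h6, hc.h7, hc.h8, hc.h9, hK, hi.sub _ _ h0,
      hi.sub _ _ h1, hi.sub _ _ h2, hi.sub _ _ h3, hi.sub _ _ hs, this]
  have hd := hi.dvd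
  refine ⟨r', _, _, hr, .freeze hi hk le_rfl h4.ge (by omega) ?_ (by simp),
    h10, h13, h14, h15, ?_, ?_, ?_⟩
  · intro b hb _
    rw [update_of_ne (by omega), update_of_ne (by omega), update_of_ne (by omega)]
  · simp [freeze, h12]
  · simp [freeze, h12]
  · simp [freeze, h12]

/-- With truncated subtraction, `r 13 + (M - r 13)` is the maximum of the marks returned by the two
children. It is `0` exactly when neither contains a marked variable. -/
theorem decRetFun_extract {p M j s q k : ℕ} (hi : HeapInv G (r 4) m) (hc : Consts r)
    (hK : r 10 ≠ 0) (h0 : G (r 10) = some 2) (h1 : G (r 10 + 1) = some p)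
    (h2 : G (r 10 + 2) = some M) (h3 : G (r 10 + 3) = some j) (j1 : G (j + 1) = some s)
    (j2 : G (j + 2) = some q) (j3 : G (j + 3) = some k) (hM : r 13 + (M - r 13) = 0) :
    ∃ r', run prog ⟨211, r, m⟩ 21 = ⟨252, r', m⟩ ∧
      HeapStep (fun _ => False) r m G r' m G ∧ r' 10 = k ∧ r' 14 = r 14 ∧ r' 17 = s ∧
      r' 18 = q := by
  obtain ⟨r', hr, h4, h10, h14, h17, h18, hk⟩ : ∃ r', run prog ⟨211, r, m⟩ 21 =
      ⟨252, r', m⟩ ∧ r' 4 = r 4 ∧ r' 10 = k ∧ r' 14 = r 14 ∧ r' 17 = s ∧ r' 18 = q ∧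
      Keep r r' := by
    obtain ⟨hM1, rfl⟩ : r 13 = 0 ∧ M = 0 := by omega
    simp [run_succ, run_zero, Keep, kept, hc.h6, hc.h7, hc.h8, hK, hi.sub _ _ h0,
      hi.sub _ _ h1, hi.sub _ _ h2, hi.sub _ _ h3, hi.sub _ _ j1, hi.sub _ _ j2, hi.sub _ _ j3, hM1]
  exact ⟨r', hr, .write hi hk h4.ge (h4 ▸ hi.dvd) (fun _ _ _ => rfl) (by simp), h10, h14, h17, h18⟩

theorem decRetFun_node {p M j s q k : ℕ} (hi : HeapInv G (r 4) m) (hc : Consts r)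
    (hK : r 10 ≠ 0) (h0 : G (r 10) = some 2) (h1 : G (r 10 + 1) = some p)
    (h2 : G (r 10 + 2) = some M) (h3 : G (r 10 + 3) = some j) (j1 : G (j + 1) = some s)
    (j2 : G (j + 2) = some q) (j3 : G (j + 3) = some k) (hM : r 13 + (M - r 13) ≠ 0) :
    ∃ r' m' G', run prog ⟨211, r, m⟩ 30 = ⟨211, r', m'⟩ ∧
      HeapStep (fun _ => False) r m G r' m' G' ∧ r' 10 = k ∧ r' 13 = r 13 + (M - r 13) ∧
      r' 14 = r 14 ∧ r' 15 = r 15 ∧ G' (r' 12) = some 2 ∧ G' (r' 12 + 1) = some (r 12) ∧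
      G' (r' 12 + 2) = some p := by
  obtain ⟨r', hr, h4, h10, h12, h13, h14, h15, hk⟩ : ∃ r', run prog ⟨211, r, m⟩ 30 =
      ⟨211, r', update (update (update m (r 4) 2) (r 4 + 1) (r 12)) (r 4 + 2) p⟩ ∧
      r' 4 = r 4 + 4 ∧ r' 10 = k ∧ r' 12 = r 4 ∧ r' 13 = r 13 + (M - r 13) ∧ r' 14 = r 14 ∧
      r' 15 = r 15 ∧ Keep r r' := by
    simp [run_succ, run_zero, Keep, kept, hc.h6, hc.h7, hc.h8, hc.h9, hK, hi.sub _ _ h0,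
      hi.sub _ _ h1, hi.sub _ _ h2, hi.sub _ _ h3, hi.sub _ _ j1, hi.sub _ _ j2, hi.sub _ _ j3,
      -Nat.add_eq_zero_iff, hM]
  have hd := hi.dvd
  refine ⟨r', _, _, hr, .freeze hi hk le_rfl h4.ge (by omega) ?_ (by simp),
    h10, h13, h14, h15, ?_, ?_, ?_⟩
  · intro b hb _
    rw [update_of_ne (by omega), update_of_ne (by omega), update_of_ne (by omega)]
  · simp [freeze, h12]
  · simp [freeze, h12]
  · simp [freeze, h12]

end decompose
end SMAD

namespace SMAD
open RAM

/-- Whether a subterm meets `θ` is known only after its traversal, so the algorithm proceeds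
bottom-up: it decomposes the children as if the node were kept, and if the largest mark shows that
the node is disjoint from `θ`, it throws that work away and extracts the node. This visits each
construct once, at a cost of at most 78 instructions.

The bound `s.size ≤ r 14` keeps all marks given inside `s` positive, and the marks of `θ` exceed the
counter `r 14`, hence all those given inside. The last clause speaks of every decomposition allowed
by the relation and of every `addr₂` that agrees with `addr` on `s`, so that the names chosen by the
run for the fleshes of an application can be assigned one after the other. -/
theorem dec_run (s : PTerm) : ∀ (θ : Finset ℕ) (r m : ℕ → ℕ) (G : ℕ → Option ℕ) (addr : ℕ → ℕ),
    HeapInv G (r 4) m → Consts r → TermAt G addr (r 11) s →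
    (∀ y ∈ s.names, Cell G (r 4) (addr y)) →
    (∀ x ∈ s.names, ∀ y ∈ s.names, addr x = addr y → x = y) → s.Clean → s.size ≤ r 14 →
    (∀ y ∈ s.fv, (y ∈ θ ∧ r 14 < m (addr y + 3)) ∨ (y ∉ θ ∧ m (addr y + 3) = 0)) →
    ∃ T r' m' G', run prog ⟨181, r, m⟩ T = ⟨211, r', m'⟩ ∧ T ≤ 128 * s.size ∧
      HeapStep (fun a => ∃ y ∈ s.binders, a = addr y + 3) r m G r' m' G' ∧ r' 10 = r 10 ∧
      r' 14 = r 14 ∧ MarkMax s.fv m addr (r' 13) ∧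
      ∀ w F addr₂, PTerm.SkelDec θ s w F → (F.map Prod.fst).Nodup →
        (∀ z ∈ F.map Prod.fst, z ∉ s.names) → (∀ x ∈ s.names, addr₂ x = addr x) →
        ∃ addr', Fresh (F.map Prod.fst) (r 4) addr₂ G' (r' 4) addr' ∧
          (∀ z ∈ F.map Prod.fst, m' (addr' z + 3) = 0) ∧ TermAt G' addr' (r' 12) w ∧
          EnvAt G' m' addr' (r' 15) (fleshEnv F) (r 15) := by
  induction s with
  | var y =>
    intro θ r m G addr hi hc ht hcell hinj hs hsz hmark
    obtain ⟨r', hr, hst, h10, h12, h13, h14, h15⟩ := decVar_run hi hc ht.1 ht.2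
    refine ⟨7, r', m, G, hr, by simp [PTerm.size], hst.weaken (by simp), h10, h14, ?_, ?_⟩
    · simp [MarkMax, PTerm.fv, h13]
    · intro w F addr₂ hdec hnd hfr ha
      cases hdec with
      | extract _ _ z hfree hvar => exact absurd trivial hvar
      | var =>
        refine ⟨addr₂, .nil _ _ _ _, by simp, ?_, by simp [fleshEnv, EnvAt, h15]⟩
        rw [h12]
        exact ht.mono (GLe.refl G) ha
  | lam y s ih =>
    intro θ r m G addr hi hc ht hcell hinj hs hsz hmark
    have htt := ht
    obtain ⟨t0, t1, p, t2, t3⟩ := ht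
    simp only [PTerm.names, List.mem_cons, forall_eq_or_imp] at hcell hinj
    simp only [PTerm.size] at hsz
    obtain ⟨hcy, hcell⟩ := hcell
    obtain ⟨hs1, hys⟩ := hs.lam
    obtain ⟨r1, m1, G1, hr1, hst1, k10, h11, h14, h15, hm1, g0, g1, g2, g3⟩ :=
      decLam_run hi hc t0 t1 t2 hcy
    have hc1 := hc.keep hst1.keep
    have hm1' : ∀ z ∈ s.fv, z ≠ y → m1 (addr z + 3) = m (addr z + 3) := fun z hz hzy => by
      have hzn := PTerm.mem_names_iff.2 (.inl hz)
      have := (hcell z hzn).le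
      exact hst1.mem _ (by omega) fun h => hzy (hinj.1.2 z hzn (by omega)).symm
    obtain ⟨T2, r2, m2, G2, hr2, hT2, hst2, k10', k14', hM, hdec2⟩ := ih (insert y θ) r1 m1 G1
      addr hst1.inv hc1 (h11 ▸ t3.mono (hst1.gle hi) fun _ _ => rfl)
      (fun z hz => (hcell z hz).grow hst1.grow) (fun u hu v hv => hinj.2 u hu |>.2 v hv) hs1
      (by omega) (by
        intro z hz
        by_cases hzy : z = y
        · subst hzy
          -- The binder has received the mark `r 14` and the body is visited with the counter `r 14
          -- - 1`; the subtraction is not truncated because the abstraction has positive size.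
          exact .inl ⟨by simp, by omega⟩
        · rw [hm1' z hz hzy]
          rcases hmark z (by simp [PTerm.fv, hz, hzy]) with ⟨h1, h2⟩ | ⟨h1, h2⟩
          · exact .inl ⟨by simp [h1], by omega⟩
          · exact .inr ⟨by simp [h1, hzy], h2⟩)
    have gg := hst2.gle hst1.inv
    have hgg := (hst1.trans hst2).gle hi
    have hc2 := hc1.keep hst2.keep
    have hW : ∀ a, (((a = addr y + 3 ∨ ∃ z ∈ s.binders, a = addr z + 3) ∨ False) ∨ False) →
        ∃ z ∈ (PTerm.lam y s).binders, a = addr z + 3 := by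
      rintro a (((rfl | ⟨z, hz, rfl⟩) | h) | h)
      · exact ⟨y, by simp [PTerm.binders], rfl⟩
      · exact ⟨z, by simp [PTerm.binders, hz], rfl⟩
      · exact h.elim
      · exact h.elim
    -- The test of the program; the two branches are shown to agree with the rules `extract` and
    -- `lam`.
    by_cases hle : r2 13 ≤ r2 14 + 1
    · obtain ⟨r3, hr3, hst3, j10, j14, j17, j18⟩ := decRetLam_extract hst2.inv hc2 (by omega)
        (k10' ▸ gg _ _ g0) (k10' ▸ gg _ _ g1) (k10' ▸ gg _ _ g2) (k10' ▸ gg _ _ g3) hle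
      have hst13 := (hst1.trans hst2).trans hst3
      obtain ⟨r4, m4, G4, hr4, hst4, i10, i14, i13, hex⟩ := extract_run hst3.inv
        (hc2.keep hst3.keep) (t := .lam y s) (addr := addr)
        (j17 ▸ htt.mono hgg fun _ _ => rfl)
      have hz : ∀ z ∈ (PTerm.lam y s).fv, z ∉ θ ∧ m (addr z + 3) = 0 := by
        intro z hz
        rcases hmark z hz with ⟨h1, h2⟩ | h
        · have := hM.1 z (Finset.mem_of_mem_erase hz)
          rw [hm1' z (Finset.mem_of_mem_erase hz) (Finset.ne_of_mem_erase hz)] at this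
          omega
        · exact h
      refine ⟨22 + T2 + 15 + 16, r4, m4, G4,
        run_trans (run_trans (run_trans hr1 hr2) hr3) hr4, by simp only [PTerm.size]; omega,
        (hst13.trans hst4).weaken fun a _ => hW a, by omega, by omega,
        ⟨fun z hz' => by rw [(hz z hz').2]; omega, .inl i13⟩, ?_⟩
      intro w F addr₂ hdec hnd hfr ha
      obtain ⟨z, rfl, rfl⟩ := hdec.of_disjoint
        (Finset.disjoint_left.2 fun z hz' => (hz z hz').1) (by simp [PTerm.IsVar])
      obtain ⟨addr', f1, f2, f3, f4⟩ := hex z addr₂ ha (hfr z (by simp))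
      exact ⟨addr', f1.base hst13.grow.1, by simpa using f2, f3, by rwa [j18] at f4⟩
    · obtain ⟨r3, m3, G3, hr3, hst3, j10, j13, j14, j15, e0, e1, e2⟩ := decRetLam_node hst2.inv hc2
        (by omega) (k10' ▸ gg _ _ g0) (k10' ▸ gg _ _ g1) (k10' ▸ gg _ _ g2) (k10' ▸ gg _ _ g3)
        (hgg _ _ t1) hle
      obtain ⟨z, hz, hzM⟩ := hM.2.resolve_left (by omega)
      -- The largest mark exceeds that of `y`, so it is attained at a variable free in the
      -- abstraction. Its mark is positive, so it lies in `θ` and extraction is excluded. The same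
      -- number is thus the maximum for the abstraction, without removing `y` from anything.
      have hzy : z ≠ y := by rintro rfl; omega
      rw [hm1' z hz hzy] at hzM
      have hzf : z ∈ (PTerm.lam y s).fv := by simp [PTerm.fv, hz, hzy]
      refine ⟨22 + T2 + 25, r3, m3, G3, run_trans (run_trans hr1 hr2) hr3,
        by simp only [PTerm.size]; omega,
        ((hst1.trans hst2).trans hst3).weaken fun a _ h => hW a (.inl h), by omega, by omega,
        ⟨fun x hx => ?_, .inr ⟨z, hzf, by omega⟩⟩, ?_⟩
      · have := hM.1 x (Finset.mem_of_mem_erase hx)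
        rw [hm1' x (Finset.mem_of_mem_erase hx) (Finset.ne_of_mem_erase hx)] at this
        omega
      · intro w F addr₂ hdec hnd hfr ha
        cases hdec with
        | extract _ _ z' hfree hvar =>
          rcases hmark z hzf with ⟨h1, h2⟩ | ⟨h1, h2⟩
          · exact absurd h1 (Finset.disjoint_left.1 hfree hzf)
          · omega
        | lam _ _ _ s' _ hdep hsub =>
          obtain ⟨addr', f1, f2, f3, f4⟩ := hdec2 s' F addr₂ hsub hnd
            (fun z hz h => hfr z hz (by simp [PTerm.names, h]))
            (fun x hx => ha x (by simp [PTerm.names, hx]))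
          have hyF : y ∉ F.map Prod.fst := fun h => hfr y h (by simp [PTerm.names])
          refine ⟨addr', (f1.base hst1.grow.1).grow hst3.grow, ?_, ⟨e0, ?_, _, e2,
            f3.mono (hst3.gle hst2.inv) fun _ _ => rfl⟩, ?_⟩
          · intro x hx
            have := (f1.cell x hx).1.le
            rw [hst3.mem _ (by omega) (by simp), f2 x hx]
          · rw [e1, f1.eq y hyF, ha y (by simp [PTerm.names])]
          · rw [j15, ← h15]
            refine f4.mono (hst3.gle hst2.inv) (fun _ _ => rfl) fun e he i hi => ?_
            have hx : e.name ∈ F.map Prod.fst := by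
              simp only [fleshEnv, List.mem_map] at he
              obtain ⟨q, hq, rfl⟩ := he
              exact List.mem_map.2 ⟨q, hq, rfl⟩
            have := (f1.cell _ hx).1.le
            exact hst3.mem _ (by omega) (by simp)
  | app s u ihs ihu =>
    intro θ r m G addr hi hc ht hcell hinj hs hsz hmark
    have htt := ht
    obtain ⟨t0, p, q, t1, t2, t3, t4⟩ := ht
    simp only [PTerm.size] at hsz
    simp only [PTerm.names, List.mem_append] at hcell hinj
    obtain ⟨hs1, hu1, hsu, hus⟩ := hs.app
    obtain ⟨r1, m1, G1, hr1, hst1, k10, h11, h14, h15, g0, g1, g2, g3⟩ := decApp_run hi hc t0 t2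
    have hc1 := hc.keep hst1.keep
    have hm1 : ∀ z ∈ u.fv, m1 (addr z + 3) = m (addr z + 3) := fun z hz => by
      have := (hcell z (.inr (PTerm.mem_names_iff.2 (.inl hz)))).le
      exact hst1.mem _ (by omega) (by simp)
    obtain ⟨T2, r2, m2, G2, hr2, hT2, hst2, k10', k14', hM2, hdec2⟩ := ihu θ r1 m1 G1
      addr hst1.inv hc1 (h11 ▸ t4.mono (hst1.gle hi) fun _ _ => rfl)
      (fun z hz => (hcell z (.inr hz)).grow hst1.grow)
      (fun x hx y hy => hinj x (.inr hx) y (.inr hy)) hu1 (by omega) (by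
        intro z hz
        rw [hm1 z hz, h14]
        exact hmark z (by simp [PTerm.fv, hz]))
    have gg := hst2.gle hst1.inv
    have hgg := (hst1.trans hst2).gle hi
    have hc2 := hc1.keep hst2.keep
    obtain ⟨r3, m3, G3, hr3, hst3, j10, j11, j14, j15, e0, e1, e2, e3⟩ := decRetArg_run hst2.inv hc2
      (by omega) (k10' ▸ gg _ _ g0) (k10' ▸ gg _ _ g1) (k10' ▸ gg _ _ g2) (k10' ▸ gg _ _ g3)
      (hgg _ _ t1)
    have hst13 := (hst1.trans hst2).trans hst3
    have hc3 := hc2.keep hst3.keep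
    have hm3 : ∀ z ∈ s.fv, m3 (addr z + 3) = m (addr z + 3) := fun z hz => by
      have hzn := PTerm.mem_names_iff.2 (.inl hz)
      have := (hcell z (.inl hzn)).le
      refine hst13.mem _ (by omega) ?_
      rintro ((h | ⟨x, hx, h⟩) | h)
      · exact h
      · have := hinj z (.inl hzn) x (.inr (PTerm.mem_names_iff.2 (.inr hx))) (by omega)
        subst this
        exact hus _ hx hzn
      · exact h
    obtain ⟨T4, r4, m4, G4, hr4, hT4, hst4, i10, i14, hM4, hdec4⟩ := ihs θ r3 m3 G3
      addr hst3.inv hc3 (j11 ▸ t3.mono (hst13.gle hi) fun _ _ => rfl)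
      (fun z hz => (hcell z (.inl hz)).grow hst13.grow)
      (fun x hx y hy => hinj x (.inl hx) y (.inl hy)) hs1 (by omega) (by
        intro z hz
        rw [hm3 z hz, j14, k14', h14]
        exact hmark z (by simp [PTerm.fv, hz]))
    have gg4 := hst4.gle hst3.inv
    have hc4 := hc3.keep hst4.keep
    have hG1 : ∀ a v, G1 a = some v → G4 a = some v := fun a v h =>
      (hst2.trans (hst3.trans hst4)).gle hst1.inv a v h
    have hW : ∀ a, (((((False ∨ ∃ z ∈ u.binders, a = addr z + 3) ∨ False) ∨
        ∃ z ∈ s.binders, a = addr z + 3) ∨ False) ∨ False) →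
        ∃ z ∈ (PTerm.app s u).binders, a = addr z + 3 := by
      rintro a (((((h | ⟨z, hz, rfl⟩) | h) | ⟨z, hz, rfl⟩) | h) | h)
      · exact h.elim
      · exact ⟨z, by simp [PTerm.binders, hz], rfl⟩
      · exact h.elim
      · exact ⟨z, by simp [PTerm.binders, hz], rfl⟩
      · exact h.elim
      · exact h.elim
    have hMs : ∀ z ∈ (PTerm.app s u).fv, m (addr z + 3) ≤ r4 13 + (r2 13 - r4 13) := by
      intro z hz
      rcases Finset.mem_union.1 hz with hz | hz
      · have := hM4.1 z hz
        rw [hm3 z hz] at this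
        omega
      · have := hM2.1 z hz
        rw [hm1 z hz] at this
        omega
    by_cases hle : r4 13 + (r2 13 - r4 13) = 0
    · obtain ⟨r5, hr5, hst5, l10, l14, l17, l18⟩ := decRetFun_extract hst4.inv hc4 (by omega)
        (i10 ▸ gg4 _ _ e0) (i10 ▸ gg4 _ _ e1) (i10 ▸ gg4 _ _ e2) (i10 ▸ gg4 _ _ e3)
        (k10' ▸ hG1 _ _ g1) (k10' ▸ hG1 _ _ g2) (k10' ▸ hG1 _ _ g3) hle
      have hst15 := (hst13.trans hst4).trans hst5
      obtain ⟨r6, m6, G6, hr6, hst6, n10, n14, n13, hex⟩ := extract_run hst5.inv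
        (hc4.keep hst5.keep) (t := .app s u) (addr := addr)
        (l17 ▸ htt.mono ((hst13.trans hst4).gle hi) fun _ _ => rfl)
      have hz : ∀ z ∈ (PTerm.app s u).fv, z ∉ θ ∧ m (addr z + 3) = 0 := by
        intro z hz
        rcases hmark z hz with ⟨h1, h2⟩ | h
        · have := hMs z hz
          omega
        · exact h
      refine ⟨20 + T2 + 21 + T4 + 21 + 16, r6, m6, G6,
        run_trans (run_trans (run_trans (run_trans (run_trans hr1 hr2) hr3) hr4) hr5) hr6,
        by simp only [PTerm.size]; omega,
        (hst15.trans hst6).weaken fun a _ => hW a, by omega, by omega,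
        ⟨fun z hz' => by rw [(hz z hz').2]; omega, .inl n13⟩, ?_⟩
      intro w F addr₂ hdec hnd hfr ha
      obtain ⟨z, rfl, rfl⟩ := hdec.of_disjoint
        (Finset.disjoint_left.2 fun z hz' => (hz z hz').1) (by simp [PTerm.IsVar])
      obtain ⟨addr', f1, f2, f3, f4⟩ := hex z addr₂ ha (hfr z (by simp))
      exact ⟨addr', f1.base hst15.grow.1, by simpa using f2, f3, by rwa [l18] at f4⟩
    · obtain ⟨r5, m5, G5, hr5, hst5, l10, l13, l14, l15, n0, n1, n2⟩ := decRetFun_node hst4.inv hc4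
        (by omega)
        (i10 ▸ gg4 _ _ e0) (i10 ▸ gg4 _ _ e1) (i10 ▸ gg4 _ _ e2) (i10 ▸ gg4 _ _ e3)
        (k10' ▸ hG1 _ _ g1) (k10' ▸ hG1 _ _ g2) (k10' ▸ hG1 _ _ g3) hle
      obtain ⟨z, hzf, hzM⟩ : ∃ z ∈ (PTerm.app s u).fv,
          m (addr z + 3) = r4 13 + (r2 13 - r4 13) := by
        rcases le_total (r2 13) (r4 13) with h | h
        · obtain ⟨z, hz, hzM⟩ := hM4.2.resolve_left (by omega)
          rw [hm3 z hz] at hzM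
          exact ⟨z, by simp [PTerm.fv, hz], by omega⟩
        · obtain ⟨z, hz, hzM⟩ := hM2.2.resolve_left (by omega)
          rw [hm1 z hz] at hzM
          exact ⟨z, by simp [PTerm.fv, hz], by omega⟩
      refine ⟨20 + T2 + 21 + T4 + 30, r5, m5, G5,
        run_trans (run_trans (run_trans (run_trans hr1 hr2) hr3) hr4) hr5,
        by simp only [PTerm.size]; omega,
        ((hst13.trans hst4).trans hst5).weaken fun a _ h => hW a (.inl h), by omega, by omega,
        ⟨fun x hx => l13 ▸ hMs x hx, .inr ⟨z, hzf, by omega⟩⟩, ?_⟩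
      intro w F' addr₂ hdec hnd hfr ha
      cases hdec with
      | extract _ _ z' hfree hvar =>
        rcases hmark z hzf with ⟨h1, h2⟩ | ⟨h1, h2⟩
        · exact absurd h1 (Finset.disjoint_left.1 hfree hzf)
        · omega
      | app _ _ _ s' u' F F₂ hdep hsubs hsubu =>
        simp only [List.map_append, List.nodup_append, List.mem_append, PTerm.names] at hnd hfr ha
        obtain ⟨nd1, nd2, nd3⟩ := hnd
        -- Addresses are assigned in the order of the traversal: names of the argument's flesh
        -- before those of the function's flesh.
        obtain ⟨addr3, f1, f2, f3, f4⟩ := hdec2 u' F₂ addr₂ hsubu nd2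
          (fun z hz h => hfr z (.inr hz) (.inr h)) (fun x hx => ha x (.inr hx))
        obtain ⟨addr', f1', f2', f3', f4'⟩ := hdec4 s' F addr3 hsubs nd1
          (fun z hz h => hfr z (.inl hz) (.inl h)) (fun x hx => by
            rw [f1.eq x fun h => hfr x (.inr h) (.inl hx), ha x (.inl hx)])
        have hst45 := hst4.trans hst5
        have hst35 := hst3.trans hst45
        have hdisj : ∀ x ∈ F₂.map Prod.fst, x ∉ F.map Prod.fst := fun x hx hx' => nd3 x hx' x hx rfl
        -- cells of the second flesh are not marked while the function is decomposed
        have hfar : ∀ x ∈ F₂.map Prod.fst, ∀ i < 4, m5 (addr3 x + i) = m2 (addr3 x + i) := by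
          intro x hx i hi
          obtain ⟨c1, c2⟩ := f1.cell x hx
          have hcl := c1.le
          refine hst35.mem _ (by omega) ?_
          rintro (h | ⟨y, hy, h⟩ | h)
          · exact h
          · have := (hcell y (.inl (PTerm.mem_names_iff.2 (.inr hy)))).le
            have := hst1.grow.1
            omega
          · exact h
        have hnew : ∀ x ∈ F.map Prod.fst, ∀ i < 4, m5 (addr' x + i) = m4 (addr' x + i) := by
          intro x hx i hi
          have := (f1'.cell x hx).1.le
          exact hst5.mem _ (by omega) (by simp)
        have hnames : ∀ {F : List (ℕ × PTerm)} {e : Entry}, e ∈ fleshEnv F →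
            e.name ∈ F.map Prod.fst := by
          intro F e he
          simp only [fleshEnv, List.mem_map] at he
          obtain ⟨q, hq, rfl⟩ := he
          exact List.mem_map.2 ⟨q, hq, rfl⟩
        have hfresh := ((f1.grow hst3.grow).base hst1.grow.1).append (f1'.grow hst5.grow)
          (hst45.grow) hst13.grow.1 hdisj
        -- The order of allocation is opposite to the order of the list `F ++ F₂`; freshness depends
        -- only on which names occur, so the two are reconciled by commuting disjunctions.
        refine ⟨addr', ⟨fun x hx => hfresh.eq x fun h => hx ?_, fun x hx => hfresh.cell x ?_,
          fun x hx y hy => hfresh.inj x ?_ y ?_⟩, ?_, ⟨n0, _, _, n1, n2, ?_, ?_⟩, ?_⟩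
        · simpa [or_comm] using h
        · simpa [or_comm] using hx
        · simpa [or_comm] using hx
        · simpa [or_comm] using hy
        · intro x hx
          rw [List.map_append] at hx
          rcases List.mem_append.1 hx with hx | hx
          · rw [hnew x hx 3 (by simp), f2' x hx]
          · rw [f1'.eq x (hdisj x hx), hfar x hx 3 (by simp), f2 x hx]
        · exact f3'.mono (hst5.gle hst4.inv) fun _ _ => rfl
        · refine f3.mono (hst35.gle hst2.inv) fun x hx => f1'.eq x fun h => ?_
          rcases hsubu.names.1 x hx with h' | h'
          · exact hfr x (.inl h) (.inr h')
          · exact hdisj x h' h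
        · rw [l15]
          simp only [fleshEnv, List.map_append]
          -- The two lists meet at the flesh that was current when the traversal of the function
          -- began, that is, the front of the argument's flesh.
          refine EnvAt.append.2 ⟨r3 15, f4'.mono (hst5.gle hst4.inv) (fun _ _ => rfl)
            fun e he i hi => hnew _ (hnames he) i (by omega), ?_⟩
          rw [j15, ← h15]
          refine f4.mono (hst35.gle hst2.inv) (fun x hx => f1'.eq x fun h => ?_)
            fun e he i hi => hfar _ (hnames he) i (by omega)
          rcases fleshEnv_names hx with h' | ⟨q, hq, h'⟩
          · exact hdisj x h' h
          · exact hfr x (.inl h) (.inr (hsubu.names.2 q hq x h'))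

end SMAD

/-! ### Effect of renaming and decomposition on sizes and names -/

namespace PTerm

theorem AlphaIn.size_eq {w : PTerm} : ∀ {v : PTerm} {l : List (ℕ × ℕ)}, AlphaIn l w v →
    w.size = v.size := by
  induction w with
  | var x => rintro (_ | _ | _) l h <;> simp_all [AlphaIn, size]
  | lam x w ih =>
    rintro (_ | ⟨y, v⟩ | _) l h <;> simp only [AlphaIn] at h
    simp [size, ih h]
  | app w w' ih ih' =>
    rintro (_ | _ | ⟨v, v'⟩) l h <;> simp only [AlphaIn] at h
    simp [size, ih h.1, ih' h.2]

theorem AlphaIn.fv {w : PTerm} : ∀ {v : PTerm} {l : List (ℕ × ℕ)}, AlphaIn l w v →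
    ∀ x ∈ w.fv, ∃ y ∈ v.fv, AlphaVar l x y := by
  induction w with
  | var x => rintro (_ | _ | _) l h <;> simp_all [AlphaIn, PTerm.fv]
  | lam x w ih =>
    rintro (_ | ⟨y, v⟩ | _) l h <;> simp only [AlphaIn] at h
    intro z hz
    simp only [PTerm.fv, Finset.mem_erase] at hz
    obtain ⟨z', hz', h1 | h1⟩ := ih h z hz.2
    · exact absurd h1.1 hz.1
    · exact ⟨z', by simp [PTerm.fv, h1.2.1, hz'], h1.2.2⟩
  | app w w' ih ih' =>
    rintro (_ | _ | ⟨v, v'⟩) l h <;> simp only [AlphaIn] at h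
    intro z hz
    rcases Finset.mem_union.1 hz with hz | hz
    · obtain ⟨z', h1, h2⟩ := ih h.1 z hz
      exact ⟨z', by simp [PTerm.fv, h1], h2⟩
    · obtain ⟨z', h1, h2⟩ := ih' h.2 z hz
      exact ⟨z', by simp [PTerm.fv, h1], h2⟩

theorem Alpha.fv_subset {w v : PTerm} (h : Alpha w v) {x : ℕ} (hx : x ∈ w.fv) : x ∈ v.fv := by
  obtain ⟨y, hy, rfl⟩ := AlphaIn.fv h x hx
  exact hy

theorem Alpha.isValue {w v : PTerm} (h : Alpha w v) (hv : v.IsValue) : w.IsValue := by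
  cases w <;> cases v <;> simp_all [Alpha, AlphaIn, IsValue]

/-- Each binder ends up either in the skeleton or in exactly one term of the flesh. This is what
keeps bound names pairwise distinct through $\mathsf{sk}$ although nothing is renamed. -/
theorem SkelDec.count_binders {θ : Finset ℕ} {t w : PTerm} {F : List (ℕ × PTerm)}
    (h : SkelDec θ t w F) (a : ℕ) :
    w.binders.count a + (F.flatMap fun p => p.2.binders).count a = t.binders.count a := by
  induction h with
  | extract θ t z hfree hvar => simp [binders]
  | var θ x => simp [binders]
  | lam θ x u s F hdep h ih => simp only [binders, List.count_cons]; omega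
  | app θ u s r p F G hdep hu hs ihu ihs =>
    simp only [binders, List.count_append, List.flatMap_append]; omega

/-- The terms of the flesh are disjoint subterms. The bound on the sum shows that $\mathsf{sk}$ does
not increase the load, and the bound on the skeleton preserves the size bound $n$. -/
theorem SkelDec.size_le {θ : Finset ℕ} {t w : PTerm} {F : List (ℕ × PTerm)}
    (h : SkelDec θ t w F) : w.size ≤ t.size ∧ (F.map fun p => p.2.size).sum ≤ t.size := by
  induction h with
  | extract θ t z hfree hvar => simp [size, Nat.one_le_iff_ne_zero, t.size_pos.ne']
  | var θ x => simp [size]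
  | lam θ x u s F hdep h ih => simp only [size]; omega
  | app θ u s r p F G hdep hu hs ihu ihs =>
    simp only [size, List.map_append, List.sum_append]; omega

theorem SkelDec.fv {θ : Finset ℕ} {t w : PTerm} {F : List (ℕ × PTerm)} (h : SkelDec θ t w F) :
    ∀ y ∈ w.fv, y ∈ t.fv ∨ y ∈ F.map Prod.fst := by
  induction h with
  | extract θ t z hfree hvar => simp [PTerm.fv]
  | var θ x => simp [PTerm.fv]
  | lam θ x u s F hdep h ih =>
    intro y hy
    simp only [PTerm.fv, Finset.mem_erase] at hy ⊢
    rcases ih y hy.2 with h | h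
    · exact .inl ⟨hy.1, h⟩
    · exact .inr h
  | app θ u s r p F G hdep hu hs ihu ihs =>
    intro y hy
    simp only [PTerm.fv, Finset.mem_union, List.map_append, List.mem_append] at hy ⊢
    rcases hy with hy | hy
    · rcases ihu y hy with h | h <;> simp only [h, true_or, or_true]
    · rcases ihs y hy with h | h <;> simp only [h, true_or, or_true]

/-- That no flesh term is a variable is needed for the amortized analysis; that it avoids `θ` makes
it well scoped outside the binders it has been extracted from. -/
theorem SkelDec.flesh {θ : Finset ℕ} {t w : PTerm} {F : List (ℕ × PTerm)} (h : SkelDec θ t w F) :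
    ∀ p ∈ F, ¬ p.2.IsVar ∧ p.2.size ≤ t.size ∧ ∀ y ∈ p.2.fv, y ∈ t.fv ∧ y ∉ θ := by
  induction h with
  | extract θ t z hfree hvar =>
    simpa [hvar] using fun y hy => ⟨hy, Finset.disjoint_left.1 hfree hy⟩
  | var θ x => simp
  | lam θ x u s F hdep h ih =>
    intro p hp
    obtain ⟨h1, h2, h3⟩ := ih p hp
    refine ⟨h1, by simp only [size]; omega, fun y hy => ?_⟩
    obtain ⟨h4, h5⟩ := h3 y hy
    simp only [Finset.mem_insert, not_or] at h5
    exact ⟨by simp [PTerm.fv, h4, h5.1], h5.2⟩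
  | app θ u s r p F G hdep hu hs ihu ihs =>
    intro q hq
    rcases List.mem_append.1 hq with hq | hq
    · obtain ⟨h1, h2, h3⟩ := ihu q hq
      exact ⟨h1, by simp only [size]; omega, fun y hy => ⟨by simp [PTerm.fv, h3 y hy], (h3 y hy).2⟩⟩
    · obtain ⟨h1, h2, h3⟩ := ihs q hq
      exact ⟨h1, by simp only [size]; omega, fun y hy => ⟨by simp [PTerm.fv, h3 y hy], (h3 y hy).2⟩⟩

end PTerm

namespace SMAD

/-! ### Invariants of the states -/

def Entry.bnd (e : Entry) : List ℕ := e.name :: e.term.binders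

def ChainItem.bnd (i : ChainItem) : List ℕ :=
  i.name :: (i.stack.flatMap PTerm.binders ++ i.env.flatMap Entry.bnd)

/-- The names bound by the state: by abstractions, by the environment, and by the chain. -/
def State.bnd (Q : State) : List ℕ :=
  Q.chain.flatMap ChainItem.bnd ++ Q.code.binders ++ Q.stack.flatMap PTerm.binders ++
    Q.env.flatMap Entry.bnd

/-- The names bound by the environment and by the chain. -/
def State.dom (Q : State) : List ℕ :=
  Q.chain.flatMap (fun i => i.name :: i.env.map Entry.name) ++ Q.env.map Entry.name

def TermOK (n : ℕ) (D : Set ℕ) (t : PTerm) : Prop := t.size ≤ n ∧ ∀ y ∈ t.fv, y ∈ D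

/-- Entries bind to their left: a term may use the names of the entries on its right and the names
`D` bound beyond the end of the list. Skeletal entries are required to contain values so that
$\mathsf{ss}$ always applies to them. -/
def EnvOK (n : ℕ) (D : Set ℕ) : List Entry → Prop
  | [] => True
  | e :: E => TermOK n {y | y ∈ D ∨ y ∈ E.map Entry.name} e.term ∧
      (e.tag = 2 → e.term.IsValue) ∧ EnvOK n D E

/-- An item is a suspended environment to the left of the current one: its segment sees the names
`D` and its variable, its stack sees moreover the names of the segment, and so do the items below
it. -/
def ChainOK (n : ℕ) (D : Set ℕ) : List ChainItem → Prop
  | [] => True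
  | i :: C => (∀ t ∈ i.stack, TermOK n {y | y ∈ D ∨ y = i.name ∨ y ∈ i.env.map Entry.name} t) ∧
      EnvOK n {y | y ∈ D ∨ y = i.name} i.env ∧
      ChainOK n {y | y ∈ D ∨ y = i.name ∨ y ∈ i.env.map Entry.name} C

theorem TermOK.mono {n : ℕ} {D D' : Set ℕ} (hD : D ⊆ D') {t : PTerm} (h : TermOK n D t) :
    TermOK n D' t :=
  ⟨h.1, fun y hy => hD (h.2 y hy)⟩

theorem EnvOK.mono {n : ℕ} {D D' : Set ℕ} (hD : D ⊆ D') {E : List Entry} (h : EnvOK n D E) :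
    EnvOK n D' E := by
  induction E with
  | nil => trivial
  | cons e E ih => exact ⟨h.1.mono fun y hy => hy.imp_left fun h => hD h, h.2.1, ih h.2.2⟩

theorem ChainOK.mono {n : ℕ} {C : List ChainItem} : ∀ {D D' : Set ℕ}, D ⊆ D' → ChainOK n D C →
    ChainOK n D' C := by
  induction C with
  | nil => intros; trivial
  | cons i C ih =>
    intro D D' hD h
    have h' : {y | y ∈ D ∨ y = i.name ∨ y ∈ i.env.map Entry.name} ⊆
      {y | y ∈ D' ∨ y = i.name ∨ y ∈ i.env.map Entry.name} := fun y hy => hy.imp_left fun h => hD h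
    exact ⟨fun t ht => (h.1 t ht).mono h', h.2.1.mono fun y hy => hy.imp_left fun h => hD h,
      ih h' h.2.2⟩

theorem EnvOK.append {n : ℕ} {D : Set ℕ} {E E' : List Entry} : EnvOK n D (E ++ E') ↔
    EnvOK n {y | y ∈ D ∨ y ∈ E'.map Entry.name} E ∧ EnvOK n D E' := by
  induction E with
  | nil => simp [EnvOK]
  | cons e E ih =>
    simp only [List.cons_append, EnvOK, ih, List.map_append, List.mem_append, and_assoc,
      Set.mem_ofPred_eq, or_assoc, or_comm, or_left_comm]

structure WF (n : ℕ) (Q : State) : Prop where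
  nodup : Q.bnd.Nodup
  env : EnvOK n ∅ Q.env
  code : TermOK n {y | y ∈ Q.env.map Entry.name} Q.code
  stack : ∀ t ∈ Q.stack, TermOK n {y | y ∈ Q.env.map Entry.name} t
  chain : ChainOK n {y | y ∈ Q.env.map Entry.name} Q.chain

theorem Entry.bnd_subset {e : Entry} {x : ℕ} (h : x ∈ e.bnd) : x ∈ e.names := by
  rw [Entry.names_eq]
  rcases List.mem_cons.1 h with rfl | h
  · simp
  · exact List.mem_cons_of_mem _ (PTerm.mem_names_iff.2 (.inr h))

theorem ChainItem.bnd_subset {i : ChainItem} {x : ℕ} (h : x ∈ i.bnd) : x ∈ i.names := by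
  simp only [bnd, names, List.mem_cons, List.mem_append, List.mem_flatMap] at h ⊢
  rcases h with h | ⟨t, ht, h⟩ | ⟨e, he, h⟩
  · exact .inl h
  · exact .inr (.inl ⟨t, ht, PTerm.mem_names_iff.2 (.inr h)⟩)
  · exact .inr (.inr ⟨e, he, e.bnd_subset h⟩)

theorem State.bnd_subset {Q : State} {x : ℕ} (h : x ∈ Q.bnd) : x ∈ Q.names := by
  simp only [bnd, names, List.mem_append, List.mem_flatMap] at h ⊢
  rcases h with ((⟨i, hi, h⟩ | h) | ⟨t, ht, h⟩) | ⟨e, he, h⟩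
  · exact .inl (.inl (.inl ⟨i, hi, i.bnd_subset h⟩))
  · exact .inl (.inl (.inr (PTerm.mem_names_iff.2 (.inr h))))
  · exact .inl (.inr ⟨t, ht, PTerm.mem_names_iff.2 (.inr h)⟩)
  · exact .inr ⟨e, he, e.bnd_subset h⟩

theorem State.dom_subset {Q : State} {x : ℕ} (h : x ∈ Q.dom) : x ∈ Q.bnd := by
  simp only [dom, bnd, List.mem_append, List.mem_flatMap, List.mem_map, List.mem_cons] at h ⊢
  rcases h with ⟨i, hi, h | ⟨e, he, h⟩⟩ | ⟨e, he, h⟩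
  · exact .inl (.inl (.inl ⟨i, hi, by simp [ChainItem.bnd, h]⟩))
  · refine .inl (.inl (.inl ⟨i, hi, ?_⟩))
    simp only [ChainItem.bnd, List.mem_cons, List.mem_append, List.mem_flatMap]
    exact .inr (.inr ⟨e, he, by simp [Entry.bnd, h]⟩)
  · exact .inr ⟨e, he, by simp [Entry.bnd, h]⟩

theorem fleshEnv_bnd_count (F : List (ℕ × PTerm)) (a : ℕ) :
    ((fleshEnv F).flatMap Entry.bnd).count a =
      (F.map Prod.fst).count a + (F.flatMap fun p => p.2.binders).count a := by
  induction F with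
  | nil => rfl
  | cons p F ih =>
    simp only [fleshEnv, List.map_cons, List.flatMap_cons, List.count_append, List.count_cons,
      Entry.bnd, Entry.name, Entry.term] at ih ⊢
    omega

theorem fleshEnv_map_name (F : List (ℕ × PTerm)) :
    (fleshEnv F).map Entry.name = F.map Prod.fst := by
  simp [fleshEnv, Entry.name]

theorem EnvOK.flesh {n : ℕ} {D : Set ℕ} {F : List (ℕ × PTerm)} (h : ∀ p ∈ F, TermOK n D p.2) :
    EnvOK n D (fleshEnv F) := by
  induction F with
  | nil => trivial
  | cons p F ih =>
    exact ⟨(h p (by simp)).mono fun y hy => .inl hy, by simp [Entry.tag],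
      ih fun q hq => h q (by simp [hq])⟩

/-- Distinctness of bound names is proved by counting: the search transitions, $\beta$ and
$\mathsf{sk}$ redistribute the bound names already present without repeating them, and the only
additional names, those of the flesh or of the copy, are pairwise distinct and had count `0` by
freshness. The size bound persists because every transition produces subterms, skeletons, variables
or renamings. -/
theorem WF.step {n : ℕ} {a : Label} {Q Q' : State} (h : WF n Q) (hs : Step a Q Q') : WF n Q' := by
  have hcount := List.nodup_iff_count_le_one.1 h.nodup
  cases hs with
  | sea1 C t u S E =>
    obtain ⟨-, h2, ⟨h3, h3'⟩, h4, h5⟩ := h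
    simp only [PTerm.size, PTerm.fv, Finset.mem_union] at h3 h3'
    refine ⟨List.nodup_iff_count_le_one.2 fun b => (hcount b).trans' ?_, h2,
      ⟨by simp only; omega, fun y hy => h3' y (.inl hy)⟩, ?_, h5⟩
    · simp only [State.bnd, PTerm.binders, List.count_append, List.flatMap_cons]; omega
    · intro t ht
      rcases List.mem_cons.1 ht with rfl | ht
      · exact ⟨by omega, fun y hy => h3' y (.inr hy)⟩
      · exact h4 t ht
  | beta C x t u S E =>
    obtain ⟨-, h2, ⟨h3, h3'⟩, h4, h5⟩ := h
    simp only [PTerm.size, PTerm.fv, Finset.mem_erase] at h3 h3'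
    have hsub : {y | y ∈ E.map Entry.name} ⊆ {y | y ∈ (Entry.es x u :: E).map Entry.name} :=
      fun y hy => List.mem_cons_of_mem _ hy
    refine ⟨List.nodup_iff_count_le_one.2 fun b => (hcount b).trans' ?_,
      ⟨(h4 u (by simp)).mono fun y hy => .inr hy, by simp [Entry.tag], h2⟩,
      ⟨by simp only; omega, fun y hy => ?_⟩, fun t ht => (h4 t (by simp [ht])).mono hsub, h5.mono hsub⟩
    · simp only [State.bnd, PTerm.binders, List.count_append, List.flatMap_cons, Entry.bnd,
        List.count_cons, Entry.name, Entry.term]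
      omega
    · by_cases hyx : y = x
      · simp [hyx, Entry.name]
      · exact hsub (h3' y ⟨hyx, hy⟩)
  | sea2 C x t S E E' ht =>
    obtain ⟨-, h2, h3, h4, h5⟩ := h
    obtain ⟨h6, h7, -, h8⟩ := EnvOK.append.1 h2
    have hsub : {y | y ∈ (E ++ Entry.es x t :: E').map Entry.name} ⊆
        {y | y ∈ E'.map Entry.name ∨ y = x ∨ y ∈ E.map Entry.name} := by
      intro y hy
      simp only [List.map_append, List.map_cons, List.mem_append, List.mem_cons,
        Set.mem_ofPred_eq, Entry.name] at hy ⊢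
      tauto
    refine ⟨List.nodup_iff_count_le_one.2 fun b => (hcount b).trans' ?_, h8,
      h7.mono fun y hy => by simpa using hy, by simp, fun t ht => (h4 t ht).mono hsub, h6.mono ?_,
      h5.mono hsub⟩
    · simp only [State.bnd, PTerm.binders, List.count_append, List.flatMap_cons, Entry.bnd,
        List.count_cons, Entry.name, Entry.term, ChainItem.bnd, List.flatMap_append,
        List.flatMap_nil, List.count_nil]
      omega
    · intro y hy
      simp only [List.map_cons, List.mem_cons, Set.mem_ofPred_eq, Entry.name] at hy ⊢
      rcases hy with hy | hy | hy
      · exact hy.elim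
      · exact .inr hy
      · exact .inl hy
  | sea3 C x v S E E' hv =>
    obtain ⟨-, h2, h3, h4, h6, h7, h5⟩ := h
    have hsub : {y | y ∈ E'.map Entry.name ∨ y = x ∨ y ∈ E.map Entry.name} ⊆
        {y | y ∈ (E ++ Entry.es x v :: E').map Entry.name} := by
      intro y hy
      simp only [List.map_append, List.map_cons, List.mem_append, List.mem_cons,
        Set.mem_ofPred_eq, Entry.name] at hy ⊢
      tauto
    refine ⟨List.nodup_iff_count_le_one.2 fun b => (hcount b).trans' ?_,
      EnvOK.append.2 ⟨h7.mono ?_, h3.mono fun y hy => .inr hy, by simp [Entry.tag], h2⟩,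
      ⟨?_, ?_⟩, fun t ht => (h6 t ht).mono hsub, h5.mono hsub⟩
    · simp only [State.bnd, PTerm.binders, List.count_append, List.flatMap_cons, Entry.bnd,
        List.count_cons, Entry.name, Entry.term, ChainItem.bnd, List.flatMap_append,
        List.flatMap_nil, List.count_nil]
      omega
    · intro y hy
      simp only [List.map_cons, List.mem_cons, Set.mem_ofPred_eq, Entry.name] at hy ⊢
      tauto
    · exact v.size_pos.trans_le h3.1
    · simp [PTerm.fv, Entry.name]
  | sk C x v w F S E E' hdec hnd hfr =>
    obtain ⟨-, h2, h3, h4, h5⟩ := h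
    obtain ⟨h6, h7, -, h8⟩ := EnvOK.append.1 h2
    obtain ⟨y, t, u, F, hdec⟩ := hdec
    have hsub : {z | z ∈ (E ++ Entry.es x (.lam y t) :: E').map Entry.name} ⊆
        {z | z ∈ (E ++ Entry.skel x (.lam y u) :: (fleshEnv F ++ E')).map Entry.name} := by
      intro z hz
      simp only [List.map_append, List.map_cons, List.mem_append, List.mem_cons,
        Set.mem_ofPred_eq, Entry.name] at hz ⊢
      tauto
    have hfl := hdec.flesh
    have hsz := hdec.size_le
    simp only [TermOK, Entry.term, PTerm.size, PTerm.fv, Finset.mem_erase] at h7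
    refine ⟨List.nodup_iff_count_le_one.2 fun b => ?_,
      EnvOK.append.2 ⟨h6.mono ?_, ⟨?_, ?_⟩, fun _ => trivial, EnvOK.append.2 ⟨.flesh ?_, h8⟩⟩,
      h3.mono hsub, fun t ht => (h4 t ht).mono hsub, h5.mono hsub⟩
    · have h1 := hcount b
      have h2 := hdec.count_binders b
      have h3 := List.nodup_iff_count_le_one.1 hnd b
      have h4 : b ∈ F.map Prod.fst → (State.bnd ⟨C, .var x, S, E ++ .es x (.lam y t) :: E'⟩).count b
          = 0 := fun hb => List.count_eq_zero.2 fun hb' => hfr b hb (State.bnd_subset hb')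
      have h5 : b ∉ F.map Prod.fst → (F.map Prod.fst).count b = 0 := List.count_eq_zero.2
      simp only [State.bnd, PTerm.binders, List.count_append, List.flatMap_cons, Entry.bnd,
        List.count_cons, Entry.name, Entry.term, List.flatMap_append,
        fleshEnv_bnd_count] at h1 h4 ⊢
      by_cases hb : b ∈ F.map Prod.fst
      · have := h4 hb
        omega
      · have := h5 hb
        omega
    · intro z hz
      simp only [List.map_append, List.map_cons, List.mem_append, List.mem_cons,
        Set.mem_ofPred_eq, Entry.name] at hz ⊢
      tauto
    · simp only [Entry.term, PTerm.size]; omega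
    · intro z hz
      simp only [Entry.term, PTerm.fv, Finset.mem_erase] at hz
      simp only [Set.mem_ofPred_eq, List.map_append, List.mem_append, fleshEnv_map_name]
      rcases hdec.fv z hz.2 with h | h
      · have := h7.2 z ⟨hz.1, h⟩
        simp only [Set.mem_ofPred_eq] at this
        tauto
      · tauto
    · intro p hp
      obtain ⟨f1, f2, f3⟩ := hfl p hp
      refine ⟨by omega, fun z hz => h7.2 z ⟨?_, (f3 z hz).1⟩⟩
      simpa using (f3 z hz).2
  | ss C x v w S E E' hv hα hwb hfr =>
    obtain ⟨-, h2, h3, h4, h5⟩ := h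
    obtain ⟨h6, h7, -, h8⟩ := EnvOK.append.1 h2
    refine ⟨List.nodup_iff_count_le_one.2 fun b => ?_, h2, ⟨?_, fun y hy => ?_⟩, h4, h5⟩
    · have h1 := hcount b
      have h3 := List.nodup_iff_count_le_one.1 hwb b
      have h4 : b ∈ w.binders → (State.bnd ⟨C, .var x, S, E ++ .skel x v :: E'⟩).count b
          = 0 := fun hb => List.count_eq_zero.2 fun hb' => hfr b hb (State.bnd_subset hb')
      have h5 : b ∉ w.binders → w.binders.count b = 0 := List.count_eq_zero.2
      simp only [State.bnd, PTerm.binders, List.count_append, List.count_nil] at h1 h4 ⊢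
      by_cases hb : b ∈ w.binders
      · have := h4 hb
        omega
      · have := h5 hb
        omega
    · rw [PTerm.AlphaIn.size_eq hα]; exact h7.1
    · have := h7.2 y (hα.fv_subset hy)
      simp only [Set.mem_ofPred_eq, List.map_append, List.map_cons, List.mem_append,
        List.mem_cons] at this ⊢
      rcases this with h | h
      · exact h.elim
      · exact .inr (.inr h)

end SMAD

/-! ### Simulation relation and constant-time transitions -/

namespace SMAD
open RAM

/-- The registers `r` and the memory `m` represent `Q` at the head of the main loop. -/
structure Sim (n : ℕ) (Q : State) (r m : ℕ → ℕ) (G : ℕ → Option ℕ) (addr : ℕ → ℕ) : Prop where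
  heap : HeapInv G (r 4) m
  consts : Consts r
  size : r 5 = n
  cell : ∀ x ∈ Q.names, Cell G (r 4) (addr x)
  inj : ∀ x ∈ Q.names, ∀ y ∈ Q.names, addr x = addr y → x = y
  mark : ∀ x ∈ Q.dom, m (addr x + 3) = 0
  chain : ChainAt G m addr (r 0) Q.chain
  code : TermAt G addr (r 1) Q.code
  stack : StackAt G addr (r 2) Q.stack
  env : EnvAt G m addr (r 3) Q.env 0

theorem Sim.represents {n pc : ℕ} {Q : State} {r m : ℕ → ℕ} {G : ℕ → Option ℕ} {addr : ℕ → ℕ}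
    (h : Sim n Q r m G addr) : Represents ⟨pc, r, m⟩ Q :=
  ⟨addr, fun x hx y hy hxy => h.inj x hx y hy hxy, h.chain.rep h.heap.sub, h.code.rep h.heap.sub,
    h.stack.rep h.heap.sub, h.env.rep h.heap.sub⟩

/-- Both addresses are multiples of four, so words of different records never overlap. -/
theorem Cell.add_ne {G G' : ℕ → Option ℕ} {hp hp' a b i j : ℕ} (ha : Cell G hp a)
    (hb : Cell G' hp' b) (hi : i < 4) (hj : j < 4) (h : a ≠ b ∨ i ≠ j) : a + i ≠ b + j := by
  have := ha.dvd
  have := hb.dvd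
  omega

theorem Fresh.cells {L L' B : List ℕ} {G G' : ℕ → Option ℕ} {hp hp' : ℕ} {addr addr' : ℕ → ℕ}
    (hf : Fresh B hp addr G' hp' addr') (hg : Grow G hp G' hp')
    (hL : ∀ x ∈ L', x ∈ L ∨ x ∈ B) (hB : ∀ x ∈ B, x ∉ L) (hc : ∀ x ∈ L, Cell G hp (addr x))
    (hi : ∀ x ∈ L, ∀ y ∈ L, addr x = addr y → x = y) :
    (∀ x ∈ L', Cell G' hp' (addr' x)) ∧ ∀ x ∈ L', ∀ y ∈ L', addr' x = addr' y → x = y := by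
  have heq : ∀ x ∈ L, addr' x = addr x := fun x hx => hf.eq x fun h => hB x h hx
  refine ⟨fun x hx => ?_, fun x hx y hy hxy => ?_⟩
  · rcases hL x hx with h | h
    · rw [heq x h]; exact (hc x h).grow hg
    · exact (hf.cell x h).1
  · rcases hL x hx with h | h <;> rcases hL y hy with h' | h'
    · rw [heq x h, heq y h'] at hxy
      exact hi x h y h' hxy
    · rw [heq x h] at hxy
      have := (hc x h).le
      have := (hf.cell y h').2
      omega
    · rw [heq y h'] at hxy
      have := (hc y h').le
      have := (hf.cell x h).2
      omega
    · exact hf.inj x h y h' hxy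

theorem Consts.of_eq {r r' : ℕ → ℕ} (h : Consts r) (h6 : r' 6 = r 6) (h7 : r' 7 = r 7)
    (h8 : r' 8 = r 8) (h9 : r' 9 = r 9) (h21 : r' 21 = r 21) : Consts r' :=
  ⟨h6.trans h.h6, h7.trans h.h7, h8.trans h.h8, h9.trans h.h9, h21.trans h.h21⟩

theorem mem_dom_of_env {Q : State} {e : Entry} (he : e ∈ Q.env) : e.name ∈ Q.dom := by
  simp only [State.dom, List.mem_append, List.mem_map]
  exact .inr ⟨e, he, rfl⟩

theorem mem_dom_of_chain {Q : State} {i : ChainItem} {e : Entry} (hi : i ∈ Q.chain)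
    (he : e ∈ i.env) : e.name ∈ Q.dom := by
  simp only [State.dom, List.mem_append, List.mem_flatMap, List.mem_cons, List.mem_map]
  exact .inl ⟨i, hi, .inr ⟨e, he, rfl⟩⟩

theorem dom_subset_names {Q : State} {x : ℕ} (h : x ∈ Q.dom) : x ∈ Q.names :=
  State.bnd_subset (State.dom_subset h)

section
variable {n : ℕ} {r m : ℕ → ℕ} {G : ℕ → Option ℕ} {addr : ℕ → ℕ}

theorem sim_sea1 {C : List ChainItem} {t u : PTerm} {S : List PTerm} {E : List Entry}
    (h : Sim n ⟨C, .app t u, S, E⟩ r m G addr) :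
    ∃ r' m' G', run prog ⟨93, r, m⟩ 15 = ⟨93, r', m'⟩ ∧ Sim n ⟨C, t, u :: S, E⟩ r' m' G' addr := by
  obtain ⟨h0, q, q', h1, h2, h3, h4⟩ := h.code
  have hi := h.heap
  have hc := h.consts
  obtain ⟨r', hr, e0, e1, e2, e3, e4, e5, e6, e7, e8, e9, e21⟩ : ∃ r', run prog ⟨93, r, m⟩ 15 =
      ⟨93, r', update (update m (r 4) q') (r 4 + 1) (r 2)⟩ ∧ r' 0 = r 0 ∧ r' 1 = q ∧ r' 2 = r 4 ∧
      r' 3 = r 3 ∧ r' 4 = r 4 + 4 ∧ r' 5 = r 5 ∧ r' 6 = r 6 ∧ r' 7 = r 7 ∧ r' 8 = r 8 ∧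
      r' 9 = r 9 ∧ r' 21 = r 21 := by
    simp [run_succ, run_zero, hc.h6, hc.h7, hc.h9, hi.sub _ _ h0, hi.sub _ _ h1, hi.sub _ _ h2]
  have hm : ∀ a < r 4, (update (update m (r 4) q') (r 4 + 1) (r 2)) a = m a := fun a ha => by
    rw [update_of_ne (by omega), update_of_ne (by omega)]
  have hd := hi.dvd
  obtain ⟨hi', hg⟩ := hi.freeze (hp' := r' 4) le_rfl e4.ge (by omega)
    (fun a v ha => hm a (hi.lt ha))
  have hgle := hg.gle hi
  have hn : ∀ x ∈ State.names ⟨C, t, u :: S, E⟩, x ∈ State.names ⟨C, .app t u, S, E⟩ := by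
    intro x hx
    simp only [State.names, PTerm.names, List.flatMap_cons, List.mem_append] at hx ⊢
    tauto
  have hcell : ∀ e : Entry, e.name ∈ State.dom ⟨C, .app t u, S, E⟩ → ∀ i < 3,
      (update (update m (r 4) q') (r 4 + 1) (r 2)) (addr e.name + i) = m (addr e.name + i) := by
    intro e he i hi
    have := (h.cell _ (dom_subset_names he)).le
    exact hm _ (by omega)
  refine ⟨r', _, _, hr, hi', hc.of_eq e6 e7 e8 e9 e21, e5.trans h.size,
    fun x hx => (h.cell x (hn x hx)).grow hg, fun x hx y hy => h.inj x (hn x hx) y (hn y hy), ?_,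
    ?_, ?_, ?_, ?_⟩
  · intro x hx
    have := (h.cell x (dom_subset_names hx)).le
    rw [hm _ (by omega)]
    exact h.mark x hx
  · rw [e0]
    exact h.chain.mono hgle (fun _ _ => rfl) fun c hc e he => hcell e (mem_dom_of_chain hc he)
  · rw [e1]
    exact h3.mono hgle fun _ _ => rfl
  · rw [e2]
    refine ⟨by have := hi.pos; omega, q', r 2, ?_, ?_, h4.mono hgle fun _ _ => rfl,
      h.stack.mono hgle fun _ _ => rfl⟩
    · simp [freeze]
    · simp [freeze]
  · rw [e3]
    exact h.env.mono hgle (fun _ _ => rfl) fun e he => hcell e (mem_dom_of_env he)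

/-- No memory is allocated: the new entry is written into the record of the binder `x`, which is
where the occurrences of `x` already point. As bound names are distinct, no existing entry is
overwritten. The mark is reset to `0`, since copying or decomposing may have left it dirty while `x`
was only a binder. -/
theorem sim_beta {C : List ChainItem} {x : ℕ} {t u : PTerm} {S : List PTerm} {E : List Entry}
    (h : Sim n ⟨C, .lam x t, u :: S, E⟩ r m G addr) (hwf : WF n ⟨C, .lam x t, u :: S, E⟩) :
    ∃ r' m' G', run prog ⟨93, r, m⟩ 22 = ⟨93, r', m'⟩ ∧
      Sim n ⟨C, t, S, .es x u :: E⟩ r' m' G' addr := by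
  obtain ⟨h0, h1, q, h2, h3⟩ := h.code
  obtain ⟨s0, p, s, s1, s2, s3, s4⟩ := h.stack
  have hi := h.heap
  have hc := h.consts
  set m' := update (update (update (update m (addr x) 1) (addr x + 1) p) (addr x + 2) (r 3))
    (addr x + 3) 0 with hm'
  obtain ⟨r', hr, e0, e1, e2, e3, e4, e5, e6, e7, e8, e9, e21⟩ : ∃ r', run prog ⟨93, r, m⟩ 22 =
      ⟨93, r', m'⟩ ∧ r' 0 = r 0 ∧ r' 1 = q ∧ r' 2 = s ∧
      r' 3 = addr x ∧ r' 4 = r 4 ∧ r' 5 = r 5 ∧ r' 6 = r 6 ∧ r' 7 = r 7 ∧ r' 8 = r 8 ∧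
      r' 9 = r 9 ∧ r' 21 = r 21 := by
    simp [hm', run_succ, run_zero, hc.h6, hc.h7, hc.h8, hc.h21, hi.sub _ _ h0, hi.sub _ _ h1,
      hi.sub _ _ h2, s0, hi.sub _ _ s1, hi.sub _ _ s2]
  have hxn : x ∈ State.names ⟨C, .lam x t, u :: S, E⟩ := by simp [State.names, PTerm.names]
  have hcx := h.cell x hxn
  have hm : ∀ b, (∀ i < 4, b ≠ addr x + i) → m' b = m b := fun b hb => by
    rw [hm', update_of_ne (hb 3 (by simp)), update_of_ne (hb 2 (by simp)),
      update_of_ne (hb 1 (by simp)), update_of_ne (by simpa using hb 0 (by simp))]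
  have hi' : HeapInv G (r' 4) m' := hi.write e4.ge (e4 ▸ hi.dvd) fun a v ha => hm a fun i h4 hai => by
    rw [hai, hcx.free i h4] at ha; cases ha
  have hn : ∀ y ∈ State.names ⟨C, t, S, .es x u :: E⟩,
      y ∈ State.names ⟨C, .lam x t, u :: S, E⟩ := by
    intro y hy
    simp only [State.names, PTerm.names, List.flatMap_cons, List.mem_append, Entry.names,
      List.mem_cons] at hy ⊢
    tauto
  have hxd : x ∉ State.dom ⟨C, .lam x t, u :: S, E⟩ := by
    intro hx
    have h1 := List.nodup_iff_count_le_one.1 hwf.nodup x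
    simp only [State.dom, List.mem_append, List.mem_flatMap, List.mem_map, List.mem_cons] at hx
    simp only [State.bnd, PTerm.binders, List.count_append, List.count_cons_self] at h1
    rcases hx with ⟨i, hi, hx⟩ | ⟨e, he, rfl⟩
    · have : 0 < (C.flatMap ChainItem.bnd).count x := by
        rw [List.count_pos_iff, List.mem_flatMap]
        refine ⟨i, hi, ?_⟩
        rcases hx with rfl | ⟨e, he, rfl⟩
        · simp [ChainItem.bnd]
        · simp only [ChainItem.bnd, List.mem_cons, List.mem_append, List.mem_flatMap]
          exact .inr (.inr ⟨e, he, by simp [Entry.bnd]⟩)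
      omega
    · have : 0 < (E.flatMap Entry.bnd).count e.name := by
        rw [List.count_pos_iff, List.mem_flatMap]
        exact ⟨e, he, by simp [Entry.bnd]⟩
      omega
  have hcell : ∀ y ∈ State.dom ⟨C, .lam x t, u :: S, E⟩, ∀ i < 4,
      m' (addr y + i) = m (addr y + i) := by
    intro y hy i hi
    refine hm _ fun j hj => (h.cell y (dom_subset_names hy)).add_ne hcx hi hj (.inl fun hxy => ?_)
    rw [h.inj y (dom_subset_names hy) x hxn hxy] at hy
    exact hxd hy
  refine ⟨r', _, G, hr, hi', hc.of_eq e6 e7 e8 e9 e21, e5.trans h.size,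
    fun y hy => e4 ▸ h.cell y (hn y hy), fun y hy z hz => h.inj y (hn y hy) z (hn z hz), ?_,
    ?_, ?_, ?_, ?_⟩
  · intro y hy
    by_cases hyx : y = x
    · rw [hyx, hm', update_self]
    · have hy' : y ∈ State.dom ⟨C, .lam x t, u :: S, E⟩ := by
        simp only [State.dom, List.map_cons, List.mem_append, List.mem_cons, Entry.name] at hy ⊢
        tauto
      rw [hcell y hy' 3 (by simp)]
      exact h.mark y hy'
  · rw [e0]
    exact h.chain.mono (GLe.refl G) (fun _ _ => rfl) fun c hc e he i hi =>
      hcell _ (mem_dom_of_chain hc he) i (by omega)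
  · rw [e1]; exact h3
  · rw [e2]; exact s4
  · rw [e3]
    refine ⟨hcx.pos.ne', rfl, by simp [hm', Entry.tag], ?_, ?_⟩
    · have : m' (addr x + 1) = p := by simp [hm']
      rw [this]; exact s3
    · have : m' (addr x + 2) = r 3 := by simp [hm']
      rw [this]
      exact h.env.mono (GLe.refl G) (fun _ _ => rfl) fun e he i hi =>
        hcell _ (mem_dom_of_env he) i (by omega)

theorem sim_sea2 {C : List ChainItem} {x : ℕ} {t : PTerm} {S : List PTerm} {E E' : List Entry}
    (ht : ¬ t.IsValue) (h : Sim n ⟨C, .var x, S, E ++ .es x t :: E'⟩ r m G addr) :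
    ∃ T r' m' G', run prog ⟨93, r, m⟩ T = ⟨93, r', m'⟩ ∧ 0 < T ∧ T ≤ 29 ∧
      Sim n ⟨⟨x, S, E⟩ :: C, t, [], E'⟩ r' m' G' addr := by
  obtain ⟨h0, h1⟩ := h.code
  obtain ⟨k, h2, h3, h4, h5, h6, h7⟩ := EnvAt.append.1 h.env
  simp only [Entry.name, Entry.tag, Entry.term] at h4 h5 h6
  subst h4
  have hi := h.heap
  have hc := h.consts
  set m' := update (update (update (update m (r 4) (addr x)) (r 4 + 1) (r 2)) (r 4 + 2) (r 3))
    (r 4 + 3) (r 0) with hm'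
  obtain ⟨T, r', hT, hT', hr, e0, e1, e2, e3, e4, e5, e6, e7, e8, e9, e21⟩ : ∃ T r', 0 < T ∧
      T ≤ 29 ∧ run prog ⟨93, r, m⟩ T = ⟨93, r', m'⟩ ∧ r' 0 = r 4 ∧ r' 1 = m (addr x + 1) ∧
      r' 2 = 0 ∧ r' 3 = m (addr x + 2) ∧ r' 4 = r 4 + 4 ∧ r' 5 = r 5 ∧ r' 6 = r 6 ∧ r' 7 = r 7 ∧
      r' 8 = r 8 ∧ r' 9 = r 9 ∧ r' 21 = r 21 := by
    -- A variable is recognized as a non-value by the first test of its tag; an application needs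
    -- two more instructions.
    cases t with
    | lam y t => exact absurd trivial ht
    | var y =>
      refine ⟨27, ?_⟩
      simp [hm', run_succ, run_zero, hc.h6, hc.h7, hc.h8, hc.h9, hi.sub _ _ h0, hi.sub _ _ h1,
        h5, hi.sub _ _ h6.1]
    | app t u =>
      refine ⟨29, ?_⟩
      simp [hm', run_succ, run_zero, hc.h6, hc.h7, hc.h8, hc.h9, hi.sub _ _ h0, hi.sub _ _ h1,
        h5, hi.sub _ _ h6.1]
  have hm : ∀ a < r 4, m' a = m a := fun a ha => by
    rw [hm', update_of_ne (by omega), update_of_ne (by omega), update_of_ne (by omega),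
      update_of_ne (by omega)]
  have hd := hi.dvd
  obtain ⟨hi', hg⟩ := hi.freeze (hp' := r' 4) le_rfl e4.ge (by omega)
    (fun a v ha => hm a (hi.lt ha))
  have hgle := hg.gle hi
  have hn : ∀ y ∈ State.names ⟨⟨x, S, E⟩ :: C, t, [], E'⟩,
      y ∈ State.names ⟨C, .var x, S, E ++ .es x t :: E'⟩ := by
    intro y hy
    simp only [State.names, PTerm.names, List.flatMap_cons, List.mem_append, Entry.names,
      List.mem_cons, ChainItem.names, List.flatMap_append, List.flatMap_nil, List.not_mem_nil]
      at hy ⊢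
    tauto
  have hdom : ∀ y ∈ State.dom ⟨⟨x, S, E⟩ :: C, t, [], E'⟩,
      y ∈ State.dom ⟨C, .var x, S, E ++ .es x t :: E'⟩ := by
    intro y hy
    simp only [State.dom, List.flatMap_cons, List.mem_append, List.mem_cons, List.map_append,
      List.map_cons, Entry.name] at hy ⊢
    tauto
  have hcell : ∀ y ∈ State.dom ⟨C, .var x, S, E ++ .es x t :: E'⟩, ∀ i < 4,
      m' (addr y + i) = m (addr y + i) := by
    intro y hy i hi
    have := (h.cell _ (dom_subset_names hy)).le
    exact hm _ (by omega)
  refine ⟨T, r', _, _, hr, hT, hT', hi', hc.of_eq e6 e7 e8 e9 e21, e5.trans h.size,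
    fun y hy => (h.cell y (hn y hy)).grow hg, fun y hy z hz => h.inj y (hn y hy) z (hn z hz), ?_,
    ?_, ?_, ?_, ?_⟩
  · intro y hy
    rw [hcell y (hdom y hy) 3 (by simp)]
    exact h.mark y (hdom y hy)
  · rw [e0]
    refine ⟨by have := hi.pos; omega, r 2, r 3, r 0, by simp [freeze, hm'], by simp [freeze, hm'],
      by simp [freeze, hm'], by simp [freeze, hm'], h.stack.mono hgle fun _ _ => rfl,
      h2.mono hgle (fun _ _ => rfl) fun e he i hi =>
        hcell _ (mem_dom_of_env (by simp [he])) i (by omega),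
      h.chain.mono hgle (fun _ _ => rfl) fun c hc e he i hi =>
        hcell _ (mem_dom_of_chain hc he) i (by omega)⟩
  · rw [e1]; exact h6.mono hgle fun _ _ => rfl
  · exact e2
  · rw [e3]
    exact h7.mono hgle (fun _ _ => rfl) fun e he i hi =>
        hcell _ (mem_dom_of_env (by simp [he])) i (by omega)

/-- The item does not remember the term node of the occurrence of `x`, so a new one is allocated.
The entry is rewritten in the old record of `x`, whose fourth word is not touched: the mark is still
`0`. -/
theorem sim_sea3 {C : List ChainItem} {x : ℕ} {v : PTerm} {S : List PTerm} {E E' : List Entry}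
    (hv : v.IsValue) (h : Sim n ⟨⟨x, S, E⟩ :: C, v, [], E'⟩ r m G addr)
    (hwf : WF n ⟨⟨x, S, E⟩ :: C, v, [], E'⟩) :
    ∃ r' m' G', run prog ⟨93, r, m⟩ 29 = ⟨93, r', m'⟩ ∧
      Sim n ⟨C, .var x, S, E ++ .es x v :: E'⟩ r' m' G' addr := by
  obtain ⟨c0, s, e, c, c1, c2, c3, c4, c5, c6, c7⟩ := h.chain
  simp only at c1 c5 c6
  have h2 : r 2 = 0 := h.stack
  have hi := h.heap
  have hc := h.consts
  set m' := update (update (update (update (update m (addr x) 1) (addr x + 1) (r 1)) (addr x + 2)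
    (r 3)) (r 4) 0) (r 4 + 1) (addr x) with hm'
  obtain ⟨r', hr, e0, e1, e2, e3, e4, e5, e6, e7, e8, e9, e21⟩ : ∃ r', run prog ⟨93, r, m⟩ 29 =
      ⟨93, r', m'⟩ ∧ r' 0 = c ∧ r' 1 = r 4 ∧ r' 2 = s ∧
      r' 3 = e ∧ r' 4 = r 4 + 4 ∧ r' 5 = r 5 ∧ r' 6 = r 6 ∧ r' 7 = r 7 ∧ r' 8 = r 8 ∧
      r' 9 = r 9 ∧ r' 21 = r 21 := by
    cases v with
    | var _ | app _ _ => exact hv.elim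
    | lam y t =>
      simp [hm', run_succ, run_zero, hc.h6, hc.h7, hc.h8, hc.h9, hc.h21, hi.sub _ _ h.code.1, h2,
        c0, hi.sub _ _ c1, hi.sub _ _ c2, hi.sub _ _ c3, hi.sub _ _ c4]
  have hxn : x ∈ State.names ⟨⟨x, S, E⟩ :: C, v, [], E'⟩ := by
    simp [State.names, ChainItem.names]
  have hcx := h.cell x hxn
  have hcl := hcx.le
  have hm : ∀ b < r 4, (∀ i < 3, b ≠ addr x + i) → m' b = m b := fun b hb' hb => by
    rw [hm', update_of_ne (by omega), update_of_ne (by omega), update_of_ne (hb 2 (by simp)),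
      update_of_ne (hb 1 (by simp)), update_of_ne (by simpa using hb 0 (by simp))]
  have hd := hi.dvd
  obtain ⟨hi', hg⟩ := hi.freeze (hp' := r' 4) (m' := m') le_rfl e4.ge (by omega)
    (fun a v ha => hm a (hi.lt ha) fun i h4 hai => by
      rw [hai, hcx.free i (by omega)] at ha; cases ha)
  have hgle := hg.gle hi
  have hn : ∀ y ∈ State.names ⟨C, .var x, S, E ++ .es x v :: E'⟩,
      y ∈ State.names ⟨⟨x, S, E⟩ :: C, v, [], E'⟩ := by
    intro y hy
    simp only [State.names, PTerm.names, List.flatMap_cons, List.mem_append, Entry.names,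
      List.mem_cons, ChainItem.names, List.flatMap_append, List.flatMap_nil, List.not_mem_nil]
      at hy ⊢
    tauto
  have hdom : ∀ y ∈ State.dom ⟨C, .var x, S, E ++ .es x v :: E'⟩,
      y ∈ State.dom ⟨⟨x, S, E⟩ :: C, v, [], E'⟩ := by
    intro y hy
    simp only [State.dom, List.flatMap_cons, List.mem_append, List.mem_cons, List.map_append,
      List.map_cons, Entry.name] at hy ⊢
    tauto
  have hx1 := List.nodup_iff_count_le_one.1 hwf.nodup x
  simp only [State.bnd, List.count_append, List.count_cons_self, List.flatMap_cons,
    ChainItem.bnd] at hx1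
  have hE : ∀ E'' : List Entry, (E''.flatMap Entry.bnd).count x = 0 → ∀ e ∈ E'', e.name ≠ x := by
    rintro E'' h e he rfl
    rw [List.count_eq_zero] at h
    exact h (List.mem_flatMap.2 ⟨e, he, by simp [Entry.bnd]⟩)
  have hC : ∀ i ∈ C, ∀ e ∈ i.env, e.name ≠ x := by
    rintro i hi e he rfl
    have : 0 < (C.flatMap ChainItem.bnd).count e.name := by
      rw [List.count_pos_iff, List.mem_flatMap]
      refine ⟨i, hi, ?_⟩
      simp only [ChainItem.bnd, List.mem_cons, List.mem_append, List.mem_flatMap]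
      exact .inr (.inr ⟨e, he, by simp [Entry.bnd]⟩)
    omega
  have hcell : ∀ y ∈ State.dom ⟨⟨x, S, E⟩ :: C, v, [], E'⟩, ∀ i < 4, y ≠ x ∨ i = 3 →
      m' (addr y + i) = m (addr y + i) := by
    intro y hy i hi hyx
    have hcy := h.cell y (dom_subset_names hy)
    have := hcy.le
    refine hm _ (by omega) fun j hj => hcy.add_ne hcx hi (by omega) ?_
    rcases hyx with hyx | rfl
    · exact .inl fun hxy => hyx (h.inj y (dom_subset_names hy) x hxn hxy)
    · exact .inr (by omega)
  refine ⟨r', _, _, hr, hi', hc.of_eq e6 e7 e8 e9 e21, e5.trans h.size,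
    fun y hy => (h.cell y (hn y hy)).grow hg, fun y hy z hz => h.inj y (hn y hy) z (hn z hz), ?_,
    ?_, ?_, ?_, ?_⟩
  · intro y hy
    rw [hcell y (hdom y hy) 3 (by simp) (.inr rfl)]
    exact h.mark y (hdom y hy)
  · rw [e0]
    exact c7.mono hgle (fun _ _ => rfl) fun c hc e he i hi =>
      hcell _ (mem_dom_of_chain (List.mem_cons_of_mem _ hc) he) i (by omega) (.inl (hC c hc e he))
  · rw [e1]
    exact ⟨by simp [freeze, hm'], by simp [freeze, hm']⟩
  · rw [e2]; exact c5.mono hgle fun _ _ => rfl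
  · rw [e3]
    refine EnvAt.append.2 ⟨addr x, c6.mono hgle (fun _ _ => rfl) fun e he i hi =>
      hcell _ (mem_dom_of_chain (List.mem_cons_self) he) i (by omega)
        (.inl (hE E (by omega) e he)), hcx.pos.ne', rfl, ?_, ?_, ?_⟩
    · rw [hm', update_of_ne (by omega), update_of_ne (by omega)]
      simp [Entry.tag]
    · have : m' (addr x + 1) = r 1 := by
        rw [hm', update_of_ne (by omega), update_of_ne (by omega)]
        simp
      rw [this]
      exact h.code.mono hgle fun _ _ => rfl
    · have : m' (addr x + 2) = r 3 := by
        rw [hm', update_of_ne (by omega), update_of_ne (by omega)]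
        simp
      rw [this]
      exact h.env.mono hgle (fun _ _ => rfl) fun e he i hi =>
        hcell _ (mem_dom_of_env he) i (by omega) (.inl (hE E' (by omega) e he))

end
end SMAD

/-! ### The transitions that traverse a term -/

namespace SMAD
open RAM

/-- The names bound by environment and chain and the binders inside one entry are disjoint parts of
the list of all bound names, so distinctness separates them. -/
theorem State.dom_count_add_le {Q : State} {E E' : List Entry} {e : Entry}
    (hQ : Q.env = E ++ e :: E') (b : ℕ) :
    Q.dom.count b + e.term.binders.count b ≤ Q.bnd.count b := by
  have henv : ∀ E : List Entry, (E.map Entry.name).count b ≤ (E.flatMap Entry.bnd).count b := by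
    intro E
    induction E with
    | nil => simp
    | cons e E ih =>
      simp only [List.map_cons, List.flatMap_cons, List.count_cons, List.count_append, Entry.bnd]
      omega
  have hchain : ∀ C : List ChainItem, (C.flatMap fun i => i.name :: i.env.map Entry.name).count b
      ≤ (C.flatMap ChainItem.bnd).count b := by
    intro C
    induction C with
    | nil => simp
    | cons i C ih =>
      have := henv i.env
      simp only [List.flatMap_cons, List.count_cons, List.count_append, ChainItem.bnd]
      omega
  have h1 := henv E
  have h2 := henv E'
  have h3 := hchain Q.chain
  simp only [State.dom, State.bnd, hQ, List.map_append, List.map_cons, List.flatMap_append,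
    List.flatMap_cons, List.count_append, List.count_cons, Entry.bnd]
  omega

/-- These are the facts that the two traversals need of the looked-up term: it is clean, its free
variables have mark `0` because they are in the domain, and its binders, whose marks will be
overwritten, are not. -/
theorem WF.entry {n : ℕ} {Q : State} {E E' : List Entry} {e : Entry} (h : WF n Q)
    (hQ : Q.env = E ++ e :: E') : e.term.size ≤ n ∧ e.term.Clean ∧
      (∀ y ∈ e.term.fv, y ∈ Q.dom) ∧ ∀ y ∈ e.term.binders, y ∉ Q.dom := by
  have h1 := h.env
  rw [hQ, EnvOK.append] at h1
  have hfv : ∀ y ∈ e.term.fv, y ∈ Q.dom := by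
    intro y hy
    have := h1.2.1.2 y hy
    simp only [Set.mem_ofPred_eq, Set.mem_empty_iff_false, false_or] at this
    simp [State.dom, hQ, this]
  have hcount := fun b => (State.dom_count_add_le hQ b).trans
    (List.nodup_iff_count_le_one.1 h.nodup b)
  have hbd : ∀ y ∈ e.term.binders, y ∉ Q.dom := by
    intro y hy hy'
    have := List.count_pos_iff.2 hy
    have := List.count_pos_iff.2 hy'
    have := hcount y
    omega
  refine ⟨h1.2.1.1, ⟨List.nodup_iff_count_le_one.2 fun b => ?_, fun y hy hy' => ?_⟩, hfv, hbd⟩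
  · have := hcount b
    omega
  · exact hbd y hy (hfv y hy')

theorem WF.name_ne {n : ℕ} {Q : State} {E E' : List Entry} {e : Entry} (h : WF n Q)
    (hQ : Q.env = E ++ e :: E') : (∀ e' ∈ E, e'.name ≠ e.name) ∧ (∀ e' ∈ E', e'.name ≠ e.name) ∧
      ∀ i ∈ Q.chain, ∀ e' ∈ i.env, e'.name ≠ e.name := by
  have h1 := (State.dom_count_add_le hQ e.name).trans
    (List.nodup_iff_count_le_one.1 h.nodup e.name)
  simp only [State.dom, hQ, List.map_append, List.map_cons, List.count_append,
    List.count_cons_self] at h1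
  refine ⟨fun e' he' h => ?_, fun e' he' h => ?_, fun i hi e' he' h => ?_⟩
  · have := List.count_pos_iff.2 (List.mem_map_of_mem (f := Entry.name) he')
    rw [h] at this
    omega
  · have := List.count_pos_iff.2 (List.mem_map_of_mem (f := Entry.name) he')
    rw [h] at this
    omega
  · have : e.name ∈ Q.chain.flatMap fun i => i.name :: i.env.map Entry.name :=
      List.mem_flatMap.2 ⟨i, hi, List.mem_cons_of_mem _ (h ▸ List.mem_map_of_mem he')⟩
    have := List.count_pos_iff.2 this
    omega

section
variable {n : ℕ} {r m : ℕ → ℕ} {G : ℕ → Option ℕ} {addr : ℕ → ℕ}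

/-- At top level all free variables of the skeleton have mark `0`, so they resolve to themselves and
the invariant of `copy_run` holds for the empty list of binders. The copy dirties only marks of
binders of the skeleton, which are outside the domain. -/
theorem sim_ss {C : List ChainItem} {x : ℕ} {v w : PTerm} {S : List PTerm} {E E' : List Entry}
    (h : Sim n ⟨C, .var x, S, E ++ .skel x v :: E'⟩ r m G addr)
    (hwf : WF n ⟨C, .var x, S, E ++ .skel x v :: E'⟩) (hα : PTerm.Alpha w v) (hwb : w.WellBound)
    (hfr : ∀ z ∈ w.binders, z ∉ State.names ⟨C, .var x, S, E ++ .skel x v :: E'⟩) :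
    ∃ T r' m' G' addr', run prog ⟨93, r, m⟩ T = ⟨93, r', m'⟩ ∧ 0 < T ∧ T ≤ 64 * n + 16 ∧
      Sim n ⟨C, w, S, E ++ .skel x v :: E'⟩ r' m' G' addr' := by
  set Q : State := ⟨C, .var x, S, E ++ .skel x v :: E'⟩ with hQ
  obtain ⟨h0, h1⟩ := h.code
  obtain ⟨k, h2, h3, h4, h5, h6, h7⟩ := EnvAt.append.1 h.env
  simp only [Entry.name, Entry.tag, Entry.term] at h4 h5 h6
  subst h4
  have hi := h.heap
  have hc := h.consts
  obtain ⟨r1, hr1, e0, e2, e3, e4, e5, e6, e7, e8, e9, e10, e11, e20, e21⟩ : ∃ r',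
      run prog ⟨93, r, m⟩ 14 = ⟨8, r', m⟩ ∧ r' 0 = r 0 ∧ r' 2 = r 2 ∧
      r' 3 = r 3 ∧ r' 4 = r 4 ∧ r' 5 = r 5 ∧ r' 6 = r 6 ∧ r' 7 = r 7 ∧ r' 8 = r 8 ∧
      r' 9 = r 9 ∧ r' 10 = 0 ∧ r' 11 = m (addr x + 1) ∧ r' 20 = 1 ∧ r' 21 = r 21 := by
    simp [run_succ, run_zero, hc.h6, hi.sub _ _ h0, hi.sub _ _ h1, h5]
  obtain ⟨f1, f2, f3, f4⟩ := hwf.entry (Q := Q) rfl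
  simp only [Entry.term] at f1 f2 f3 f4
  have hvn : ∀ y ∈ v.names, y ∈ Q.names := by
    intro y hy
    simp [Q, State.names, Entry.names, hy]
  have hwn : ∀ y ∈ w.fv, y ∈ v.fv := fun y hy => hα.fv_subset hy
  obtain ⟨T, r2, m2, G2, addr', hr2, hT, hst, k10, hf, ht⟩ := copy_run v w [] r1 m G addr
    (e4 ▸ hi) (hc.of_eq e6 e7 e8 e9 e21) (by omega) (e11 ▸ h6)
    (fun y hy => e4 ▸ h.cell y (hvn y hy)) (fun y hy z hz => h.inj y (hvn y hy) z (hvn z hz)) f2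
    ⟨hwb, fun y hy hy' => hfr y hy (hvn y (PTerm.mem_names_iff.2 (.inl (hwn y hy'))))⟩
    (fun y hy hy' => hfr y hy (hvn y hy')) hα (by
      rintro y - z hz hyz
      simp only [PTerm.AlphaVar] at hyz
      rw [resolve, if_pos (h.mark z (f3 z hz)), hyz])
  rw [e4] at hf
  have hg : Grow G (r 4) G2 (r2 4) := e4 ▸ hst.grow
  have hgle := hg.gle hi
  have hr3 : run prog ⟨41, r2, m2⟩ 2 = ⟨93, update r2 1 (r2 12), m2⟩ := by
    simp [run_succ, run_zero, k10, e10]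
  have hk := hst.keep
  have hn : ∀ y ∈ State.names ⟨C, w, S, E ++ .skel x v :: E'⟩, y ∈ Q.names ∨ y ∈ w.binders := by
    intro y hy
    by_cases hyw : y ∈ w.names
    · rcases PTerm.mem_names_iff.1 hyw with hyw | hyw
      · exact .inl (hvn y (PTerm.mem_names_iff.2 (.inl (hwn y hyw))))
      · exact .inr hyw
    · left
      simp only [State.names, Q, PTerm.names, List.mem_append] at hy ⊢
      tauto
  obtain ⟨hcell, hinj⟩ := hf.cells hg hn hfr h.cell h.inj
  have haddr : ∀ y ∈ Q.names, addr' y = addr y := fun y hy => hf.eq y fun h => hfr y h hy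
  have hmem : ∀ y ∈ Q.dom, ∀ i < 4, m2 (addr y + i) = m (addr y + i) := by
    intro y hy i hi4
    have hcy := h.cell y (dom_subset_names hy)
    have := hcy.le
    refine hst.mem _ (by omega) ?_
    rintro ⟨z, hz, hzy⟩
    have hzn := hvn z (PTerm.mem_names_iff.2 (.inr hz))
    refine hcy.add_ne (h.cell z hzn) hi4 (by omega) (.inl fun hyz => ?_) hzy
    rw [h.inj y (dom_subset_names hy) z hzn hyz] at hy
    exact f4 z hz hy
  have hnm : ∀ y, (y ∈ C.flatMap ChainItem.names ∨ y ∈ S.flatMap PTerm.names ∨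
      y ∈ (E ++ .skel x v :: E').flatMap Entry.names) → addr' y = addr y := fun y hy => by
    refine haddr y ?_
    simp only [Q, State.names, List.mem_append] at hy ⊢
    tauto
  refine ⟨14 + (T + 2), update r2 1 (r2 12), m2, G2, addr', run_trans hr1 (run_trans hr2 hr3),
    by omega, by omega, hst.inv, ?_, ?_, hcell, hinj, ?_, ?_, ht, ?_, ?_⟩
  · exact ((hc.of_eq e6 e7 e8 e9 e21).keep hk).of_eq rfl rfl rfl rfl rfl
  · exact (hk 5 (by simp [kept])).trans (e5.trans h.size)
  · intro y hy
    have hy : y ∈ Q.dom := hy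
    rw [haddr y (dom_subset_names hy), hmem y hy 3 (by simp)]
    exact h.mark y hy
  · have : update r2 1 (r2 12) 0 = r 0 := (hk 0 (by simp [kept])).trans e0
    rw [this]
    exact h.chain.mono hgle (fun y hy => hnm y (.inl hy)) fun c hc e he i hi =>
      hmem _ (mem_dom_of_chain hc he) i (by omega)
  · have : update r2 1 (r2 12) 2 = r 2 := (hk 2 (by simp [kept])).trans e2
    rw [this]
    exact h.stack.mono hgle fun y hy => hnm y (.inr (.inl hy))
  · have : update r2 1 (r2 12) 3 = r 3 := (hk 3 (by simp [kept])).trans e3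
    rw [this]
    exact h.env.mono hgle (fun y hy => hnm y (.inr (.inr hy))) fun e he i hi =>
      hmem _ (mem_dom_of_env he) i (by omega)

/-- The entry of `x` is turned in place into a skeletal one, and its next pointer is redirected to
the flesh, whose list ends at the former next entry. The new abstraction reuses the record of the
binder `y`, as the skeleton keeps that name. -/
theorem sim_sk {C : List ChainItem} {x : ℕ} {v w : PTerm} {F : List (ℕ × PTerm)} {S : List PTerm}
    {E E' : List Entry} (h : Sim n ⟨C, .var x, S, E ++ .es x v :: E'⟩ r m G addr)
    (hwf : WF n ⟨C, .var x, S, E ++ .es x v :: E'⟩) (hdec : PTerm.SkelDecValue v w F)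
    (hnd : (F.map Prod.fst).Nodup)
    (hfr : ∀ z ∈ F.map Prod.fst, z ∉ State.names ⟨C, .var x, S, E ++ .es x v :: E'⟩) :
    ∃ T r' m' G' addr', run prog ⟨93, r, m⟩ T = ⟨93, r', m'⟩ ∧ 0 < T ∧ T ≤ 128 * n + 39 ∧
      Sim n ⟨C, .var x, S, E ++ .skel x w :: (fleshEnv F ++ E')⟩ r' m' G' addr' := by
  set Q : State := ⟨C, .var x, S, E ++ .es x v :: E'⟩ with hQ
  obtain ⟨f1, f2, f3, f4⟩ := hwf.entry (Q := Q) rfl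
  obtain ⟨d1, d2, d3⟩ := hwf.name_ne (Q := Q) rfl
  obtain ⟨h0, h1⟩ := h.code
  obtain ⟨k, h2, h3, h4, h5, h6, h7⟩ := EnvAt.append.1 h.env
  simp only [Entry.name, Entry.tag, Entry.term] at h4 h5 h6 f1 f2 f3 f4 d1 d2 d3
  subst h4
  obtain ⟨y, t, u, F, hdec⟩ := hdec
  obtain ⟨t0, t1, q, t2, t3⟩ := h6
  have hi := h.heap
  have hc := h.consts
  set m1 := update m (addr y + 3) n with hm1
  obtain ⟨r1, hr1, e0, e1, e2, e3, e4, e5, e6, e7, e8, e9, e10, e11, e14, e15, e19, e21, e22⟩ :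
      ∃ r', run prog ⟨93, r, m⟩ 24 = ⟨181, r', m1⟩ ∧ r' 0 = r 0 ∧ r' 1 = r 1 ∧ r' 2 = r 2 ∧
      r' 3 = r 3 ∧ r' 4 = r 4 ∧ r' 5 = r 5 ∧ r' 6 = r 6 ∧ r' 7 = r 7 ∧ r' 8 = r 8 ∧
      r' 9 = r 9 ∧ r' 10 = 0 ∧ r' 11 = q ∧ r' 14 = n - 1 ∧ r' 15 = m (addr x + 2) ∧
      r' 19 = addr x ∧ r' 21 = r 21 ∧ r' 22 = m (addr x + 1) := by
    simp [hm1, run_succ, run_zero, hc.h6, hc.h7, hc.h8, hi.sub _ _ h0, hi.sub _ _ h1, h5,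
      hi.sub _ _ t0, hi.sub _ _ t1, hi.sub _ _ t2, h.size]
  have hc1 := hc.of_eq e6 e7 e8 e9 e21
  have hvn : ∀ z ∈ (PTerm.lam y t).names, z ∈ Q.names := by
    intro z hz
    simp [Q, State.names, Entry.names, hz]
  have hyn : y ∈ Q.names := hvn y (by simp [PTerm.names])
  have htn : ∀ z ∈ t.names, z ∈ Q.names := fun z hz => hvn z (by simp [PTerm.names, hz])
  have hxn : x ∈ Q.names := by simp [Q, State.names, PTerm.names]
  have hcy := h.cell y hyn
  have hcx := h.cell x hxn
  have hi1 : HeapInv G (r1 4) m1 := hi.write e4.ge (e4 ▸ hi.dvd) fun a v ha => by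
    rw [hm1, update_of_ne]
    rintro rfl
    rw [hcy.free 3 (by simp)] at ha
    cases ha
  have hyd : y ∉ Q.dom := f4 y (by simp [PTerm.binders])
  have hmem1 : ∀ z ∈ Q.dom, ∀ i < 4, m1 (addr z + i) = m (addr z + i) := by
    intro z hz i hi4
    have hzn := dom_subset_names hz
    rw [hm1, update_of_ne]
    refine (h.cell z hzn).add_ne hcy hi4 (by simp) (.inl fun hzy => ?_)
    rw [h.inj z hzn y hyn hzy] at hz
    exact hyd hz
  simp only [PTerm.size] at f1
  have htb := (f2.lam).2
  obtain ⟨T, r2, m2, G2, hr2, hT, hst, k10, -, -, hdr⟩ := dec_run t {y} r1 m1 G addr hi1 hc1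
    (e11 ▸ t3) (fun z hz => e4 ▸ h.cell z (htn z hz))
    (fun a ha b hb => h.inj a (htn a ha) b (htn b hb)) f2.lam.1 (by omega) (by
      intro z hz
      by_cases hzy : z = y
      · subst hzy
        left
        -- The outermost binder has the mark `n` and the counter starts at `n - 1`. This suffices
        -- for the inner binders because the body has size at most `n - 1`.
        simp only [Finset.mem_singleton, hm1, update_self, e14, true_and]
        omega
      · right
        have hzd := f3 z (by simp [PTerm.fv, hz, hzy])
        exact ⟨by simpa using hzy, (hmem1 z hzd 3 (by simp)).trans (h.mark z hzd)⟩)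
  obtain ⟨addr', hf, hmk, htu, henv⟩ := hdr u F addr hdec hnd
    (fun z hz hz' => hfr z hz (htn z hz')) fun _ _ => rfl
  rw [e4] at hf
  rw [e15] at henv
  have hg : Grow G (r 4) G2 (r2 4) := e4 ▸ hst.grow
  have hgle := hg.gle hi
  have hk := hst.keep
  have hi2 := hst.inv
  have hc2 := hc1.keep hk
  have hcx2 := hcx.grow hg
  have hmem2 : ∀ z ∈ Q.dom, ∀ i < 4, m2 (addr z + i) = m (addr z + i) := by
    intro z hz i hi4
    have hzn := dom_subset_names hz
    have hcz := h.cell z hzn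
    have := hcz.le
    rw [← hmem1 z hz i hi4]
    refine hst.mem _ (by omega) ?_
    rintro ⟨b, hb, hbz⟩
    have hbn := htn b (PTerm.mem_names_iff.2 (.inr hb))
    refine hcz.add_ne (h.cell b hbn) hi4 (by omega) (.inl fun hzb => ?_) hbz
    rw [h.inj z hzn b hbn hzb] at hz
    exact f4 b (by simp [PTerm.binders, hb]) hz
  have k0 := (hk 0 (by simp [kept])).trans e0
  have k1 := (hk 1 (by simp [kept])).trans e1
  have k2 := (hk 2 (by simp [kept])).trans e2
  have k3 := (hk 3 (by simp [kept])).trans e3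
  have k5 := (hk 5 (by simp [kept])).trans e5
  have k19 := (hk 19 (by simp [kept])).trans e19
  have k22 := (hk 22 (by simp [kept])).trans e22
  set m3 := update (update (update (update (update (update m2 (r2 4) 1) (r2 4 + 1) (addr y))
    (r2 4 + 2) (r2 12)) (addr x) 2) (addr x + 1) (r2 4)) (addr x + 2) (r2 15) with hm3
  have hcl := hcx2.le
  obtain ⟨r3, hr3, l0, l1, l2, l3, l4, l5, l6, l7, l8, l9, l21⟩ :
      ∃ r', run prog ⟨211, r2, m2⟩ 15 = ⟨93, r', m3⟩ ∧ r' 0 = r2 0 ∧ r' 1 = r2 1 ∧ r' 2 = r2 2 ∧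
      r' 3 = r2 3 ∧ r' 4 = r2 4 + 4 ∧ r' 5 = r2 5 ∧ r' 6 = r2 6 ∧ r' 7 = r2 7 ∧ r' 8 = r2 8 ∧
      r' 9 = r2 9 ∧ r' 21 = r2 21 := by
    simp [hm3, run_succ, run_zero, hc2.h6, hc2.h7, hc2.h9, k10, e10, k19, k22,
      hi2.sub _ _ (hgle _ _ t1)]
  have hm : ∀ b < r2 4, (∀ i < 3, b ≠ addr x + i) → m3 b = m2 b := fun b hb' hb => by
    rw [hm3, update_of_ne (hb 2 (by simp)), update_of_ne (hb 1 (by simp)),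
      update_of_ne (by simpa using hb 0 (by simp)), update_of_ne (by omega),
      update_of_ne (by omega), update_of_ne (by omega)]
  have hd := hi2.dvd
  obtain ⟨hi3, hg3⟩ := hi2.freeze (hp' := r3 4) (m' := m3) le_rfl l4.ge (by omega)
    (fun a v ha => hm a (hi2.lt ha) fun i h4 hai => by
      rw [hai, hcx2.free i (by omega)] at ha; cases ha)
  have hgle3 := hg3.gle hi2
  obtain ⟨hnu, hnF⟩ := hdec.names
  have hn : ∀ z ∈ State.names ⟨C, .var x, S, E ++ .skel x (.lam y u) :: (fleshEnv F ++ E')⟩,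
      z ∈ Q.names ∨ z ∈ F.map Prod.fst := by
    intro z hz
    simp only [State.names, PTerm.names, List.flatMap_append, List.flatMap_cons, List.mem_append,
      Entry.names, List.mem_cons] at hz
    by_cases hzu : z ∈ u.names
    · exact (hnu z hzu).imp_left (htn z)
    by_cases hzF : z ∈ (fleshEnv F).flatMap Entry.names
    · rcases fleshEnv_names hzF with h | ⟨p, hp, h⟩
      · exact .inr h
      · exact .inl (htn z (hnF p hp z h))
    · left
      simp only [Q, State.names, PTerm.names, List.flatMap_append, List.flatMap_cons,
        List.mem_append, Entry.names, List.mem_cons]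
      tauto
  obtain ⟨hcell, hinj⟩ := (hf.grow hg3).cells (hg.trans hg3) hn hfr h.cell h.inj
  have haddr : ∀ z ∈ Q.names, addr' z = addr z := fun z hz => hf.eq z fun h => hfr z h hz
  have hmem3 : ∀ z ∈ Q.dom, ∀ i < 4, z ≠ x ∨ i = 3 → m3 (addr z + i) = m (addr z + i) := by
    intro z hz i hi4 hzx
    have hzn := dom_subset_names hz
    have hcz := h.cell z hzn
    have := (hcz.grow hg).le
    rw [← hmem2 z hz i hi4]
    -- Only the first three words of the record of `x` have been rewritten, so its mark survives.
    refine hm _ (by omega) fun j hj => hcz.add_ne hcx hi4 (by omega) ?_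
    rcases hzx with hzx | rfl
    · exact .inl fun hzx' => hzx (h.inj z hzn x hxn hzx')
    · exact .inr (by omega)
  have hmemF : ∀ z ∈ F.map Prod.fst, ∀ i < 4, m3 (addr' z + i) = m2 (addr' z + i) := by
    intro z hz i hi4
    obtain ⟨hcz, hle⟩ := hf.cell z hz
    have := hcz.le
    have := hcx.le
    exact hm _ (by omega) fun j hj => by omega
  have hnm : ∀ z, (z ∈ C.flatMap ChainItem.names ∨ z ∈ S.flatMap PTerm.names ∨
      z ∈ E.flatMap Entry.names ∨ z ∈ E'.flatMap Entry.names) → addr' z = addr z := fun z hz => by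
    refine haddr z ?_
    simp only [Q, State.names, List.flatMap_append, List.flatMap_cons, List.mem_append] at hz ⊢
    tauto
  have hgl : GLe G _ := (hg.trans hg3).gle hi
  have hx' := haddr x hxn
  refine ⟨24 + (T + 15), r3, m3, _, addr', run_trans hr1 (run_trans hr2 hr3), by omega, by omega,
    hi3, hc2.of_eq l6 l7 l8 l9 l21, l5.trans (k5.trans h.size), hcell, hinj, ?_, ?_, ?_, ?_, ?_⟩
  · intro z hz
    by_cases hzF : z ∈ F.map Prod.fst
    · rw [hmemF z hzF 3 (by simp)]
      exact hmk z hzF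
    · have hz : z ∈ Q.dom := by
        simp only [State.dom, List.map_append, List.map_cons, List.mem_append, List.mem_cons,
          Entry.name, fleshEnv_map_name, Q] at hz ⊢
        tauto
      rw [haddr z (dom_subset_names hz), hmem3 z hz 3 (by simp) (.inr rfl)]
      exact h.mark z hz
  · rw [l0, k0]
    exact h.chain.mono hgl (fun z hz => hnm z (.inl hz)) fun c hc e he i hi =>
      hmem3 _ (mem_dom_of_chain hc he) i (by omega) (.inl (d3 c hc e he))
  · rw [l1, k1]
    exact h.code.mono hgl fun z hz => by
      simp only [PTerm.names, List.mem_singleton] at hz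
      rw [hz, hx']
  · rw [l2, k2]
    exact h.stack.mono hgl fun z hz => hnm z (.inr (.inl hz))
  · rw [l3, k3]
    refine EnvAt.append.2 ⟨addr x, h2.mono hgl (fun z hz => hnm z (.inr (.inr (.inl hz))))
      fun e he i hi => hmem3 _ (mem_dom_of_env (by simp [Q, he])) i (by omega) (.inl (d1 e he)),
      hcx.pos.ne', hx'.symm, ?_, ?_, ?_⟩
    · simp [hm3, Entry.tag]
    · have : m3 (addr x + 1) = r2 4 := by simp [hm3]
      rw [this]
      have hy' := haddr y hyn
      refine ⟨?_, ?_, r2 12, ?_, htu.mono hgle3 fun _ _ => rfl⟩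
      · rw [freeze, if_pos (by omega), hm3, update_of_ne (by omega), update_of_ne (by omega),
          update_of_ne (by omega)]
        simp
      · rw [freeze, if_pos (by omega), hm3, update_of_ne (by omega), update_of_ne (by omega),
          update_of_ne (by omega)]
        simp [hy']
      · rw [freeze, if_pos (by omega), hm3, update_of_ne (by omega), update_of_ne (by omega),
          update_of_ne (by omega)]
        simp
    · have : m3 (addr x + 2) = r2 15 := by simp [hm3]
      rw [this]
      refine EnvAt.append.2 ⟨_, henv.mono hgle3 (fun _ _ => rfl) fun e he i hi => ?_,
        h7.mono hgl (fun z hz => hnm z (.inr (.inr (.inr hz)))) fun e he i hi =>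
          hmem3 _ (mem_dom_of_env (by simp [Q, he])) i (by omega) (.inl (d2 e he))⟩
      have : e.name ∈ (fleshEnv F).map Entry.name := List.mem_map_of_mem he
      rw [fleshEnv_map_name] at this
      exact hmemF _ this i (by omega)

end
end SMAD

namespace SMAD
open RAM

/-! ### Simulation of a transition -/

/-- A bound on the time that the program needs for a transition. -/
def cost (n : ℕ) : Label → ℕ
  | .sk => 167 * n
  | .ss => 167 * n
  | _ => 29

theorem WF.pos {n : ℕ} {Q : State} (h : WF n Q) : 0 < n :=
  Q.code.size_pos.trans_le h.code.1

/-- The configuration `c` is at the head of the main loop and represents `Q`. -/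
def Match (n : ℕ) (Q : State) (c : Config) : Prop :=
  ∃ r m G addr, c = ⟨93, r, m⟩ ∧ Sim n Q r m G addr

theorem Match.represents {n : ℕ} {Q : State} {c : Config} (h : Match n Q c) : Represents c Q := by
  obtain ⟨r, m, G, addr, rfl, h⟩ := h
  exact h.represents

theorem Match.step {n : ℕ} {a : Label} {Q Q' : State} {c : Config} (h : Match n Q c)
    (hwf : WF n Q) (hs : Step a Q Q') :
    ∃ T, 0 < T ∧ T ≤ cost n a ∧ Match n Q' (run prog c T) := by
  have hn := hwf.pos
  obtain ⟨r, m, G, addr, rfl, h⟩ := h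
  cases hs with
  | sea1 C t u S E =>
    obtain ⟨r', m', G', hr, h'⟩ := sim_sea1 h
    exact ⟨15, by simp, by simp [cost], hr ▸ ⟨r', m', G', addr, rfl, h'⟩⟩
  | beta C x t u S E =>
    obtain ⟨r', m', G', hr, h'⟩ := sim_beta h hwf
    exact ⟨22, by simp, by simp [cost], hr ▸ ⟨r', m', G', addr, rfl, h'⟩⟩
  | sea2 C x t S E E' ht =>
    obtain ⟨T, r', m', G', hr, hT, hT', h'⟩ := sim_sea2 ht h
    exact ⟨T, hT, hT', hr ▸ ⟨r', m', G', addr, rfl, h'⟩⟩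
  | sea3 C x v S E E' hv =>
    obtain ⟨r', m', G', hr, h'⟩ := sim_sea3 hv h hwf
    exact ⟨29, by simp, by simp [cost], hr ▸ ⟨r', m', G', addr, rfl, h'⟩⟩
  | sk C x v w F S E E' hdec hnd hfr =>
    obtain ⟨T, r', m', G', addr', hr, hT, hT', h'⟩ := sim_sk h hwf hdec hnd hfr
    exact ⟨T, hT, by simp only [cost]; omega, hr ▸ ⟨r', m', G', addr', rfl, h'⟩⟩
  | ss C x v w S E E' hv hα hwb hfr =>
    obtain ⟨T, r', m', G', addr', hr, hT, hT', h'⟩ := sim_ss h hwf hα hwb hfr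
    exact ⟨T, hT, by simp only [cost]; omega, hr ▸ ⟨r', m', G', addr', rfl, h'⟩⟩

/-! ### Amortized cost -/

def Entry.esSize : Entry → ℕ
  | .es _ t => t.size
  | .skel _ _ => 0

/-- The size of the terms that have not been copied. -/
def State.load (Q : State) : ℕ :=
  Q.code.size + (Q.stack.map PTerm.size).sum + (Q.env.map Entry.esSize).sum +
    (Q.chain.map fun i => (i.stack.map PTerm.size).sum + (i.env.map Entry.esSize).sum).sum

/-- The number of transitions that a lookup of the entry causes, up to a constant. -/
def Entry.weight : Entry → ℕ
  | .skel _ _ => 1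
  | .es _ (.lam _ _) => 2
  | .es _ _ => 5

/-- The value `5` is the maximal weight of an entry, so the empty case does not spoil the uniform
bound. -/
def lookupWeight (x : ℕ) : List Entry → ℕ
  | [] => 5
  | e :: E => if e.name = x then e.weight else lookupWeight x E

/-- An abstraction facing an empty stack can cause one $\mathsf{sea}_3$, one $\mathsf{sk}$ and one
$\mathsf{ss}$ before the stack of the top chain item is met. -/
def emptyWeight : List PTerm → ℕ
  | [] => 3
  | _ :: _ => 0

/-- An application is searched until a variable or an abstraction faces a non-empty stack, so only a
lookup, of weight at most `5`, can follow it. -/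
def codeWeight (S : List PTerm) (E : List Entry) : PTerm → ℕ
  | .var x => lookupWeight x E + emptyWeight S
  | .lam _ _ => emptyWeight S
  | .app _ _ => 5

/-- Entering such an entry by $\mathsf{sea}_2$ puts another variable in front of an empty stack,
which costs the weight `3` of that stack. The entry carries this amount until then and returns as a
value, with weight `0`. -/
def Entry.varWeight : Entry → ℕ
  | .es _ (.var _) => 3
  | _ => 0

/-- A bound on the number of transitions before the next `β`-transition that copy terms. -/
def State.weight (Q : State) : ℕ :=
  codeWeight Q.stack Q.env Q.code + (Q.env.map Entry.varWeight).sum +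
    (Q.chain.map fun i => emptyWeight i.stack + (i.env.map Entry.varWeight).sum).sum

/-- A constant-time transition costs at most `29` and is paid by one construct of the load. An
$\mathsf{ss}$ costs at most `167 * n` and adds at most `29 * n` through the load, hence `196 * n`
for each unit of weight. -/
def State.potential (n : ℕ) (Q : State) : ℕ := 29 * Q.load + 196 * n * Q.weight

theorem lookupWeight_le (x : ℕ) (E : List Entry) : lookupWeight x E ≤ 5 := by
  induction E with
  | nil => simp [lookupWeight]
  | cons e E ih =>
    rw [lookupWeight]
    split_ifs
    · rcases e with ⟨y, _ | _ | _⟩ | _ <;> simp [Entry.weight]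
    · exact ih

theorem lookupWeight_append {x : ℕ} {e : Entry} {E E' : List Entry} (he : e.name = x)
    (hE : ∀ e' ∈ E, e'.name ≠ x) : lookupWeight x (E ++ e :: E') = e.weight := by
  induction E with
  | nil => simp [lookupWeight, he]
  | cons e' E ih =>
    rw [List.cons_append, lookupWeight, if_neg (hE e' (by simp))]
    exact ih fun e he => hE e (by simp [he])

theorem codeWeight_le (S : List PTerm) (E : List Entry) (t : PTerm) :
    codeWeight S E t ≤ 5 + emptyWeight S := by
  cases t with
  | var x => have := lookupWeight_le x E; simp only [codeWeight]; omega
  | lam x t => simp [codeWeight]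
  | app t u => simp [codeWeight]

theorem codeWeight_lam (S : List PTerm) (E : List Entry) (x : ℕ) (t : PTerm) :
    codeWeight S E (.lam x t) = emptyWeight S := rfl

theorem emptyWeight_cons (t : PTerm) (S : List PTerm) : emptyWeight (t :: S) = 0 := rfl

theorem emptyWeight_le (S : List PTerm) : emptyWeight S ≤ 3 := by
  cases S <;> simp [emptyWeight]

/-- Extracted terms are not variables, so $\mathsf{sk}$ adds no entry that would lead from one
variable to another. -/
theorem fleshEnv_varWeight {θ : Finset ℕ} {t u : PTerm} {F : List (ℕ × PTerm)}
    (h : PTerm.SkelDec θ t u F) : ((fleshEnv F).map Entry.varWeight).sum = 0 := by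
  have := h.flesh
  clear h
  induction F with
  | nil => rfl
  | cons p F ih =>
    obtain ⟨z, s⟩ := p
    have h1 := (this (z, s) (by simp)).1
    have h2 := ih fun q hq => this q (by simp [hq])
    simp only [fleshEnv, List.map_cons, List.sum_cons] at h2 ⊢
    rw [h2]
    cases s <;> simp_all [Entry.varWeight, PTerm.IsVar]

theorem fleshEnv_esSize (F : List (ℕ × PTerm)) :
    ((fleshEnv F).map Entry.esSize).sum = (F.map fun p => p.2.size).sum := by
  simp [fleshEnv, Function.comp_def, Entry.esSize]

/-- The weight does not increase along $\mathsf{sea}_1$ and $\mathsf{sea}_2$ and drops along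
$\mathsf{sea}_3$, $\mathsf{sk}$ and $\mathsf{ss}$. A $\beta$ may raise it by `11`: up to `5 + 3` for
the new code and its stack, and `3` for the new entry. This gives `2156 = 11 * 196`. -/
theorem potential_step {n : ℕ} {a : Label} {Q Q' : State} (hwf : WF n Q) (hwf' : WF n Q')
    (hs : Step a Q Q') :
    cost n a + Q'.potential n ≤ Q.potential n + if a = .beta then 2156 * n else 0 := by
  have hn := hwf.pos
  cases hs with
  | sea1 C t u S E =>
    have h1 : State.load ⟨C, t, u :: S, E⟩ + 1 = State.load ⟨C, .app t u, S, E⟩ := by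
      simp only [State.load, PTerm.size, List.map_cons, List.sum_cons]; omega
    have h2 : State.weight ⟨C, t, u :: S, E⟩ ≤ State.weight ⟨C, .app t u, S, E⟩ := by
      have := codeWeight_le (u :: S) E t
      simp only [State.weight, codeWeight, emptyWeight] at this ⊢; omega
    have h3 := Nat.mul_le_mul_left (196 * n) h2
    simp only [State.potential, cost, reduceCtorEq, if_false]
    omega
  | beta C x t u S E =>
    have h1 : State.load ⟨C, t, S, .es x u :: E⟩ + 1 = State.load ⟨C, .lam x t, u :: S, E⟩ := by
      simp only [State.load, PTerm.size, List.map_cons, List.sum_cons, Entry.esSize]; omega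
    have h2 : State.weight ⟨C, t, S, .es x u :: E⟩ ≤ State.weight ⟨C, .lam x t, u :: S, E⟩ + 11 := by
      have h3 := codeWeight_le S (.es x u :: E) t
      have h4 := emptyWeight_le S
      have h5 : (Entry.es x u).varWeight ≤ 3 := by cases u <;> simp [Entry.varWeight]
      simp only [State.weight, codeWeight_lam, emptyWeight_cons, List.map_cons, List.sum_cons]
      omega
    have h3 := Nat.mul_le_mul_left (196 * n) h2
    rw [Nat.mul_add] at h3
    simp only [State.potential, cost, if_true]
    omega
  | sea2 C x t S E E' ht =>
    have hx : lookupWeight x (E ++ .es x t :: E') = (Entry.es x t).weight :=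
      lookupWeight_append rfl (hwf.name_ne rfl).1
    have h1 : State.load ⟨⟨x, S, E⟩ :: C, t, [], E'⟩ + 1 =
        State.load ⟨C, .var x, S, E ++ .es x t :: E'⟩ := by
      simp only [State.load, PTerm.size, List.map_cons, List.sum_cons, Entry.esSize,
        List.map_append, List.sum_append, List.map_nil, List.sum_nil]
      omega
    have h2 : State.weight ⟨⟨x, S, E⟩ :: C, t, [], E'⟩ ≤
        State.weight ⟨C, .var x, S, E ++ .es x t :: E'⟩ := by
      simp only [State.weight, codeWeight, hx, List.map_cons, List.sum_cons, List.map_append,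
        List.sum_append]
      cases t with
      | var y =>
        have := lookupWeight_le y E'
        simp only [Entry.weight, Entry.varWeight, emptyWeight]
        omega
      | lam y t => exact absurd trivial ht
      | app t u =>
        simp only [Entry.weight, Entry.varWeight]
        omega
    have h3 := Nat.mul_le_mul_left (196 * n) h2
    simp only [State.potential, cost, reduceCtorEq, if_false]
    omega
  | sea3 C x v S E E' hv =>
    -- The entry of `x` exists only in the target state, so its uniqueness is taken from the
    -- invariant of the target.
    have hx : lookupWeight x (E ++ .es x v :: E') = (Entry.es x v).weight :=
      lookupWeight_append rfl (hwf'.name_ne rfl).1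
    have h1 : State.load ⟨⟨x, S, E⟩ :: C, v, [], E'⟩ + 1 =
        State.load ⟨C, .var x, S, E ++ .es x v :: E'⟩ := by
      simp only [State.load, PTerm.size, List.map_cons, List.sum_cons, Entry.esSize,
        List.map_append, List.sum_append, List.map_nil, List.sum_nil]
      omega
    have h2 : State.weight ⟨C, .var x, S, E ++ .es x v :: E'⟩ + 1 ≤
        State.weight ⟨⟨x, S, E⟩ :: C, v, [], E'⟩ := by
      simp only [State.weight, codeWeight, hx, List.map_cons, List.sum_cons, List.map_append,
        List.sum_append]
      cases v with
      | lam y t =>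
        simp only [Entry.weight, Entry.varWeight, emptyWeight]
        omega
      | var y | app t u => exact hv.elim
    have h3 := Nat.mul_le_mul_left (196 * n) h2
    rw [Nat.mul_add] at h3
    simp only [State.potential, cost, reduceCtorEq, if_false]
    omega
  | sk C x v w F S E E' hdec hnd hfr =>
    have hx : lookupWeight x (E ++ .es x v :: E') = (Entry.es x v).weight :=
      lookupWeight_append rfl (hwf.name_ne rfl).1
    have hx' : lookupWeight x (E ++ .skel x w :: (fleshEnv F ++ E')) = (Entry.skel x w).weight :=
      lookupWeight_append rfl (hwf.name_ne rfl).1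
    obtain ⟨y, t, u, F, hdec⟩ := hdec
    have h1 : State.load ⟨C, .var x, S, E ++ .skel x (.lam y u) :: (fleshEnv F ++ E')⟩ ≤
        State.load ⟨C, .var x, S, E ++ .es x (.lam y t) :: E'⟩ := by
      have := hdec.size_le.2
      simp only [State.load, PTerm.size, List.map_cons, List.sum_cons, Entry.esSize,
        List.map_append, List.sum_append, fleshEnv_esSize]
      omega
    have h2 : State.weight ⟨C, .var x, S, E ++ .skel x (.lam y u) :: (fleshEnv F ++ E')⟩ + 1 ≤
        State.weight ⟨C, .var x, S, E ++ .es x (.lam y t) :: E'⟩ := by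
      simp only [State.weight, codeWeight, hx, hx', List.map_cons, List.sum_cons, List.map_append,
        List.sum_append, fleshEnv_varWeight hdec, Entry.weight, Entry.varWeight]
      omega
    have h3 := Nat.mul_le_mul_left (196 * n) h2
    rw [Nat.mul_add] at h3
    simp only [State.potential, cost, reduceCtorEq, if_false]
    omega
  | ss C x v w S E E' hv hα hwb hfr =>
    have hx : lookupWeight x (E ++ .skel x v :: E') = (Entry.skel x v).weight :=
      lookupWeight_append rfl (hwf.name_ne rfl).1
    have h1 : State.load ⟨C, w, S, E ++ .skel x v :: E'⟩ ≤
        State.load ⟨C, .var x, S, E ++ .skel x v :: E'⟩ + n := by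
      have := hwf'.code.1
      simp only [State.load, PTerm.size] at this ⊢
      omega
    have h2 : State.weight ⟨C, w, S, E ++ .skel x v :: E'⟩ + 1 ≤
        State.weight ⟨C, .var x, S, E ++ .skel x v :: E'⟩ := by
      have := hα.isValue hv
      cases w with
      | lam y t =>
        simp only [State.weight, codeWeight, hx, Entry.weight]
        omega
      | var y | app t u => exact this.elim
    have h3 := Nat.mul_le_mul_left (196 * n) h2
    rw [Nat.mul_add] at h3
    simp only [State.potential, cost, reduceCtorEq, if_false]
    omega

end SMAD

/-! ### Invariance of the serialization; existence of fresh decompositions and renamings -/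

namespace PTerm

theorem AlphaVar.idxOf_eq {x y : ℕ} : ∀ {l : List (ℕ × ℕ)}, AlphaVar l x y →
    (l.map Prod.fst).idxOf x = (l.map Prod.snd).idxOf y
  | [], _ => by simp
  | (a, b) :: l, h => by
    rcases h with ⟨rfl, rfl⟩ | ⟨h1, h2, h3⟩
    · simp
    · rw [List.map_cons, List.map_cons, List.idxOf_cons_ne _ (Ne.symm h1),
        List.idxOf_cons_ne _ (Ne.symm h2), h3.idxOf_eq]

theorem AlphaIn.encodeIn_eq {u : PTerm} : ∀ {t : PTerm} {l : List (ℕ × ℕ)}, AlphaIn l u t →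
    encodeIn (l.map Prod.fst) u = encodeIn (l.map Prod.snd) t := by
  induction u with
  | var x =>
    rintro (y | _ | _) l h <;> simp only [AlphaIn] at h
    simp only [encodeIn, h.idxOf_eq]
  | lam x u ih =>
    rintro (_ | ⟨y, t⟩ | _) l h <;> simp only [AlphaIn] at h
    simpa [encodeIn] using ih h
  | app u u' ih ih' =>
    rintro (_ | _ | ⟨t, t'⟩) l h <;> simp only [AlphaIn] at h
    simp [encodeIn, ih h.1, ih' h.2]

theorem Alpha.encode_eq {u t : PTerm} (h : Alpha u t) : u.encode = t.encode :=
  AlphaIn.encodeIn_eq h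

/-- New names are drawn from consecutive intervals, the second child of an application starting
where the first one ended. Existence is needed only for progress: without it a lookup could be
stuck. -/
theorem exists_skelDec (t : PTerm) : ∀ (θ : Finset ℕ) (N : ℕ), ∃ M, N ≤ M ∧ ∃ w F,
    SkelDec θ t w F ∧ (F.map Prod.fst).Nodup ∧ ∀ z ∈ F.map Prod.fst, N ≤ z ∧ z < M := by
  have hext : ∀ (t : PTerm) (θ : Finset ℕ) (N : ℕ), Disjoint t.fv θ → ¬ t.IsVar → ∃ M, N ≤ M ∧
      ∃ w F, SkelDec θ t w F ∧ (F.map Prod.fst).Nodup ∧ ∀ z ∈ F.map Prod.fst, N ≤ z ∧ z < M :=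
    fun t θ N h1 h2 => ⟨N + 1, by omega, .var N, [(N, t)], .extract θ t N h1 h2, by simp, by simp⟩
  induction t with
  | var x => exact fun θ N => ⟨N, le_rfl, .var x, [], .var θ x, by simp, by simp⟩
  | lam x t ih =>
    intro θ N
    by_cases h : Disjoint (lam x t).fv θ
    · exact hext _ θ N h (by simp [IsVar])
    · obtain ⟨M, hM, w, F, h1, h2, h3⟩ := ih (insert x θ) N
      exact ⟨M, hM, .lam x w, F, .lam θ x t w F h h1, h2, h3⟩
  | app t u iht ihu =>
    intro θ N
    by_cases h : Disjoint (app t u).fv θ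
    · exact hext _ θ N h (by simp [IsVar])
    · obtain ⟨M, hM, w, F, h1, h2, h3⟩ := iht θ N
      obtain ⟨M', hM', w', F', h1', h2', h3'⟩ := ihu θ M
      refine ⟨M', hM.trans hM', .app w w', F ++ F', .app θ t u w w' F F' h h1 h1', ?_, ?_⟩
      · rw [List.map_append, List.nodup_append]
        refine ⟨h2, h2', fun a ha b hb hab => ?_⟩
        have := h3 a ha
        have := h3' b hb
        omega
      · intro z hz
        rw [List.map_append, List.mem_append] at hz
        rcases hz with hz | hz
        · have := h3 z hz
          omega
        · have := h3' z hz
          omega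

/-- The images of the free variables are below `N` and the new binders are at least `N`, so no
variable is captured. -/
theorem exists_alphaIn (t : PTerm) : ∀ (l : List (ℕ × ℕ)) (N : ℕ),
    (∀ y ∈ t.fv, ∃ x < N, AlphaVar l x y) → ∃ M, N ≤ M ∧ ∃ w, AlphaIn l w t ∧
      w.binders.Nodup ∧ ∀ z ∈ w.binders, N ≤ z ∧ z < M := by
  induction t with
  | var y =>
    intro l N h
    obtain ⟨x, -, hx⟩ := h y (by simp [fv])
    exact ⟨N, le_rfl, .var x, hx, by simp [binders], by simp [binders]⟩
  | lam y t ih =>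
    intro l N h
    obtain ⟨M, hM, w, h1, h2, h3⟩ := ih ((N, y) :: l) (N + 1) fun z hz => by
      by_cases hzy : z = y
      · exact ⟨N, by omega, .inl ⟨rfl, hzy⟩⟩
      · obtain ⟨x, hx, hxz⟩ := h z (by simp [fv, hz, hzy])
        exact ⟨x, by omega, .inr ⟨hx.ne, hzy, hxz⟩⟩
    refine ⟨M, by omega, .lam N w, h1, ?_, ?_⟩
    · rw [binders, List.nodup_cons]
      exact ⟨fun hN => by have := h3 N hN; omega, h2⟩
    · intro z hz
      rw [binders, List.mem_cons] at hz
      rcases hz with rfl | hz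
      · omega
      · have := h3 z hz
        omega
  | app t u iht ihu =>
    intro l N h
    obtain ⟨M, hM, w, h1, h2, h3⟩ := iht l N fun y hy => h y (by simp [fv, hy])
    obtain ⟨M', hM', w', h1', h2', h3'⟩ := ihu l M fun y hy => by
      obtain ⟨x, hx, hxy⟩ := h y (by simp [fv, hy])
      exact ⟨x, by omega, hxy⟩
    refine ⟨M', hM.trans hM', .app w w', ⟨h1, h1'⟩, ?_, ?_⟩
    · rw [binders, List.nodup_append]
      refine ⟨h2, h2', fun a ha b hb hab => ?_⟩
      have := h3 a ha
      have := h3' b hb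
      omega
    · intro z hz
      rw [binders, List.mem_append] at hz
      rcases hz with hz | hz
      · have := h3 z hz
        omega
      · have := h3' z hz
        omega

end PTerm

/-! ### Final states, the initial phase, and the total time -/

namespace SMAD
open RAM

theorem exists_fresh (L : List ℕ) : ∃ N, ∀ z, N ≤ z → z ∉ L :=
  ⟨L.sum + 1, fun z hz hzL => by have := List.le_sum_of_mem hzL; omega⟩

/-- Progress: every variable in the code has an entry, so a lookup always allows $\mathsf{sea}_2$,
$\mathsf{sk}$ or $\mathsf{ss}$. Thus the only state without a transition is the one that makes the
program leave through its last jump. -/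
theorem Final.eq {n : ℕ} {Q : State} (hwf : WF n Q) (h : Final Q) :
    ∃ x t E, Q = ⟨[], .lam x t, [], E⟩ := by
  obtain ⟨C, c, S, E⟩ := Q
  cases c with
  | app t u => exact absurd (.sea1 C t u S E) (h _ _)
  | lam x t =>
    cases S with
    | cons u S => exact absurd (.beta C x t u S E) (h _ _)
    | nil =>
      cases C with
      | cons i C => exact absurd (.sea3 C i.name _ i.stack i.env E trivial) (h _ _)
      | nil => exact ⟨x, t, E, rfl⟩
  | var x =>
    exfalso
    obtain ⟨e, he, hx⟩ := List.mem_map.1 (hwf.code.2 x (by simp [PTerm.fv]))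
    obtain ⟨E₁, E₂, rfl⟩ := List.append_of_mem he
    have hok := (EnvOK.append.1 hwf.env).2
    obtain ⟨N, hN⟩ := exists_fresh (State.names ⟨C, .var x, S, E₁ ++ e :: E₂⟩)
    cases e with
    | es y t =>
      simp only [Entry.name] at hx
      subst hx
      by_cases ht : t.IsValue
      · cases t with
        | var _ | app _ _ => exact ht
        | lam z t =>
          obtain ⟨M, -, w, F, h1, h2, h3⟩ := t.exists_skelDec {z} N
          exact h _ _ (.sk C y _ _ F S E₁ E₂ (.mk z t w F h1) h2 fun a ha => hN a (h3 a ha).1)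
      · exact h _ _ (.sea2 C y t S E₁ E₂ ht)
    | skel y v =>
      simp only [Entry.name] at hx
      subst hx
      obtain ⟨M, -, w, h1, h2, h3⟩ := v.exists_alphaIn [] N fun y hy => by
        refine ⟨y, not_le.1 fun hNy => hN y hNy ?_, rfl⟩
        simp [State.names, Entry.names, PTerm.mem_names_iff, hy]
      exact h _ _ (.ss C y v w S E₁ E₂ (hok.2.1 rfl) h1 h2 fun a ha => hN a (h3 a ha).1)

theorem Match.halt {n : ℕ} {Q : State} {c : Config} (h : Match n Q c) (hwf : WF n Q)
    (hQ : Final Q) : Represents (run prog c 10) Q ∧ Halted prog (run prog c 10) := by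
  obtain ⟨r, m, G, addr, rfl, h⟩ := h
  obtain ⟨x, t, E, rfl⟩ := hQ.eq hwf
  obtain ⟨h0, h1, q, h2, h3⟩ := h.code
  have hi := h.heap
  have hc := h.consts
  have hs : r 2 = 0 := h.stack
  have hch : r 0 = 0 := h.chain
  obtain ⟨r', hr, e0, e1, e2, e3⟩ : ∃ r', run prog ⟨93, r, m⟩ 10 = ⟨294, r', m⟩ ∧ r' 0 = r 0 ∧
      r' 1 = r 1 ∧ r' 2 = r 2 ∧ r' 3 = r 3 := by
    simp [run_succ, run_zero, hc.h6, hi.sub _ _ h0, hs, hch]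
  rw [hr]
  refine ⟨?_, by simp [Halted, length_prog]⟩
  obtain ⟨addr, g1, g2, g3, g4, g5⟩ := h.represents (pc := 294)
  exact ⟨addr, g1, by simpa only [e0] using g2, by simpa only [e1] using g3,
    by simpa only [e2] using g4, by simpa only [e3] using g5⟩

theorem Initial.wf {t : PTerm} (ht : t.fv = ∅) {Q : State} (h : Initial t Q) : WF t.size Q := by
  obtain ⟨u, hα, hwb, rfl⟩ := h
  refine ⟨by simpa [State.bnd, PTerm.WellBound] using hwb, trivial, ⟨(PTerm.AlphaIn.size_eq hα).le, fun y hy => ?_⟩,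
    by simp, trivial⟩
  have := hα.fv_subset hy
  simp [ht] at this

theorem Initial.potential {t : PTerm} {Q : State} (h : Initial t Q) :
    Q.potential t.size ≤ 1597 * t.size := by
  obtain ⟨u, hα, hwb, rfl⟩ := h
  have h1 := PTerm.AlphaIn.size_eq hα
  have h2 : State.weight ⟨[], u, [], []⟩ ≤ 8 := by
    simpa [State.weight, emptyWeight] using codeWeight_le [] [] u
  have h3 := Nat.mul_le_mul_left (196 * t.size) h2
  simp only [State.potential, State.load, List.map_nil, List.sum_nil, h1]
  omega

/-- The heap starts at `4 * t.size`, which is positive, aligned and above the input. The input is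
the serialization of `t`, but it equals that of the renaming `u` chosen by the run. Reading costs
`64` per construct, and the `8 + 2` instructions around it are absorbed by one construct. -/
theorem Initial.match {t : PTerm} (ht : t.fv = ∅) {Q : State} (h : Initial t Q) :
    ∃ T ≤ 74 * t.size, Match t.size Q (run prog (start t.encode) T) := by
  obtain ⟨u, hα, hwb, rfl⟩ := h
  have hsz := PTerm.AlphaIn.size_eq hα
  have hfv : u.fv = ∅ := by
    refine Finset.eq_empty_of_forall_notMem fun x hx => ?_
    have := hα.fv_subset hx
    simp [ht] at this
  have hlen : t.encode.length = t.size := PTerm.length_encodeIn t []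
  have hpos := t.size_pos
  set m := (start t.encode).mem
  obtain ⟨r1, hr1, e0, e2, e3, e4, e5, e6, e7, e8, e9, e10, e14, e15, e20, e21⟩ : ∃ r',
      run prog (start t.encode) 8 = ⟨8, r', m⟩ ∧ r' 0 = 0 ∧ r' 2 = 0 ∧ r' 3 = 0 ∧
      r' 4 = 4 * t.size ∧ r' 5 = t.size ∧ r' 6 = 1 ∧ r' 7 = 2 ∧ r' 8 = 3 ∧ r' 9 = 4 ∧
      r' 10 = 0 ∧ r' 14 = 0 ∧ r' 15 = 0 ∧ r' 20 = 0 ∧ r' 21 = 0 := by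
    simp [start, run_succ, run_zero, hlen, m]
    omega
  have hc : Consts r1 := ⟨e6, e7, e8, e9, e21⟩
  have hi : HeapInv (fun _ => none) (r1 4) m := ⟨by simp, by simp, by omega, by omega⟩
  obtain ⟨T, r2, m2, G2, addr, hr2, hT, hst, k10, -, -, hf, htu⟩ := parse_run t.size u [] r1 m
    (fun _ => none) id hi hc e20 (by simp) (by omega) (by omega) (by simpa using e15) (by omega)
    ⟨hwb, by simp [hfv]⟩ (by
      intro i v hv
      have : PTerm.encodeIn [] u = t.encode := hα.encode_eq
      rw [this] at hv
      simp [m, start, e14, hv]) (by simp [hfv])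
  have hk := hst.keep
  have hr3 : run prog ⟨41, r2, m2⟩ 2 = ⟨93, update r2 1 (r2 12), m2⟩ := by
    simp [run_succ, run_zero, k10, e10]
  obtain ⟨hcell, hinj⟩ := hf.cells (L := []) (L' := State.names ⟨[], u, [], []⟩) hst.grow
    (fun x hx => by simpa [State.names, PTerm.mem_names_iff, hfv] using hx) (by simp) (by simp)
    (by simp)
  refine ⟨8 + (T + 2), by omega, ?_⟩
  rw [run_trans hr1 (run_trans hr2 hr3)]
  exact ⟨_, _, G2, addr, rfl, hst.inv, (hc.keep hk).of_eq rfl rfl rfl rfl rfl,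
    (hk 5 (by simp [kept])).trans e5, hcell, hinj, by simp [State.dom],
    (hk 0 (by simp [kept])).trans e0, htu, (hk 2 (by simp [kept])).trans e2,
    (hk 3 (by simp [kept])).trans e3⟩

/-- The predicate contains the time bound, so the times have to be chosen along the run and not
state by state. -/
theorem exists_strictMono {N : ℕ} (P : Fin (N + 1) → ℕ → Prop) {t₀ : ℕ} (h₀ : P 0 t₀)
    (hs : ∀ (i : Fin N) (t : ℕ), P i.castSucc t → ∃ t', t < t' ∧ P i.succ t') :
    ∃ f : Fin (N + 1) → ℕ, (∀ i, P i (f i)) ∧ StrictMono f := by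
  choose g hg hg' using hs
  let F : (i : Fin (N + 1)) → {t // P i t} :=
    Fin.induction ⟨t₀, h₀⟩ fun i t => ⟨g i t.1 t.2, hg' i t.1 t.2⟩
  refine ⟨fun i => (F i).1, fun i => (F i).2, Fin.strictMono_iff_lt_succ.2 fun i => ?_⟩
  have : F i.succ = ⟨g i (F i.castSucc).1 (F i.castSucc).2, hg' i _ _⟩ := by
    simp [F]
  simp only [this]
  exact hg i _ _

/-- The number of `β`-transitions before the `i`-th state. -/
def Run.betaBefore (r : Run) (i : Fin (r.length + 1)) : ℕ :=
  ((Finset.univ.filter fun j => r.label j = .beta).filter fun j => j.castSucc < i).card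

theorem Run.betaBefore_succ (r : Run) (i : Fin r.length) :
    r.betaBefore i.castSucc + (if r.label i = .beta then 1 else 0) ≤ r.betaBefore i.succ := by
  have hsub : ((Finset.univ.filter fun j => r.label j = .beta).filter
      fun j => j.castSucc < i.castSucc) ⊆ ((Finset.univ.filter fun j => r.label j = .beta).filter
      fun j => j.castSucc < i.succ) := by
    intro j hj
    simp only [Finset.mem_filter, Finset.mem_univ, true_and] at hj ⊢
    exact ⟨hj.1, hj.2.trans i.castSucc_lt_succ⟩
  split_ifs with h
  · refine Finset.card_lt_card ((Finset.ssubset_iff_of_subset hsub).2 ⟨i, ?_, ?_⟩)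
    · simp [h]
    · simp
  · exact Finset.card_le_card hsub

theorem Run.betaBefore_le (r : Run) (i : Fin (r.length + 1)) : r.betaBefore i ≤ r.count .beta :=
  Finset.card_filter_le _ _

theorem implements {t : PTerm} (ht : t.fv = ∅) {r : Run} (hr : Initial t r.first) :
    Implements prog t r (2156 * (t.size * (r.count .beta + 1))) := by
  obtain ⟨T₀, hT₀, hm₀⟩ := hr.match ht
  have hwf : ∀ i, WF t.size (r.state i) :=
    Fin.induction (hr.wf ht) fun i h => h.step (r.step i)
  have hpos := t.size_pos
  obtain ⟨f, hf, hmono⟩ := exists_strictMono (N := r.length) (fun i T =>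
      Match t.size (r.state i) (run prog (start t.encode) T) ∧
        -- Here `1671 = 74 + 1597`: the time of the initial phase plus the initial potential.
        T + (r.state i).potential t.size ≤ 1671 * t.size + 2156 * t.size * r.betaBefore i)
    ⟨hm₀, by have : State.potential t.size (r.state 0) ≤ _ := hr.potential
             omega⟩ (by
      rintro i T ⟨h1, h2⟩
      obtain ⟨T', hT, hT', h3⟩ := h1.step (hwf _) (r.step i)
      refine ⟨T + T', by omega, by rwa [run_add], ?_⟩
      have h4 := potential_step (hwf _) (hwf _) (r.step i)
      have h5 := Nat.mul_le_mul_left (2156 * t.size) (r.betaBefore_succ i)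
      rw [Nat.mul_add] at h5
      split_ifs at h4 h5 <;> omega)
  classical
  -- Only the last state can be final. There the chosen time is delayed by the ten instructions that
  -- reach the exit, during which the represented state does not change; the difference between
  -- `2156` and `1671` covers them.
  refine ⟨fun i => f i + if Final (r.state i) then 10 else 0, ?_, fun i => ?_, ?_, fun h => ?_⟩
  · refine Fin.strictMono_iff_lt_succ.2 fun i => ?_
    have h1 : ¬ Final (r.state i.castSucc) := fun h => h _ _ (r.step i)
    have := hmono i.castSucc_lt_succ
    rw [if_neg h1]
    omega
  · by_cases h : Final (r.state i)
    · simp only [if_pos h, run_add]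
      exact ((hf i).1.halt (hwf i) h).1
    · simp only [if_neg h]
      exact (hf i).1.represents
  · have h1 := (hf (Fin.last _)).2
    have h2 := Nat.mul_le_mul_left (2156 * t.size) (r.betaBefore_le (Fin.last _))
    rw [← Nat.mul_assoc, Nat.mul_add]
    dsimp only
    split_ifs <;> omega
  · have h : Final (r.state (Fin.last _)) := h
    simp only [if_pos h, run_add]
    exact ((hf _).1.halt (hwf _) h).2

end SMAD

theorem mainTheorem2 :
    ∃ (P : RAM.Program) (c : ℕ), ∀ (t : PTerm), t.fv = ∅ →
      ∀ (r : SMAD.Run), SMAD.Initial t r.first →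
        SMAD.Implements P t r (c * (t.size * (r.count SMAD.Label.beta + 1))) :=
  ⟨RAM.prog, 2156, fun _ ht _ hr => SMAD.implements ht hr⟩
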